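/- **Refined Arthurs–Kelly relation.** Let $\sigma,\sigma_{i}>0$, $\bar t_{i},\bar\omega_{i}\in\mathbb R$ and $\kappa\in[0,1)$ be known. For $\theta=(\bar t,\bar\omega)\in\mathbb R^2$ let $\Psi_\theta\in L^2(\mathbb R^2)$ be the Gaussian biphoton state $$\Psi_\theta(t,t_i)=\mathcal N\exp\{-i\bar\omega(t-\bar t)-i\bar\omega_i(t_i-\bar t_i)-(t-\bar t)^2\sigma^2-(t_i-\bar t_i)^2\sigma_i^2+2\kappa(t-\bar t)(t_i-\bar t_i)\sigma\sigma_i\},$$ with $\mathcal N=\sqrt{2\sigma\sigma_i/\pi}\,(1-\kappa^2)^{1/4}$. The parameters to be estimated are the central time $\bar t$ and the central frequency $\bar\omega$. Let $F_Q$ be the quantum Fisher information matrix of $|\Psi_\theta\rangle\langle\Psi_\theta|$, and for a POVM $M$ on $L^2(\mathbb R^2)$ (with an arbitrary measurable outcome space) let $p_\theta(E)=\langle\Psi_\theta,M(E)\Psi_\theta\rangle$ be the outcome law and $F_C$ its classical Fisher information matrix, with entries $\int s_js_k\,dp_\theta$, where the score $s_j$ is the density of $\partial_{\theta_j}p_\theta$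 with respect to $p_\theta$. An estimator $(\hat t,\hat\omega)$, i.e. a pair of real measurable functions of the outcome, is called locally unbiased at $\theta$ if its second moments are bounded near $\theta$, its mean at $\theta$ is $\theta$, and the matrix of partial derivatives of its mean at $\theta$ is the identity; $\sigma_{\bar t},\sigma_{\bar\omega}$ denote the standard deviations of $\hat t,\hat\omega$ under $p_\theta$ (a single repetition of the measurement). Then the following hold. 1. For every $\theta$, $F_Q=\begin{pmatrix}4\sigma^2&0\\0&\frac1{\sigma^2(1-\kappa^2)}\end{pmatrix}$. 2. For every $\theta$ and every POVM, $F_C$ exists, is unique, and satisfies $\operatorname{Tr}(F_Q^{-1}F_C)\le 1+\kappa$. Consequently, for every estimator that is locally unbiased at $\theta$, $$\sigma_{\bar t}\,\sigma_{\bar\omega}\ \ge\ \sqrt{\frac{1-\kappa}{1+\kappa}}.$$ 3. Both bounds are attained: for every $\theta$ there are a projective measurement with finitely many outcomes for which $\operatorname{Tr}(F_Q^{-1}F_C)=1+\kappa$, and an estimator based on its outcome, locally unbiased at $\theta$, with $\sigma_{\bar t}\sigma_{\bar\omega}=\sqrt{(1-\kappa)/(1+\kappa)}$. 4. Put $r=\sigma_i/\sigma$.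 Both bounds are saturated, for all $\theta$ at once and with one estimator that does not depend on $\theta$, by the continuous-spectrum measurement of the time difference $t-r\,t_i$ and the frequency sum $\omega+\omega_i/r$ (that is, of $t-t_i$ and $\omega+\omega_i$ in the case $\sigma=\sigma_i$). This is the joint projective measurement of these commuting observables, and it is the unique POVM on $\mathbb R^2$ whose outcome $(x,\nu)$ has, in every state $\varphi\in L^1(\mathbb R^2)\cap L^2(\mathbb R^2)$, the density $\frac1{2\pi r}\bigl|\int_{\mathbb R} e^{i\nu y}\varphi\bigl(y,\tfrac{y-x}{r}\bigr)dy\bigr|^2$. 5. The bound $\sqrt{(1-\kappa)/(1+\kappa)}$ equals the Arthurs–Kelly value $1$ at $\kappa=0$ and tends to $0$ as $\kappa\to1^-$. -/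

import Mathlib

open MeasureTheory Filter Topology
open scoped InnerProductSpace ENNReal

namespace QuantumRadar

noncomputable section

/-! ### Measurements -/

/-- A positive operator-valued measure on the Hilbert space `H` with outcomes in the measurable
space `X`: `effect E` is the operator `M(E)` for a measurable set `E` of outcomes, and `E ↦ M(E)` is
countably additive in the weak operator topology. For `X = Fin n` this is a family
`M_m ≥ 0`, `∑ m, M_m = 1`. -/
structure POVM (X : Type*) [MeasurableSpace X] (H : Type*) [NormedAddCommGroup H]
    [InnerProductSpace ℂ H] [CompleteSpace H] where
  effect : Set X → (H →L[ℂ] H)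
  isPositive : ∀ E, MeasurableSet E → (effect E).IsPositive
  univ : effect Set.univ = 1
  hasSum : ∀ E : ℕ → Set X, (∀ n, MeasurableSet (E n)) → Pairwise (Function.onFun Disjoint E) →
    ∀ φ : H, HasSum (fun n => ⟪φ, effect (E n) φ⟫_ℂ) ⟪φ, effect (⋃ n, E n) φ⟫_ℂ

variable {X : Type*} [MeasurableSpace X] {H : Type*} [NormedAddCommGroup H]
  [InnerProductSpace ℂ H] [CompleteSpace H]

theorem POVM.hasSum_re (M : POVM X H) (φ : H) (E : ℕ → Set X) (hE : ∀ n, MeasurableSet (E n))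
    (hd : Pairwise (Function.onFun Disjoint E)) :
    HasSum (fun n => (⟪φ, M.effect (E n) φ⟫_ℂ).re) (⟪φ, M.effect (⋃ n, E n) φ⟫_ℂ).re :=
  Complex.hasSum_re (M.hasSum E hE hd φ)

theorem POVM.re_nonneg (M : POVM X H) (φ : H) (E : Set X) (hE : MeasurableSet E) :
    0 ≤ (⟪φ, M.effect E φ⟫_ℂ).re :=
  (M.isPositive E hE).re_inner_nonneg_right φ

theorem POVM.re_empty (M : POVM X H) (φ : H) : (⟪φ, M.effect ∅ φ⟫_ℂ).re = 0 := by
  have h := M.hasSum_re φ (fun _ => ∅) (fun _ => MeasurableSet.empty) (fun _ _ _ => by simp)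
  have h0 := h.summable.tendsto_atTop_zero
  exact tendsto_nhds_unique tendsto_const_nhds h0

/-- The law of the outcome when `M` is measured in the pure state `φ`:
`E ↦ Tr (M(E) |φ⟩⟨φ|) = ⟨φ, M(E) φ⟩`. -/
def POVM.prob (M : POVM X H) (φ : H) : Measure X :=
  Measure.ofMeasurable (fun E _ => ENNReal.ofReal (⟪φ, M.effect E φ⟫_ℂ).re)
    (by simp [M.re_empty φ])
    (by
      intro E hE hd
      have h := M.hasSum_re φ E hE hd
      rw [← h.tsum_eq, ENNReal.ofReal_tsum_of_nonneg (fun n => M.re_nonneg φ _ (hE n)) h.summable])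

theorem POVM.prob_apply (M : POVM X H) (φ : H) {E : Set X} (hE : MeasurableSet E) :
    M.prob φ E = ENNReal.ofReal (⟪φ, M.effect E φ⟫_ℂ).re :=
  Measure.ofMeasurable_apply E hE

/-- The measurement is projective: every effect is an (orthogonal) projection. -/
def POVM.IsProjective (M : POVM X H) : Prop :=
  ∀ E, MeasurableSet E → IsIdempotentElem (M.effect E)

/-! ### Classical and quantum Fisher information, locally unbiased estimators -/

variable {ι : Type*} [DecidableEq ι]

/-- `s` is the score of the model `p` at `θ` in the direction of the `j`-th parameter: the density
of the signed measure `∂_j p` with respect to `p θ`. For discrete outcomes,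
`s m = ∂_j p(m|θ) / p(m|θ)`. -/
def IsScore (p : (ι → ℝ) → Measure X) (θ : ι → ℝ) (j : ι) (s : X → ℝ) : Prop :=
  MemLp s 2 (p θ) ∧ ∀ E, MeasurableSet E →
    HasDerivAt (fun u : ℝ => (p (Function.update θ j u)).real E) (∫ x in E, s x ∂(p θ)) (θ j)

/-- `F` is the classical Fisher information matrix of the model `p` at `θ`. For discrete outcomes,
`F j k = ∑ m, ∂_j p(m|θ) ∂_k p(m|θ) / p(m|θ)`. -/
def IsCFIM (p : (ι → ℝ) → Measure X) (θ : ι → ℝ) (F : Matrix ι ι ℝ) : Prop :=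
  ∃ s : ι → X → ℝ, (∀ j, IsScore p θ j (s j)) ∧ ∀ j k, F j k = ∫ x, s j x * s k x ∂(p θ)

/-- The density operator `|φ⟩⟨φ|`. -/
def pureState (φ : H) : H →L[ℂ] H := InnerProductSpace.rankOne ℂ φ φ

/-- `L` is a symmetric logarithmic derivative of the pure-state family `ρ_θ = |Ψ_θ⟩⟨Ψ_θ|` at `θ`
for the `j`-th parameter: `L` is self-adjoint and `∂_j ρ_θ = (ρ_θ L + L ρ_θ) / 2`. -/
def IsSLD (Ψ : (ι → ℝ) → H) (θ : ι → ℝ) (j : ι) (L : H →L[ℂ] H) : Prop :=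
  IsSelfAdjoint L ∧
    HasDerivAt (fun u : ℝ => pureState (Ψ (Function.update θ j u)))
      ((1 / 2 : ℂ) • (pureState (Ψ θ) * L + L * pureState (Ψ θ))) (θ j)

/-- `F` is the quantum Fisher information matrix of the pure-state family `Ψ` at `θ`:
`F j k = (1/2) Tr (ρ_θ {L_j, L_k})`, where `Tr (|φ⟩⟨φ| A) = ⟨φ, A φ⟩`. -/
def IsQFIM (Ψ : (ι → ℝ) → H) (θ : ι → ℝ) (F : Matrix ι ι ℝ) : Prop :=
  ∃ L : ι → (H →L[ℂ] H), (∀ j, IsSLD Ψ θ j (L j)) ∧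
    ∀ j k, (F j k : ℂ) = (1 / 2 : ℂ) * ⟪Ψ θ, (L j * L k + L k * L j) (Ψ θ)⟫_ℂ

/-- `est` is an estimator of the parameter that is locally unbiased at `θ`, with second moments
bounded near `θ`. -/
structure IsLocallyUnbiased (p : (ι → ℝ) → Measure X) (θ : ι → ℝ) (est : ι → X → ℝ) : Prop where
  measurable : ∀ j, Measurable (est j)
  secondMoment : ∃ C : ℝ, ∀ᶠ η in 𝓝 θ, ∀ j,
    MemLp (est j) 2 (p η) ∧ ∫ x, est j x ^ 2 ∂(p η) ≤ C
  mean : ∀ j, ∫ x, est j x ∂(p θ) = θ j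
  hasDerivAt_mean : ∀ j k, HasDerivAt (fun u : ℝ => ∫ x, est j x ∂(p (Function.update θ k u)))
    (if j = k then 1 else 0) (θ k)

/-- The standard deviation of `f` under the probability law `P`. -/
def stdDev (P : Measure X) (f : X → ℝ) : ℝ := √(ProbabilityTheory.variance f P)

/-! ### The Gaussian biphoton -/

/-- The Hilbert space `L²(ℝ²)` of the pair (signal time `t`, idler time `t_i`). -/
abbrev BiphotonSpace : Type := Lp ℂ 2 (volume : Measure (ℝ × ℝ))

/-- The known data of the biphoton: bandwidth `σ` of the returned signal; bandwidth `σi`, central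
time `tI` and central frequency `ωI` of the idler; correlation `κ ∈ [0, 1)`. -/
structure Biphoton where
  σ : ℝ
  σi : ℝ
  tI : ℝ
  ωI : ℝ
  κ : ℝ
  σ_pos : 0 < σ
  σi_pos : 0 < σi
  κ_nonneg : 0 ≤ κ
  κ_lt_one : κ < 1

/-- The wave function; `θ 0` is the central time and `θ 1` the central frequency of the returned
signal photon, `z = (t, t_i)`. -/
def Biphoton.wave (B : Biphoton) (θ : Fin 2 → ℝ) (z : ℝ × ℝ) : ℂ :=
  ((√(2 * B.σ * B.σi / Real.pi) * (1 - B.κ ^ 2) ^ (1 / 4 : ℝ) : ℝ) : ℂ) *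
    Complex.exp (-Complex.I * (θ 1 : ℂ) * ((z.1 - θ 0 : ℝ) : ℂ)
      - Complex.I * (B.ωI : ℂ) * ((z.2 - B.tI : ℝ) : ℂ)
      + ((-(z.1 - θ 0) ^ 2 * B.σ ^ 2 - (z.2 - B.tI) ^ 2 * B.σi ^ 2
        + 2 * B.κ * (z.1 - θ 0) * (z.2 - B.tI) * B.σ * B.σi : ℝ) : ℂ))

theorem Biphoton.continuous_wave (B : Biphoton) (θ : Fin 2 → ℝ) : Continuous (B.wave θ) := by
  unfold Biphoton.wave
  fun_prop

theorem Biphoton.norm_wave (B : Biphoton) (θ : Fin 2 → ℝ) (z : ℝ × ℝ) :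
    ‖B.wave θ z‖ = |√(2 * B.σ * B.σi / Real.pi) * (1 - B.κ ^ 2) ^ (1 / 4 : ℝ)| *
      Real.exp (-(z.1 - θ 0) ^ 2 * B.σ ^ 2 - (z.2 - B.tI) ^ 2 * B.σi ^ 2
        + 2 * B.κ * (z.1 - θ 0) * (z.2 - B.tI) * B.σ * B.σi) := by
  unfold Biphoton.wave
  rw [norm_mul, Complex.norm_real, Real.norm_eq_abs, Complex.norm_exp]
  congr 2
  rw [Complex.add_re, Complex.ofReal_re, Complex.sub_re]
  simp [Complex.mul_re, Complex.mul_im]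

theorem Biphoton.memLp_wave (B : Biphoton) (θ : Fin 2 → ℝ) :
    MemLp (B.wave θ) 2 (volume : Measure (ℝ × ℝ)) := by
  rw [memLp_two_iff_integrable_sq_norm (B.continuous_wave θ).aestronglyMeasurable]
  set N := |√(2 * B.σ * B.σi / Real.pi) * (1 - B.κ ^ 2) ^ (1 / 4 : ℝ)| with hN
  have hκ : 0 < 1 - B.κ := sub_pos.2 B.κ_lt_one
  have h1 : Integrable (fun t : ℝ => Real.exp (-(2 * (1 - B.κ) * B.σ ^ 2) * (t - θ 0) ^ 2)) :=
    (integrable_exp_neg_mul_sq (by have := B.σ_pos; positivity)).comp_sub_right (θ 0)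
  have h2 : Integrable (fun t : ℝ => Real.exp (-(2 * (1 - B.κ) * B.σi ^ 2) * (t - B.tI) ^ 2)) :=
    (integrable_exp_neg_mul_sq (by have := B.σi_pos; positivity)).comp_sub_right B.tI
  refine ((h1.mul_prod h2).const_mul (N ^ 2)).mono'
    ((B.continuous_wave θ).norm.pow 2).aestronglyMeasurable (ae_of_all _ fun z => ?_)
  rw [Real.norm_of_nonneg (by positivity), B.norm_wave, mul_pow, ← Real.exp_nat_mul,
    ← Real.exp_add]
  refine mul_le_mul_of_nonneg_left (Real.exp_le_exp.2 ?_) (by positivity)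
  push_cast
  nlinarith [mul_nonneg B.κ_nonneg
    (sq_nonneg ((z.1 - θ 0) * B.σ - (z.2 - B.tI) * B.σi))]

/-- The state of the returned signal and the idler, as a function of the unknown parameter
`θ = (central time, central frequency)`. -/
def Biphoton.state (B : Biphoton) (θ : Fin 2 → ℝ) : BiphotonSpace :=
  (B.memLp_wave θ).toLp (B.wave θ)

/-- The family of outcome laws when the POVM `M` is measured on the biphoton. -/
def Biphoton.model (B : Biphoton) (M : POVM X BiphotonSpace) (θ : Fin 2 → ℝ) : Measure X :=
  M.prob (B.state θ)

/-- `M` is the continuous-spectrum joint measurement of the commuting observables `t - r t_i` (time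
difference) and `ω + ω_i / r` (frequency sum), where `ω = i ∂_t` and `ω_i = i ∂_{t_i}`, that is, the
projective measurement in their common generalized eigenvectors
`|x, ν⟩ = √(r / 2π) δ(t - r t_i - x) exp (-i ν t)`, so that the outcome `(x, ν)` has the density
`|⟨x, ν | φ⟩|² = (2 π r)⁻¹ |∫ exp (i ν y) φ(y, (y - x) / r) dy|²` in the state `φ`. The states
`φ ∈ L¹ ∩ L²` are dense, hence determine `M`. -/
def IsTimeFrequencyMeasurement (r : ℝ) (M : POVM (ℝ × ℝ) BiphotonSpace) : Prop :=
  ∀ φ : BiphotonSpace, Integrable (φ : ℝ × ℝ → ℂ) volume →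
    M.prob φ = (volume : Measure (ℝ × ℝ)).withDensity fun z =>
      ENNReal.ofReal ((2 * Real.pi * r)⁻¹ *
        ‖∫ y : ℝ, Complex.exp (Complex.I * (z.2 : ℂ) * (y : ℂ)) * φ (y, (y - z.1) / r)‖ ^ 2)

/-- The right-hand side of the refined Arthurs–Kelly relation. -/
def refinedBound (κ : ℝ) : ℝ := √((1 - κ) / (1 + κ))

end

end QuantumRadar

/-!
The derivatives of an outcome law `E ↦ ⟨Ψ, M(E) Ψ⟩` along a differentiable family of unit vectors
are `2 Re ⟨M(E) Ψ, ∂_j Ψ⟩`. By `POVM.exists_density` every complex measure `E ↦ ⟨M(E) Ψ, φ⟩` has a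
square-integrable density with respect to the outcome law, and the map from `φ` to the density is a
contraction. Hence scores exist for every measurement, without any dilation theorem, and the Fisher
information in the direction `φ` never exceeds its quantum value.

For the Gaussian biphoton, multiplication of the state by the two decorrelated coordinates yields an
orthonormal pair `e₀`, `e₁`, orthogonal to the state, in which the derivatives of the state are
computed (`Biphoton.hasDerivAt_state`). Up to normalisation and a multiple of the state, the two
tangent directions are `v₀ = e₀` and `v₁ = -i (√(1 - κ²) e₀ + κ e₁)`. This gives the quantum Fisher
information matrix. The trade-off is the triangle inequality for `s₀ + i s₁`, which is the mean of
the density belonging to `v₀ + i v₁` and of the conjugate of the density belonging to `v₀ - i v₁`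
(`POVM.integral_sq_add_integral_sq_le`): as these two vectors have the norms `√(2 ± 2 √(1 - κ²))`,
the total normalised information is at most `(√(2 + 2 √(1 - κ²)) + √(2 - 2 √(1 - κ²)))² / 4 = 1 + κ`.
The Cramér–Rao inequality for estimators with locally bounded second moments needs the derivative of
the mean of an unbounded function (`POVM.hasDerivAt_integral`). With the inequality of the
arithmetic and geometric means it turns the trade-off into the uncertainty relation; conversely an
estimator that attains the uncertainty relation forces equality in the trade-off
(`Biphoton.trace_eq_of_stdDev_mul_eq`), so that for the attainability statements only the variances
of estimators have to be computed.

The bounds are attained at a given parameter by measuring an orthonormal basis of the real span of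
the state and of two unit vectors of the tangent space, chosen such that each of them sees the
derivative in one parameter only (`Biphoton.optimalFrame`). They are attained at all parameters by
the joint measurement of time difference and frequency sum. Its amplitude is an isometry on
integrable wave functions by Plancherel's theorem on each line of constant time difference
(`lintegral_enorm_amplitude_sq`), and is extended by density; in the state of the biphoton the two
outcomes are independent Gaussians, whose means are the parameters up to known constants and whose
variances are `1 / (2 (1 + κ) σ²)` and `2 (1 - κ) σ²` (`Biphoton.prob_state_eq_lineLaw`).
-/

namespace QuantumRadar

/-! ### Outcome laws of a measurement -/

section Povm

variable {X : Type*} [MeasurableSpace X] {H : Type*} [NormedAddCommGroup H]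
  [InnerProductSpace ℂ H] [CompleteSpace H]

instance POVM.isFiniteMeasure_prob (M : POVM X H) (φ : H) : IsFiniteMeasure (M.prob φ) :=
  ⟨by rw [M.prob_apply φ MeasurableSet.univ]; exact ENNReal.ofReal_lt_top⟩

theorem POVM.prob_real (M : POVM X H) (φ : H) {E : Set X} (hE : MeasurableSet E) :
    (M.prob φ).real E = (⟪φ, M.effect E φ⟫_ℂ).re := by
  rw [measureReal_def, M.prob_apply φ hE, ENNReal.toReal_ofReal (M.re_nonneg φ E hE)]

theorem POVM.prob_real_univ (M : POVM X H) (φ : H) : (M.prob φ).real Set.univ = ‖φ‖ ^ 2 := by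
  rw [M.prob_real φ MeasurableSet.univ, M.univ]
  simpa using inner_self_eq_norm_sq (𝕜 := ℂ) φ

theorem POVM.inner_effect (M : POVM X H) {E : Set X} (hE : MeasurableSet E) (φ ψ : H) :
    ⟪M.effect E φ, ψ⟫_ℂ = ⟪φ, M.effect E ψ⟫_ℂ :=
  (M.isPositive E hE).isSymmetric φ ψ

theorem POVM.prob_real_add (M : POVM X H) {E : Set X} (hE : MeasurableSet E) (φ ψ : H) :
    (M.prob (φ + ψ)).real E =
      (M.prob φ).real E + 2 * (⟪M.effect E φ, ψ⟫_ℂ).re + (M.prob ψ).real E := by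
  rw [M.prob_real _ hE, M.prob_real _ hE, M.prob_real _ hE, map_add, inner_add_left,
    inner_add_right, inner_add_right, ← M.inner_effect hE φ ψ,
    ← inner_conj_symm ψ (M.effect E φ)]
  simp only [Complex.add_re, Complex.conj_re]
  ring

theorem POVM.prob_real_smul (M : POVM X H) {E : Set X} (hE : MeasurableSet E) (c : ℂ) (φ : H) :
    (M.prob (c • φ)).real E = ‖c‖ ^ 2 * (M.prob φ).real E := by
  rw [M.prob_real _ hE, M.prob_real _ hE, map_smul, inner_smul_left, inner_smul_right, ← mul_assoc,
    ← Complex.normSq_eq_conj_mul_self, Complex.re_ofReal_mul, Complex.normSq_eq_norm_sq]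

theorem POVM.prob_real_sub (M : POVM X H) {E : Set X} (hE : MeasurableSet E) (φ ψ : H) :
    (M.prob (φ - ψ)).real E =
      (M.prob φ).real E - 2 * (⟪M.effect E φ, ψ⟫_ℂ).re + (M.prob ψ).real E := by
  have h1 : φ - ψ = φ + (-1 : ℂ) • ψ := by simp [sub_eq_add_neg]
  rw [h1, M.prob_real_add hE, M.prob_real_smul hE, inner_smul_right]
  simp
  ring

/-- The parallelogram law, as an inequality between measures. -/
theorem POVM.prob_add_le (M : POVM X H) (φ ψ : H) :
    M.prob (φ + ψ) ≤ (2 : ℝ≥0∞) • M.prob φ + (2 : ℝ≥0∞) • M.prob ψ := by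
  refine Measure.le_iff.2 fun E hE => ?_
  have h1 := M.prob_real_add hE φ ψ
  have h2 := M.prob_real_sub hE φ ψ
  have h3 : 0 ≤ (M.prob (φ - ψ)).real E := measureReal_nonneg
  simp only [Measure.add_apply, Measure.smul_apply, smul_eq_mul]
  rw [← ENNReal.toReal_le_toReal (by finiteness) (by finiteness),
    ENNReal.toReal_add (by finiteness) (by finiteness), ENNReal.toReal_mul, ENNReal.toReal_mul]
  simp only [measureReal_def, ENNReal.toReal_ofNat] at *
  linarith

theorem POVM.prob_neg (M : POVM X H) (φ : H) : M.prob (-φ) = M.prob φ := by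
  refine Measure.ext fun E hE => ?_
  rw [M.prob_apply _ hE, M.prob_apply _ hE]
  simp

theorem POVM.prob_sub_le (M : POVM X H) (φ ψ : H) :
    M.prob (φ - ψ) ≤ (2 : ℝ≥0∞) • M.prob φ + (2 : ℝ≥0∞) • M.prob ψ := by
  rw [sub_eq_add_neg, ← M.prob_neg ψ]
  exact M.prob_add_le φ (-ψ)

/-- The Cauchy–Schwarz inequality for the positive form `⟨φ, M(E) ψ⟩`. -/
theorem POVM.sq_re_inner_effect_le (M : POVM X H) {E : Set X} (hE : MeasurableSet E) (φ ψ : H) :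
    (⟪M.effect E φ, ψ⟫_ℂ).re ^ 2 ≤ (M.prob φ).real E * (M.prob ψ).real E := by
  have h : ∀ t : ℝ, 0 ≤ (M.prob φ).real E * (t * t) + (2 * (⟪M.effect E φ, ψ⟫_ℂ).re) * t
      + (M.prob ψ).real E := by
    intro t
    have h0 : 0 ≤ (M.prob ((t : ℂ) • φ + ψ)).real E := measureReal_nonneg
    rw [M.prob_real_add hE, M.prob_real_smul hE, map_smul, inner_smul_left] at h0
    simp only [Complex.norm_real, Real.norm_eq_abs, sq_abs, Complex.conj_ofReal,
      Complex.re_ofReal_mul] at h0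
    linarith
  have := discrim_le_zero h
  rw [discrim] at this
  linarith

/-- For fixed `ψ` and `φ`, the signed measure `E ↦ Re ⟨M(E) ψ, φ⟩` has a density with respect to
the outcome law of `ψ`, by Cauchy–Schwarz and the Radon–Nikodym theorem. -/
theorem POVM.exists_real_density (M : POVM X H) (ψ φ : H) :
    ∃ s : X → ℝ, Integrable s (M.prob ψ) ∧ ∀ E, MeasurableSet E →
      ∫ x in E, s x ∂(M.prob ψ) = (⟪M.effect E ψ, φ⟫_ℂ).re := by
  set w : SignedMeasure X :=
    (1 / 4 : ℝ) • ((M.prob (ψ + φ)).toSignedMeasure - (M.prob (ψ - φ)).toSignedMeasure) with hw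
  have hwE : ∀ E, MeasurableSet E → w E = (⟪M.effect E ψ, φ⟫_ℂ).re := by
    intro E hE
    rw [hw, smul_apply, sub_apply,
      Measure.toSignedMeasure_apply_measurable hE, Measure.toSignedMeasure_apply_measurable hE,
      M.prob_real_add hE, M.prob_real_sub hE, smul_eq_mul]
    ring
  have hac : w ≪ᵥ (M.prob ψ).toENNRealVectorMeasure := by
    refine VectorMeasure.AbsolutelyContinuous.mk fun E hE h0 => ?_
    rw [Measure.toENNRealVectorMeasure_apply_measurable hE] at h0
    have h1 := M.sq_re_inner_effect_le hE ψ φ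
    rw [measureReal_def, h0, ENNReal.toReal_zero, zero_mul] at h1
    rw [hwE E hE]
    exact pow_eq_zero_iff two_ne_zero |>.1 (le_antisymm h1 (sq_nonneg _))
  refine ⟨w.rnDeriv (M.prob ψ), SignedMeasure.integrable_rnDeriv _ _, fun E hE => ?_⟩
  rw [← hwE E hE, ← withDensityᵥ_apply (SignedMeasure.integrable_rnDeriv _ _) hE,
    SignedMeasure.withDensityᵥ_rnDeriv_eq _ _ hac]

/-- The complex measure `E ↦ ⟨M(E) ψ, φ⟩` has a square-integrable density `u` with respect to the
outcome law of `ψ`, and the map `φ ↦ u` is a contraction. Indeed positivity of `M` on `φ - z ψ`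
gives `2 Re (z̄ u) - |z|² ≤ β` almost everywhere for every `z`, where `β` is the density of the
absolutely continuous part of the law of `φ`; taking `z = u` yields `|u|² ≤ β`. -/
theorem POVM.exists_density (M : POVM X H) (ψ φ : H) :
    ∃ u : X → ℂ, MemLp u 2 (M.prob ψ) ∧ ∫ x, ‖u x‖ ^ 2 ∂(M.prob ψ) ≤ ‖φ‖ ^ 2 ∧
      ∀ E, MeasurableSet E → ∫ x in E, u x ∂(M.prob ψ) = ⟪M.effect E ψ, φ⟫_ℂ := by
  obtain ⟨a, ha, haE⟩ := M.exists_real_density ψ φ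
  obtain ⟨b, hb, hbE⟩ := M.exists_real_density ψ (-Complex.I • φ)
  set p := M.prob ψ with hp
  set u : X → ℂ := fun x => (a x : ℂ) + (b x : ℂ) * Complex.I with hu
  have hui : Integrable u p := ha.ofReal.add (hb.ofReal.mul_const _)
  have huE : ∀ E, MeasurableSet E → ∫ x in E, u x ∂p = ⟪M.effect E ψ, φ⟫_ℂ := by
    intro E hE
    rw [hu, integral_add (μ := p.restrict E) ha.integrableOn.ofReal
      (hb.integrableOn.ofReal.mul_const _),
      integral_mul_const, integral_complex_ofReal, integral_complex_ofReal, haE E hE, hbE E hE,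
      inner_smul_right]
    apply Complex.ext <;> simp
  set β : X → ℝ := fun x => ((M.prob φ).rnDeriv p x).toReal with hβ
  have hβi : Integrable β p := Measure.integrable_toReal_rnDeriv
  -- off a `p`-null set the law of `φ` is absolutely continuous with respect to `p`
  have hms := Measure.mutuallySingular_singularPart (M.prob φ) p
  set S := hms.nullSet with hS
  have hSm : MeasurableSet S := hms.measurableSet_nullSet
  have hβE : ∀ E, MeasurableSet E → (M.prob φ).real (E ∩ S) = ∫ x in E, β x ∂p := by
    intro E hE
    have h1 : (M.prob φ) (E ∩ S) = ∫⁻ x in E, (M.prob φ).rnDeriv p x ∂p := by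
      conv_lhs => rw [← Measure.singularPart_add_rnDeriv (M.prob φ) p]
      rw [Measure.add_apply, measure_mono_null Set.inter_subset_right hms.measure_nullSet, zero_add,
        withDensity_apply _ (hE.inter hSm)]
      refine setLIntegral_congr ?_
      exact inter_ae_eq_left_of_ae_eq_univ (ae_eq_univ.2 hms.measure_compl_nullSet)
    rw [measureReal_def, h1, integral_toReal (Measure.measurable_rnDeriv _ _).aemeasurable
      (ae_restrict_of_ae (Measure.rnDeriv_lt_top _ _))]
  have key : ∀ z : ℂ, ∀ᵐ x ∂p, 2 * ((starRingEnd ℂ) z * u x).re - ‖z‖ ^ 2 ≤ β x := by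
    intro z
    have hi : Integrable (fun x => (starRingEnd ℂ) z * u x) p := hui.const_mul _
    have hr : Integrable (fun x => ((starRingEnd ℂ) z * u x).re) p := hi.re
    refine ae_le_of_forall_setIntegral_le
      ((hr.const_mul 2).sub (integrable_const _)) hβi fun E hE _ => ?_
    have hES : (E ∩ S : Set X) =ᵐ[p] E :=
      inter_ae_eq_left_of_ae_eq_univ (ae_eq_univ.2 hms.measure_compl_nullSet)
    have hm := hE.inter hSm
    rw [← hβE E hE, ← setIntegral_congr_set hES,
      integral_sub (hr.const_mul 2).integrableOn (integrable_const _).integrableOn,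
      integral_const_mul]
    have h2 : ∫ x in E ∩ S, ((starRingEnd ℂ) z * u x).re ∂p
        = ((starRingEnd ℂ) z * ⟪M.effect (E ∩ S) ψ, φ⟫_ℂ).re := by
      rw [← huE _ hm, ← integral_const_mul]
      exact integral_re hi.integrableOn
    have h3 : ∫ x in E ∩ S, ‖z‖ ^ 2 ∂p = p.real (E ∩ S) * ‖z‖ ^ 2 := by
      rw [setIntegral_const, smul_eq_mul]
    have h4 : 0 ≤ (M.prob (z • ψ - φ)).real (E ∩ S) := measureReal_nonneg
    rw [M.prob_real_sub hm, M.prob_real_smul hm, map_smul, inner_smul_left] at h4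
    rw [h2, h3]
    linarith
  have key2 : ∀ᵐ x ∂p, ‖u x‖ ^ 2 ≤ β x := by
    have h := ae_all_iff.2 fun n : ℕ => key (TopologicalSpace.denseSeq ℂ n)
    filter_upwards [h] with x hx
    have h2 : ∀ z : ℂ, 2 * ((starRingEnd ℂ) z * u x).re - ‖z‖ ^ 2 ≤ β x := fun z =>
      (TopologicalSpace.denseRange_denseSeq ℂ).induction_on z
        (isClosed_le (by fun_prop) continuous_const) hx
    have h3 := h2 (u x)
    rw [← Complex.normSq_eq_conj_mul_self, Complex.ofReal_re, Complex.normSq_eq_norm_sq] at h3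
    linarith
  have hsq : Integrable (fun x => ‖u x‖ ^ 2) p :=
    hβi.mono' (hui.1.norm.pow 2) (key2.mono fun x hx => by
      rwa [Real.norm_of_nonneg (by positivity)])
  refine ⟨u, (memLp_two_iff_integrable_sq_norm hui.1).2 hsq, ?_, huE⟩
  calc ∫ x, ‖u x‖ ^ 2 ∂p ≤ ∫ x, β x ∂p := integral_mono_ae hsq hβi key2
    _ = (M.prob φ).real (Set.univ ∩ S) := by rw [hβE _ MeasurableSet.univ, setIntegral_univ]
    _ ≤ (M.prob φ).real Set.univ := measureReal_mono Set.inter_subset_left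
    _ = ‖φ‖ ^ 2 := M.prob_real_univ φ

end Povm

/-! ### Differentiating means of unbounded estimators -/

section Means

variable {X : Type*} [MeasurableSpace X] {H : Type*} [NormedAddCommGroup H]
  [InnerProductSpace ℂ H] [CompleteSpace H]

theorem sq_integral_mul_le {μ : Measure X} {f g : X → ℝ} (hf : MemLp f 2 μ) (hg : MemLp g 2 μ) :
    (∫ x, f x * g x ∂μ) ^ 2 ≤ (∫ x, f x ^ 2 ∂μ) * ∫ x, g x ^ 2 ∂μ := by
  have hfg : Integrable (fun x => f x * g x) μ := hf.integrable_mul hg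
  have h : ∀ t : ℝ, 0 ≤ (∫ x, f x ^ 2 ∂μ) * (t * t) + (2 * ∫ x, f x * g x ∂μ) * t
      + ∫ x, g x ^ 2 ∂μ := by
    intro t
    have h0 : 0 ≤ ∫ x, (f x * t + g x) ^ 2 ∂μ := integral_nonneg fun x => sq_nonneg _
    have h1 : ∀ x, (f x * t + g x) ^ 2 = (t * t) * f x ^ 2 + ((2 * t) * (f x * g x) + g x ^ 2) :=
      fun x => by ring
    simp only [h1] at h0
    have h2 : Integrable (fun x => 2 * t * (f x * g x) + g x ^ 2) μ :=
      (hfg.const_mul _).add hg.integrable_sq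
    rw [integral_add (hf.integrable_sq.const_mul _) h2,
      integral_add (hfg.const_mul _) hg.integrable_sq, integral_const_mul, integral_const_mul] at h0
    linarith
  have := discrim_le_zero h
  rw [discrim] at this
  linarith

theorem abs_integral_mul_le {μ : Measure X} {f g : X → ℝ} (hf : MemLp f 2 μ) (hg : MemLp g 2 μ) :
    |∫ x, f x * g x ∂μ| ≤ √(∫ x, f x ^ 2 ∂μ) * √(∫ x, g x ^ 2 ∂μ) := by
  rw [← Real.sqrt_mul (integral_nonneg fun x => sq_nonneg _)]
  exact Real.abs_le_sqrt (sq_integral_mul_le hf hg)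

/-- A mean splits into a bounded part and a tail, which is small when the event `N < |f|` is. -/
theorem abs_integral_le_truncation {ν : Measure X} [IsFiniteMeasure ν] {f : X → ℝ}
    (hm : Measurable f) (hf : MemLp f 2 ν) {N : ℝ} (hN : 0 ≤ N) :
    |∫ x, f x ∂ν| ≤ N * ν.real Set.univ
      + √(∫ x, f x ^ 2 ∂ν) * √(ν.real {x | N < |f x|}) := by
  set F := {x | N < |f x|} with hF
  have hFm : MeasurableSet F := measurableSet_lt measurable_const hm.abs
  have hi : MemLp (F.indicator fun _ => (1 : ℝ)) 2 ν := (memLp_const 1).indicator hFm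
  have hfa : MemLp (fun x => |f x|) 2 ν := hf.abs
  have hfi : Integrable (fun x => |f x| * F.indicator (fun _ => (1 : ℝ)) x) ν :=
    hfa.integrable_mul hi
  have h1 : |∫ x, f x ∂ν| ≤ ∫ x, (N + |f x| * F.indicator (fun _ => (1 : ℝ)) x) ∂ν := by
    refine (abs_integral_le_integral_abs).trans
      (integral_mono (MemLp.integrable one_le_two hfa)
        ((integrable_const N).add hfi) fun x => ?_)
    by_cases hx : x ∈ F
    · simp only [Set.indicator_of_mem hx]
      linarith
    · simp only [Set.indicator_of_notMem hx]
      have : |f x| ≤ N := not_lt.1 hx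
      linarith
  refine h1.trans ?_
  rw [integral_add (integrable_const N) hfi, integral_const, smul_eq_mul,
    mul_comm (ν.real _)]
  have h2 := (le_abs_self _).trans (abs_integral_mul_le hfa hi)
  have h3 : ∫ x, (F.indicator (fun _ => (1 : ℝ)) x) ^ 2 ∂ν = ν.real F := by
    rw [← integral_indicator_one hFm]
    refine integral_congr_ae (ae_of_all _ fun x => ?_)
    by_cases hx : x ∈ F
    · simp [Set.indicator_of_mem hx]
    · simp [Set.indicator_of_notMem hx]
  simp only [sq_abs, h3] at h2
  linarith

/-- If the measure `l` is the sum of a signed measure with density `g` and of a measure `ν`, then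
so are the integrals. -/
theorem integral_eq_of_forall_real_eq {l μ ν : Measure X} [IsFiniteMeasure l] [IsFiniteMeasure μ]
    [IsFiniteMeasure ν] {f g : X → ℝ} (hg : Integrable g μ)
    (h : ∀ E, MeasurableSet E → l.real E = (∫ x in E, g x ∂μ) + ν.real E) (hm : Measurable f)
    (hl : Integrable f l) (hν : Integrable f ν) (hfg : Integrable (fun x => f x * g x) μ) :
    ∫ x, f x ∂l = (∫ x, f x * g x ∂μ) + ∫ x, f x ∂ν := by
  set gp : X → ℝ≥0∞ := fun x => ENNReal.ofReal (g x) with hgp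
  set gn : X → ℝ≥0∞ := fun x => ENNReal.ofReal (-g x) with hgn
  have hgpm : AEMeasurable gp μ := hg.1.aemeasurable.ennreal_ofReal
  have hgnm : AEMeasurable gn μ := hg.1.aemeasurable.neg.ennreal_ofReal
  have : IsFiniteMeasure (μ.withDensity gp) := isFiniteMeasure_withDensity_ofReal hg.2
  have : IsFiniteMeasure (μ.withDensity gn) := isFiniteMeasure_withDensity_ofReal hg.neg.2
  have hmeas : l + μ.withDensity gn = μ.withDensity gp + ν := by
    refine Measure.ext fun E hE => ?_
    rw [← ENNReal.toReal_eq_toReal_iff' (by finiteness) (by finiteness), Measure.add_apply,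
      Measure.add_apply, ENNReal.toReal_add (by finiteness) (by finiteness),
      ENNReal.toReal_add (by finiteness) (by finiteness), withDensity_apply _ hE,
      withDensity_apply _ hE]
    have h1 := h E hE
    rw [integral_eq_lintegral_pos_part_sub_lintegral_neg_part hg.integrableOn] at h1
    simp only [measureReal_def] at h1
    rw [h1]
    ring
  have hp : Integrable (fun x => (gp x).toReal * f x) μ := by
    refine hfg.mono (hgpm.ennreal_toReal.aestronglyMeasurable.mul hm.aestronglyMeasurable)
      (ae_of_all _ fun x => ?_)
    simp only [hgp, ENNReal.toReal_ofReal', norm_mul, Real.norm_eq_abs]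
    rw [mul_comm]
    exact mul_le_mul_of_nonneg_left (abs_max_le_max_abs_abs.trans (by simp)) (abs_nonneg _)
  have hn : Integrable (fun x => (gn x).toReal * f x) μ := by
    refine hfg.mono (hgnm.ennreal_toReal.aestronglyMeasurable.mul hm.aestronglyMeasurable)
      (ae_of_all _ fun x => ?_)
    simp only [hgn, ENNReal.toReal_ofReal', norm_mul, Real.norm_eq_abs]
    rw [mul_comm]
    exact mul_le_mul_of_nonneg_left (abs_max_le_max_abs_abs.trans (by simp)) (abs_nonneg _)
  have hint : ∫ x, f x ∂(l + μ.withDensity gn) = ∫ x, f x ∂(μ.withDensity gp + ν) := by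
    rw [hmeas]
  have hpt : ∀ᵐ x ∂μ, gp x < ∞ := ae_of_all _ fun x => ENNReal.ofReal_lt_top
  have hnt : ∀ᵐ x ∂μ, gn x < ∞ := ae_of_all _ fun x => ENNReal.ofReal_lt_top
  rw [integral_add_measure hl, integral_add_measure _ hν,
    integral_withDensity_eq_integral_toReal_smul₀ hgpm hpt,
    integral_withDensity_eq_integral_toReal_smul₀ hgnm hnt] at hint
  · simp only [smul_eq_mul] at hint
    have h2 : ∫ x, f x * g x ∂μ = (∫ x, (gp x).toReal * f x ∂μ) - ∫ x, (gn x).toReal * f x ∂μ := by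
      rw [← integral_sub hp hn]
      refine integral_congr_ae (ae_of_all _ fun x => ?_)
      simp only [hgp, hgn, ENNReal.toReal_ofReal']
      have : g x = max (g x) 0 - max (-g x) 0 := by
        rcases le_total 0 (g x) with h | h <;> simp [h]
      nth_rewrite 1 [this]
      ring
    linarith
  · rw [integrable_withDensity_iff_integrable_smul₀' hgpm hpt]; exact hp
  · rw [integrable_withDensity_iff_integrable_smul₀' hgnm hnt]; exact hn

theorem POVM.real_prob_smul_add_le (M : POVM X H) (h : ℝ) (φ R : H) {E : Set X}
    (hE : MeasurableSet E) :
    (M.prob ((h : ℂ) • φ + R)).real E ≤ 2 * h ^ 2 * (M.prob φ).real E + 2 * ‖R‖ ^ 2 := by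
  have h1 := M.prob_add_le ((h : ℂ) • φ) R E
  simp only [Measure.add_apply, Measure.smul_apply, smul_eq_mul] at h1
  rw [← ENNReal.toReal_le_toReal (by finiteness) (by finiteness),
    ENNReal.toReal_add (by finiteness) (by finiteness), ENNReal.toReal_mul, ENNReal.toReal_mul,
    ← measureReal_def, ← measureReal_def, ← measureReal_def, M.prob_real_smul hE] at h1
  simp only [Complex.norm_real, Real.norm_eq_abs, sq_abs, ENNReal.toReal_ofNat] at h1
  have h2 : (M.prob R).real E ≤ ‖R‖ ^ 2 := by
    rw [← M.prob_real_univ]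
    exact measureReal_mono (Set.subset_univ E)
  linarith

theorem POVM.memLp_prob_sub (M : POVM X H) {φ ψ : H} {f : X → ℝ} {C : ℝ} (hm : Measurable f)
    (hφ : MemLp f 2 (M.prob φ)) (hφC : ∫ x, f x ^ 2 ∂(M.prob φ) ≤ C)
    (hψ : MemLp f 2 (M.prob ψ)) (hψC : ∫ x, f x ^ 2 ∂(M.prob ψ) ≤ C) :
    MemLp f 2 (M.prob (φ - ψ)) ∧ ∫ x, f x ^ 2 ∂(M.prob (φ - ψ)) ≤ 2 ^ 2 * C := by
  have h1 : Integrable (fun x => f x ^ 2) ((2 : ℝ≥0∞) • M.prob φ) :=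
    hφ.integrable_sq.smul_measure ENNReal.ofNat_ne_top
  have h2 : Integrable (fun x => f x ^ 2) ((2 : ℝ≥0∞) • M.prob ψ) :=
    hψ.integrable_sq.smul_measure ENNReal.ofNat_ne_top
  refine ⟨(memLp_two_iff_integrable_sq hm.aestronglyMeasurable).2
    ((h1.add_measure h2).mono_measure (M.prob_sub_le φ ψ)), ?_⟩
  have h3 := integral_mono_measure (M.prob_sub_le φ ψ) (ae_of_all _ fun x => sq_nonneg (f x))
    (h1.add_measure h2)
  rw [integral_add_measure h1 h2, integral_smul_measure, integral_smul_measure] at h3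
  simp only [ENNReal.toReal_ofNat, smul_eq_mul] at h3
  linarith

/-- The law of `ψ + (h φ + R)` is that of `ψ`, plus signed measures with densities `h s` and
`2 r`, plus the law of the increment. -/
theorem POVM.integral_prob_eq (M : POVM X H) {Ψ ψ φ R : H} {h : ℝ} (hΨ : Ψ - ψ = (h : ℂ) • φ + R)
    {f s r : X → ℝ} (hm : Measurable f) (hfΨ : Integrable f (M.prob Ψ)) (hf : MemLp f 2 (M.prob ψ))
    (hfD : Integrable f (M.prob (Ψ - ψ))) (hs : MemLp s 2 (M.prob ψ))
    (hsE : ∀ E, MeasurableSet E → ∫ x in E, s x ∂(M.prob ψ) = 2 * (⟪M.effect E ψ, φ⟫_ℂ).re)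
    (hr : MemLp r 2 (M.prob ψ))
    (hrE : ∀ E, MeasurableSet E → ∫ x in E, r x ∂(M.prob ψ) = (⟪M.effect E ψ, R⟫_ℂ).re) :
    ∫ x, f x ∂(M.prob Ψ) - ∫ x, f x ∂(M.prob ψ) - h * ∫ x, f x * s x ∂(M.prob ψ) =
      2 * (∫ x, f x * r x ∂(M.prob ψ)) + ∫ x, f x ∂(M.prob (Ψ - ψ)) := by
  set p := M.prob ψ with hp
  have hsi : Integrable (fun x => h * s x) p := (hs.integrable one_le_two).const_mul h
  have hri : Integrable (fun x => 2 * r x) p := (hr.integrable one_le_two).const_mul 2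
  have hsr : Integrable (fun x => h * s x + 2 * r x) p := hsi.add hri
  have hi : Integrable (fun x => 1 + (h * s x + 2 * r x)) p := (integrable_const 1).add hsr
  have hfs : Integrable (fun x => f x * s x) p := hf.integrable_mul hs
  have hfr : Integrable (fun x => f x * r x) p := hf.integrable_mul hr
  have hfsr : Integrable (fun x => h * (f x * s x) + 2 * (f x * r x)) p :=
    (hfs.const_mul h).add (hfr.const_mul 2)
  have hfg : Integrable (fun x => f x + (h * (f x * s x) + 2 * (f x * r x))) p :=
    (hf.integrable one_le_two).add hfsr
  have hcongr : ∀ x, f x * (1 + (h * s x + 2 * r x)) =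
      f x + (h * (f x * s x) + 2 * (f x * r x)) := fun x => by ring
  have hid : ∫ x, f x ∂(M.prob Ψ) = (∫ x, f x * (1 + (h * s x + 2 * r x)) ∂p)
      + ∫ x, f x ∂(M.prob (Ψ - ψ)) := by
    refine integral_eq_of_forall_real_eq hi (fun E hE => ?_) hm hfΨ hfD (by simpa only [hcongr])
    have h1 : Ψ = ψ + (Ψ - ψ) := by abel
    have h3 : ∫ x in E, (1 : ℝ) ∂p = p.real E := by simp
    rw [integral_add (integrable_const 1) hsr.integrableOn,
      integral_add hsi.integrableOn hri.integrableOn, integral_const_mul, integral_const_mul,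
      hsE E hE, hrE E hE, h3]
    nth_rewrite 1 [h1]
    rw [M.prob_real_add hE]
    nth_rewrite 1 [hΨ]
    rw [inner_add_right, inner_smul_right, Complex.add_re, Complex.re_ofReal_mul]
    ring
  simp only [hcongr] at hid
  rw [hid, integral_add (hf.integrable one_le_two) hfsr,
    integral_add (hfs.const_mul h) (hfr.const_mul 2), integral_const_mul, integral_const_mul]
  ring

theorem POVM.abs_integral_remainder_le (M : POVM X H) {Ψ ψ φ : H} {h : ℝ} {f s : X → ℝ} {C : ℝ}
    (hm : Measurable f) (hΨ : MemLp f 2 (M.prob Ψ)) (hΨC : ∫ x, f x ^ 2 ∂(M.prob Ψ) ≤ C)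
    (hψ : MemLp f 2 (M.prob ψ)) (hψC : ∫ x, f x ^ 2 ∂(M.prob ψ) ≤ C) (hs : MemLp s 2 (M.prob ψ))
    (hsE : ∀ E, MeasurableSet E → ∫ x in E, s x ∂(M.prob ψ) = 2 * (⟪M.effect E ψ, φ⟫_ℂ).re)
    {N : ℝ} (hN : 0 ≤ N) :
    |∫ x, f x ∂(M.prob Ψ) - ∫ x, f x ∂(M.prob ψ) - h * ∫ x, f x * s x ∂(M.prob ψ)| ≤
      2 * √C * ‖Ψ - ψ - h • φ‖ + (N * ‖Ψ - ψ‖ ^ 2 + 2 * √C *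
        √(2 * h ^ 2 * (M.prob φ).real {x | N < |f x|} + 2 * ‖Ψ - ψ - h • φ‖ ^ 2)) := by
  set R := Ψ - ψ - h • φ with hR
  have hDR : Ψ - ψ = (h : ℂ) • φ + R := by rw [hR, Complex.coe_smul]; abel
  obtain ⟨v, hv, hvn, hvE⟩ := M.exists_density ψ R
  have hvr : MemLp (fun x => (v x).re) 2 (M.prob ψ) := hv.re
  obtain ⟨hfD, hfDC⟩ := M.memLp_prob_sub hm hΨ hΨC hψ hψC
  rw [M.integral_prob_eq hDR hm (hΨ.integrable one_le_two) hψ (hfD.integrable one_le_two) hs hsE hvr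
    fun E hE => by rw [← hvE E hE]; exact integral_re (hv.integrable one_le_two).integrableOn]
  refine (abs_add_le _ _).trans (add_le_add ?_ ?_)
  · rw [abs_mul, abs_two, mul_assoc]
    refine mul_le_mul_of_nonneg_left ?_ zero_le_two
    refine (abs_integral_mul_le hψ hvr).trans ?_
    refine mul_le_mul (Real.sqrt_le_sqrt hψC) ?_ (Real.sqrt_nonneg _) (Real.sqrt_nonneg _)
    rw [Real.sqrt_le_left (norm_nonneg _)]
    refine (integral_mono hvr.integrable_sq
      ((memLp_two_iff_integrable_sq_norm hv.1).1 hv) fun x => ?_).trans hvn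
    exact sq_le_sq.2 (by simpa using Complex.abs_re_le_norm (v x))
  · refine (abs_integral_le_truncation hm hfD hN).trans ?_
    rw [M.prob_real_univ]
    have h4 : √(∫ x, f x ^ 2 ∂(M.prob (Ψ - ψ))) ≤ 2 * √C := by
      refine (Real.sqrt_le_sqrt hfDC).trans_eq ?_
      rw [Real.sqrt_mul (by positivity), Real.sqrt_sq (by positivity)]
    refine add_le_add_right (mul_le_mul h4 (Real.sqrt_le_sqrt ?_) (Real.sqrt_nonneg _)
      (by positivity)) _
    rw [hDR]
    exact M.real_prob_smul_add_le h φ R (measurableSet_lt measurable_const hm.abs)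

theorem tendsto_real_lt_abs {ν : Measure X} [IsFiniteMeasure ν] {f : X → ℝ} (hm : Measurable f) :
    Tendsto (fun n : ℕ => ν.real {x | (n : ℝ) < |f x|}) atTop (𝓝 0) := by
  have h := tendsto_measure_iInter_atTop (μ := ν) (s := fun n : ℕ => {x | (n : ℝ) < |f x|})
    (fun n => (measurableSet_lt measurable_const hm.abs).nullMeasurableSet)
    (fun m n hmn x hx => lt_of_le_of_lt (Nat.cast_le (α := ℝ).2 hmn)
      (show (n : ℝ) < |f x| from hx)) ⟨0, measure_ne_top _ _⟩
  have h0 : (⋂ n : ℕ, {x | (n : ℝ) < |f x|}) = ∅ := by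
    refine Set.eq_empty_of_forall_notMem fun x hx => ?_
    obtain ⟨n, hn⟩ := exists_nat_ge |f x|
    exact absurd (Set.mem_iInter.1 hx n) (not_lt.2 hn)
  rw [h0, measure_empty] at h
  simpa [measureReal_def, Function.comp_def] using
    (ENNReal.tendsto_toReal ENNReal.zero_ne_top).comp h

/-- The mean of an observable `f` with locally bounded second moments may be differentiated along a
differentiable curve of states. Writing `Ψ u = Ψ u₀ + h Ψ' + R`, the law of `Ψ u` differs from that
of `Ψ u₀` by `h s`, by a signed measure of order `‖R‖`, and by the law of `Ψ u - Ψ u₀`, whose mass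
is of order `h²`; the mean of `f` under the last one is `o(h)` because `f` is bounded up to a tail
that is small in the state `Ψ'`. -/
theorem POVM.hasDerivAt_integral (M : POVM X H) {Ψ : ℝ → H} {Ψ' : H} {u₀ : ℝ}
    (hΨ : HasDerivAt Ψ Ψ' u₀) {f : X → ℝ} (hm : Measurable f) {C : ℝ}
    (hf : ∀ᶠ u in 𝓝 u₀, MemLp f 2 (M.prob (Ψ u)) ∧ ∫ x, f x ^ 2 ∂(M.prob (Ψ u)) ≤ C)
    {s : X → ℝ} (hs : MemLp s 2 (M.prob (Ψ u₀)))
    (hsE : ∀ E, MeasurableSet E →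
      ∫ x in E, s x ∂(M.prob (Ψ u₀)) = 2 * (⟪M.effect E (Ψ u₀), Ψ'⟫_ℂ).re) :
    HasDerivAt (fun u => ∫ x, f x ∂(M.prob (Ψ u))) (∫ x, f x * s x ∂(M.prob (Ψ u₀))) u₀ := by
  obtain ⟨hf0, hC0⟩ := hf.self_of_nhds
  set K := √C with hK
  have hK0 : 0 ≤ K := Real.sqrt_nonneg C
  rw [hasDerivAt_iff_isLittleO, Asymptotics.isLittleO_iff]
  intro c hc
  -- the terms of the remainder that are linear in `√C` add up to `6 √C δ |u - u₀|`
  set δ := c / (8 * K + 1) / 2 with hδ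
  have hδ0 : 0 < δ := by positivity
  have hKδ : 8 * K * δ ≤ c / 2 := by
    rw [hδ, ← mul_div_assoc, ← mul_div_assoc]
    refine div_le_div_of_nonneg_right ?_ zero_le_two
    rw [div_le_iff₀ (by positivity)]
    nlinarith
  obtain ⟨N, hN⟩ := ((tendsto_real_lt_abs (ν := M.prob Ψ') hm).eventually
    (gt_mem_nhds (show (0 : ℝ) < δ ^ 2 by positivity))).exists
  have hR := (Asymptotics.isLittleO_iff.1 (hasDerivAt_iff_isLittleO.1 hΨ)) hδ0
  obtain ⟨A, hA⟩ := hΨ.isBigO_sub.bound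
  have hcont : Tendsto (fun u => N * A ^ 2 * |u - u₀|) (𝓝 u₀) (𝓝 0) := by
    have : Continuous fun u => N * A ^ 2 * |u - u₀| := by fun_prop
    simpa using this.tendsto u₀
  filter_upwards [hf, hR, hA, hcont.eventually (gt_mem_nhds (half_pos hc))]
    with u hfu hRu hDu hsmall
  rw [smul_eq_mul]
  refine (M.abs_integral_remainder_le hm hfu.1 hfu.2 hf0 hC0 hs hsE N.cast_nonneg).trans ?_
  simp only [Real.norm_eq_abs] at hRu hDu ⊢
  have ha := abs_nonneg (u - u₀)
  have h1 : ‖Ψ u - Ψ u₀ - (u - u₀) • Ψ'‖ ^ 2 ≤ δ ^ 2 * (u - u₀) ^ 2 := by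
    rw [← sq_abs (u - u₀), ← mul_pow]
    exact pow_le_pow_left₀ (norm_nonneg _) hRu 2
  have h2 : ‖Ψ u - Ψ u₀‖ ^ 2 ≤ A ^ 2 * |u - u₀| ^ 2 := by
    rw [← mul_pow]
    exact pow_le_pow_left₀ (norm_nonneg _) hDu 2
  have h3 : √(2 * (u - u₀) ^ 2 * (M.prob Ψ').real {x | (N : ℝ) < |f x|}
      + 2 * ‖Ψ u - Ψ u₀ - (u - u₀) • Ψ'‖ ^ 2) ≤ 2 * δ * |u - u₀| := by
    rw [Real.sqrt_le_left (by positivity), mul_pow, sq_abs]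
    nlinarith [mul_le_mul_of_nonneg_left hN.le (sq_nonneg (u - u₀))]
  have h4 : (N : ℝ) * ‖Ψ u - Ψ u₀‖ ^ 2 ≤ c / 2 * |u - u₀| := by
    refine (mul_le_mul_of_nonneg_left h2 N.cast_nonneg).trans ?_
    calc (N : ℝ) * (A ^ 2 * |u - u₀| ^ 2) = (N * A ^ 2 * |u - u₀|) * |u - u₀| := by ring
      _ ≤ _ := mul_le_mul_of_nonneg_right hsmall.le ha
  have h5 : 2 * K * ‖Ψ u - Ψ u₀ - (u - u₀) • Ψ'‖ ≤ 2 * K * (δ * |u - u₀|) :=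
    mul_le_mul_of_nonneg_left hRu (by positivity)
  have h6 := mul_le_mul_of_nonneg_left h3 (by positivity : 0 ≤ 2 * K)
  have h7 := mul_le_mul_of_nonneg_right hKδ ha
  have h8 : 0 ≤ K * δ * |u - u₀| := by positivity
  linarith

end Means

/-! ### Scores and the Cramér–Rao inequality -/

section Scores

variable {X : Type*} [MeasurableSpace X] {H : Type*} [NormedAddCommGroup H]
  [InnerProductSpace ℂ H] [CompleteSpace H] {ι : Type*} [DecidableEq ι]

/-- The score of a differentiable family of pure states is the density of
`E ↦ 2 Re ⟨M(E) Ψ, ∂_j Ψ⟩`. -/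
theorem POVM.hasDerivAt_prob_real (M : POVM X H) {Ψ : (ι → ℝ) → H} {θ : ι → ℝ} {j : ι} {d : H}
    (hd : HasDerivAt (fun u => Ψ (Function.update θ j u)) d (θ j)) {E : Set X}
    (hE : MeasurableSet E) :
    HasDerivAt (fun u : ℝ => (M.prob (Ψ (Function.update θ j u))).real E)
      (2 * (⟪M.effect E (Ψ θ), d⟫_ℂ).re) (θ j) := by
  have hM : HasDerivAt (fun u => M.effect E (Ψ (Function.update θ j u))) (M.effect E d) (θ j) :=
    ((M.effect E).restrictScalars ℝ).hasFDerivAt.comp_hasDerivAt _ hd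
  have h1 := Complex.reCLM.hasFDerivAt.comp_hasDerivAt (θ j) (hd.inner ℂ hM)
  simp only [Function.update_eq_self] at h1
  have h2 : (2 * (⟪M.effect E (Ψ θ), d⟫_ℂ).re) =
      Complex.reCLM (⟪Ψ θ, M.effect E d⟫_ℂ + ⟪d, M.effect E (Ψ θ)⟫_ℂ) := by
    rw [← M.inner_effect hE, ← inner_conj_symm d]
    simp only [Complex.reCLM_apply, Complex.add_re, Complex.conj_re]
    ring
  rw [h2]
  refine h1.congr_of_eventuallyEq (Eventually.of_forall fun u => ?_)
  exact M.prob_real _ hE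

theorem POVM.isScore_iff (M : POVM X H) {Ψ : (ι → ℝ) → H} {θ : ι → ℝ} {j : ι} {d : H}
    (hd : HasDerivAt (fun u => Ψ (Function.update θ j u)) d (θ j)) {s : X → ℝ} :
    IsScore (fun η => M.prob (Ψ η)) θ j s ↔ MemLp s 2 (M.prob (Ψ θ)) ∧ ∀ E, MeasurableSet E →
      ∫ x in E, s x ∂(M.prob (Ψ θ)) = 2 * (⟪M.effect E (Ψ θ), d⟫_ℂ).re := by
  refine and_congr_right fun _ => forall₂_congr fun E hE =>
    ⟨fun h => h.unique (M.hasDerivAt_prob_real hd hE), fun h => ?_⟩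
  rw [h]
  exact M.hasDerivAt_prob_real hd hE

theorem POVM.exists_isScore (M : POVM X H) {Ψ : (ι → ℝ) → H} {θ : ι → ℝ} {j : ι} {d : H}
    (hd : HasDerivAt (fun u => Ψ (Function.update θ j u)) d (θ j)) :
    ∃ s : X → ℝ, IsScore (fun η => M.prob (Ψ η)) θ j s := by
  obtain ⟨u, hu, -, huE⟩ := M.exists_density (Ψ θ) d
  have hr : MemLp (fun x => (u x).re) 2 (M.prob (Ψ θ)) := hu.re
  refine ⟨fun x => 2 * (u x).re, (M.isScore_iff hd).2 ⟨hr.const_mul 2, fun E hE => ?_⟩⟩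
  rw [integral_const_mul, ← huE E hE]
  exact congrArg (2 * ·) (integral_re (hu.integrable one_le_two).integrableOn)

theorem IsScore.ae_eq {p : (ι → ℝ) → Measure X} {θ : ι → ℝ} [IsFiniteMeasure (p θ)] {j : ι}
    {s t : X → ℝ} (hs : IsScore p θ j s) (ht : IsScore p θ j t) : s =ᵐ[p θ] t :=
  (hs.1.integrable one_le_two).ae_eq_of_forall_setIntegral_eq _ _ (ht.1.integrable one_le_two)
    fun E hE _ => (hs.2 E hE).unique (ht.2 E hE)

theorem POVM.existsUnique_isCFIM (M : POVM X H) {Ψ : (ι → ℝ) → H} {θ : ι → ℝ} {d : ι → H}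
    (hd : ∀ j, HasDerivAt (fun u => Ψ (Function.update θ j u)) (d j) (θ j)) :
    ∃! F : Matrix ι ι ℝ, IsCFIM (fun η => M.prob (Ψ η)) θ F := by
  choose s hs using fun j => M.exists_isScore (hd j)
  refine ⟨fun j k => ∫ x, s j x * s k x ∂(M.prob (Ψ θ)), ⟨s, hs, fun _ _ => rfl⟩, ?_⟩
  rintro F ⟨t, ht, hF⟩
  ext j k
  rw [hF j k]
  refine integral_congr_ae ?_
  filter_upwards [(ht j).ae_eq (hs j), (ht k).ae_eq (hs k)] with x hj hk
  rw [hj, hk]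

theorem IsLocallyUnbiased.integral_mul_score {M : POVM X H} {Ψ : (ι → ℝ) → H} {θ : ι → ℝ} {k : ι}
    {d : H} (hd : HasDerivAt (fun u => Ψ (Function.update θ k u)) d (θ k)) {est : ι → X → ℝ}
    (hest : IsLocallyUnbiased (fun η => M.prob (Ψ η)) θ est) {s : X → ℝ}
    (hs : IsScore (fun η => M.prob (Ψ η)) θ k s) (j : ι) :
    ∫ x, est j x * s x ∂(M.prob (Ψ θ)) = if j = k then 1 else 0 := by
  obtain ⟨C, hC⟩ := hest.secondMoment
  have hcont : Tendsto (fun u => Function.update θ k u) (𝓝 (θ k)) (𝓝 θ) := by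
    have : Continuous fun u => Function.update θ k u := by fun_prop
    simpa using this.tendsto (θ k)
  obtain ⟨hs2, hsE⟩ := (M.isScore_iff hd).1 hs
  have hb : Function.update θ k (θ k) = θ := Function.update_eq_self k θ
  have h := M.hasDerivAt_integral hd (hest.measurable j) (C := C)
    ((hcont.eventually hC).mono fun u hu => hu j) (s := s) (by rwa [hb]) (by rwa [hb])
  rw [hb] at h
  exact h.unique (hest.hasDerivAt_mean j k)

theorem variance_eq_of_isLocallyUnbiased {p : (ι → ℝ) → Measure X} {θ : ι → ℝ} {est : ι → X → ℝ}
    (hest : IsLocallyUnbiased p θ est) (j : ι) :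
    ProbabilityTheory.variance (est j) (p θ) = ∫ x, (est j x - θ j) ^ 2 ∂(p θ) := by
  rw [ProbabilityTheory.variance_eq_integral (hest.measurable j).aemeasurable, hest.mean j]

/-- The Cramér–Rao inequality for one parameter, in the presence of others. -/
theorem IsLocallyUnbiased.one_le_variance_mul {M : POVM X H} {Ψ : (ι → ℝ) → H}
    (hΨ : ∀ η, ‖Ψ η‖ = 1) {θ : ι → ℝ} {j : ι} {d : H}
    (hd : HasDerivAt (fun u => Ψ (Function.update θ j u)) d (θ j)) {est : ι → X → ℝ}
    (hest : IsLocallyUnbiased (fun η => M.prob (Ψ η)) θ est) {s : X → ℝ}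
    (hs : IsScore (fun η => M.prob (Ψ η)) θ j s) :
    1 ≤ ProbabilityTheory.variance (est j) (M.prob (Ψ θ)) * ∫ x, s x ^ 2 ∂(M.prob (Ψ θ)) := by
  obtain ⟨C, hC⟩ := hest.secondMoment
  have h2 : MemLp (est j) 2 (M.prob (Ψ θ)) := (hC.self_of_nhds j).1
  have h0 : ∫ x, s x ∂(M.prob (Ψ θ)) = 0 := by
    have h := hs.2 Set.univ MeasurableSet.univ
    simp only [M.prob_real_univ, hΨ, setIntegral_univ] at h
    exact h.unique (hasDerivAt_const _ _)
  have hsi : Integrable s (M.prob (Ψ θ)) := hs.1.integrable one_le_two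
  have h1 : ∫ x, (est j x - θ j) * s x ∂(M.prob (Ψ θ)) = 1 := by
    simp only [sub_mul]
    have h5 : Integrable (fun x => est j x * s x) (M.prob (Ψ θ)) := h2.integrable_mul hs.1
    rw [integral_sub h5 (hsi.const_mul _), integral_const_mul, h0,
      hest.integral_mul_score hd hs j]
    simp
  have h3 := sq_integral_mul_le (h2.sub (memLp_const (θ j))) hs.1
  simp only [Pi.sub_apply] at h3
  rw [h1, one_pow] at h3
  have h4 : ProbabilityTheory.variance (est j) (M.prob (Ψ θ)) =
      ∫ x, (est j x - θ j) ^ 2 ∂(M.prob (Ψ θ)) := variance_eq_of_isLocallyUnbiased hest j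
  rwa [h4]

end Scores

/-! ### The trade-off between two tangent directions -/

section TradeOff

variable {X : Type*} [MeasurableSpace X] {H : Type*} [NormedAddCommGroup H]
  [InnerProductSpace ℂ H] [CompleteSpace H]

theorem ae_eq_re_of_forall_setIntegral_eq {μ : Measure X} {s : X → ℝ} {u : X → ℂ}
    (hs : Integrable s μ) (hu : Integrable u μ)
    (h : ∀ E, MeasurableSet E → ∫ x in E, s x ∂μ = (∫ x in E, u x ∂μ).re) :
    s =ᵐ[μ] fun x => (u x).re := by
  refine hs.ae_eq_of_forall_setIntegral_eq _ _ hu.re fun E hE _ => ?_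
  rw [h E hE]
  exact (integral_re hu.integrableOn).symm

theorem sq_re_add_sq_re_le (z w : ℂ) :
    ((1 / 2 : ℂ) * (z + w)).re ^ 2 + (-(Complex.I / 2) * (z - w)).re ^ 2 ≤
      (1 / 4) * (‖z‖ ^ 2 + (2 * (‖z‖ * ‖w‖) + ‖w‖ ^ 2)) := by
  have h1 : (z * w).re ≤ ‖z‖ * ‖w‖ := by
    rw [← norm_mul]
    exact Complex.re_le_norm _
  have h2 := Complex.normSq_apply z
  have h3 := Complex.normSq_apply w
  rw [Complex.normSq_eq_norm_sq] at h2 h3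
  rw [h2, h3]
  rw [Complex.mul_re] at h1
  have h4 : ((1 / 2 : ℂ) * (z + w)).re = (z.re + w.re) / 2 := by
    simp [Complex.mul_re]
    ring
  have h5 : (-(Complex.I / 2) * (z - w)).re = (z.im - w.im) / 2 := by
    simp [Complex.mul_re]
    ring
  rw [h4, h5]
  linarith

/-- If `p` and `q` are the densities belonging to `v₀ + i v₁` and `v₀ - i v₁`, then the real
densities belonging to `v₀` and `v₁` satisfy `s₀ + i s₁ = (p + q̄) / 2`, so the total information is
bounded by the triangle inequality. -/
theorem POVM.integral_sq_add_integral_sq_le (M : POVM X H) {ψ v₀ v₁ : H} {s₀ s₁ : X → ℝ}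
    (h₀ : MemLp s₀ 2 (M.prob ψ)) (h₁ : MemLp s₁ 2 (M.prob ψ))
    (h₀E : ∀ E, MeasurableSet E → ∫ x in E, s₀ x ∂(M.prob ψ) = (⟪M.effect E ψ, v₀⟫_ℂ).re)
    (h₁E : ∀ E, MeasurableSet E → ∫ x in E, s₁ x ∂(M.prob ψ) = (⟪M.effect E ψ, v₁⟫_ℂ).re) :
    ∫ x, s₀ x ^ 2 ∂(M.prob ψ) + ∫ x, s₁ x ^ 2 ∂(M.prob ψ) ≤
      ((‖v₀ + Complex.I • v₁‖ + ‖v₀ - Complex.I • v₁‖) / 2) ^ 2 := by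
  obtain ⟨p, hp, hpn, hpE⟩ := M.exists_density ψ (v₀ + Complex.I • v₁)
  obtain ⟨q, hq, hqn, hqE⟩ := M.exists_density ψ (v₀ - Complex.I • v₁)
  set μ := M.prob ψ with hμ
  set a := ‖v₀ + Complex.I • v₁‖ with ha
  set b := ‖v₀ - Complex.I • v₁‖ with hb
  have hpi := hp.integrable one_le_two
  have hqi := hq.integrable one_le_two
  have e₀ : s₀ =ᵐ[μ] fun x => ((1 / 2 : ℂ) * (p x + q x)).re := by
    refine ae_eq_re_of_forall_setIntegral_eq (h₀.integrable one_le_two)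
      ((hpi.add hqi).const_mul _) fun E hE => ?_
    rw [h₀E E hE, integral_const_mul, integral_add hpi.integrableOn hqi.integrableOn, hpE E hE,
      hqE E hE, inner_add_right, inner_sub_right]
    congr 1
    ring
  have e₁ : s₁ =ᵐ[μ] fun x => (-(Complex.I / 2) * (p x - q x)).re := by
    refine ae_eq_re_of_forall_setIntegral_eq (h₁.integrable one_le_two)
      ((hpi.sub hqi).const_mul _) fun E hE => ?_
    rw [h₁E E hE, integral_const_mul, integral_sub hpi.integrableOn hqi.integrableOn, hpE E hE,
      hqE E hE, inner_add_right, inner_sub_right, inner_smul_right]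
    congr 1
    linear_combination ⟪M.effect E ψ, v₁⟫_ℂ * Complex.I_sq
  have hp2 := (memLp_two_iff_integrable_sq_norm hp.1).1 hp
  have hq2 := (memLp_two_iff_integrable_sq_norm hq.1).1 hq
  have hpq : Integrable (fun x => ‖p x‖ * ‖q x‖) μ := hp.norm.integrable_mul hq.norm
  have hbound : ∀ᵐ x ∂μ, s₀ x ^ 2 + s₁ x ^ 2 ≤
      (1 / 4) * (‖p x‖ ^ 2 + (2 * (‖p x‖ * ‖q x‖) + ‖q x‖ ^ 2)) := by
    filter_upwards [e₀, e₁] with x hx₀ hx₁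
    rw [hx₀, hx₁]
    exact sq_re_add_sq_re_le _ _
  have hcs : ∫ x, ‖p x‖ * ‖q x‖ ∂μ ≤ a * b := by
    have ha0 : 0 ≤ a := norm_nonneg _
    have hb0 : 0 ≤ b := norm_nonneg _
    have h1 : √(∫ x, ‖p x‖ ^ 2 ∂μ) ≤ a := (Real.sqrt_le_left ha0).2 hpn
    have h2 : √(∫ x, ‖q x‖ ^ 2 ∂μ) ≤ b := (Real.sqrt_le_left hb0).2 hqn
    have h3 := abs_integral_mul_le hp.norm hq.norm
    exact (le_abs_self _).trans (h3.trans (mul_le_mul h1 h2 (Real.sqrt_nonneg _) ha0))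
  have hi : Integrable (fun x => 2 * (‖p x‖ * ‖q x‖) + ‖q x‖ ^ 2) μ := (hpq.const_mul 2).add hq2
  have hs : Integrable (fun x => s₀ x ^ 2 + s₁ x ^ 2) μ := h₀.integrable_sq.add h₁.integrable_sq
  have ht : Integrable (fun x => (1 / 4) * (‖p x‖ ^ 2 + (2 * (‖p x‖ * ‖q x‖) + ‖q x‖ ^ 2))) μ :=
    (hp2.add hi).const_mul _
  rw [← integral_add h₀.integrable_sq h₁.integrable_sq]
  calc ∫ x, s₀ x ^ 2 + s₁ x ^ 2 ∂μ
      ≤ ∫ x, (1 / 4) * (‖p x‖ ^ 2 + (2 * (‖p x‖ * ‖q x‖) + ‖q x‖ ^ 2)) ∂μ :=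
        integral_mono_ae hs ht hbound
    _ = (1 / 4) * (∫ x, ‖p x‖ ^ 2 ∂μ + (2 * ∫ x, ‖p x‖ * ‖q x‖ ∂μ + ∫ x, ‖q x‖ ^ 2 ∂μ)) := by
        rw [integral_const_mul, integral_add hp2 hi, integral_add (hpq.const_mul 2) hq2,
          integral_const_mul]
    _ ≤ (1 / 4) * (a ^ 2 + (2 * (a * b) + b ^ 2)) := by linarith
    _ = ((a + b) / 2) ^ 2 := by ring

end TradeOff

/-! ### Square-integrable functions -/

section LTwo

variable {Z : Type*} [MeasurableSpace Z] {μ : Measure Z}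

theorem inner_toLp {f g : Z → ℂ} (hf : MemLp f 2 μ) (hg : MemLp g 2 μ) :
    ⟪hf.toLp f, hg.toLp g⟫_ℂ = ∫ z, g z * (starRingEnd ℂ) (f z) ∂μ := by
  rw [L2.inner_def]
  refine integral_congr_ae ?_
  filter_upwards [hf.coeFn_toLp, hg.coeFn_toLp] with z h1 h2
  rw [h1, h2, RCLike.inner_apply]

theorem norm_toLp_sq {f : Z → ℂ} (hf : MemLp f 2 μ) : ‖hf.toLp f‖ ^ 2 = ∫ z, ‖f z‖ ^ 2 ∂μ := by
  have h1 := inner_self_eq_norm_sq (𝕜 := ℂ) (hf.toLp f)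
  rw [inner_toLp] at h1
  rw [← h1]
  have h2 : ∀ z, f z * (starRingEnd ℂ) (f z) = ((‖f z‖ ^ 2 : ℝ) : ℂ) := fun z => by
    rw [Complex.mul_conj, Complex.normSq_eq_norm_sq]
  simp only [h2]
  rw [integral_complex_ofReal]
  simp

/-- Differentiation in `L²` under a square-integrable bound on the derivative. -/
theorem hasDerivAt_toLp {f f' : ℝ → Z → ℂ} {u₀ : ℝ} {g : Z → ℝ} (hf : ∀ u, MemLp (f u) 2 μ)
    (hd : ∀ u ∈ Metric.ball u₀ 1, ∀ z, HasDerivAt (fun v => f v z) (f' u z) u)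
    (hb : ∀ u ∈ Metric.ball u₀ 1, ∀ z, ‖f' u z‖ ≤ g z) (hg : MemLp g 2 μ)
    (hf' : MemLp (f' u₀) 2 μ) :
    HasDerivAt (fun u => (hf u).toLp (f u)) (hf'.toLp (f' u₀)) u₀ := by
  rw [hasDerivAt_iff_tendsto_slope, tendsto_iff_norm_sub_tendsto_zero]
  have hm : ∀ u, MemLp (fun z => slope (fun v => f v z) u₀ u - f' u₀ z) 2 μ := fun u =>
    ((((hf u).sub (hf u₀)).const_smul (u - u₀)⁻¹).sub hf')
  have hnorm : ∀ u, ‖slope (fun u => (hf u).toLp (f u)) u₀ u - hf'.toLp (f' u₀)‖ ^ 2 =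
      ∫ z, ‖slope (fun v => f v z) u₀ u - f' u₀ z‖ ^ 2 ∂μ := by
    intro u
    rw [← norm_toLp_sq (hm u)]
    rfl
  have hball : ∀ᶠ u in 𝓝[≠] u₀, u ∈ Metric.ball u₀ 1 ∧ u ≠ u₀ :=
    (eventually_nhdsWithin_of_eventually_nhds (Metric.ball_mem_nhds u₀ one_pos)).and
      self_mem_nhdsWithin
  have h0 : u₀ ∈ Metric.ball u₀ 1 := Metric.mem_ball_self one_pos
  have hlim : Tendsto (fun u => ∫ z, ‖slope (fun v => f v z) u₀ u - f' u₀ z‖ ^ 2 ∂μ) (𝓝[≠] u₀)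
      (𝓝 (∫ _, 0 ∂μ)) := by
    refine tendsto_integral_filter_of_dominated_convergence (fun z => (2 * g z) ^ 2)
      (Eventually.of_forall fun u => (hm u).1.norm.pow 2) ?_ (hg.const_mul 2).integrable_sq
      (ae_of_all _ fun z => ?_)
    · filter_upwards [hball] with u hu
      refine ae_of_all _ fun z => ?_
      have h1 : ‖slope (fun v => f v z) u₀ u‖ ≤ g z := by
        have h2 := (convex_ball u₀ 1).norm_image_sub_le_of_norm_hasDerivWithin_le
          (f := fun v => f v z) (f' := fun v => f' v z) (C := g z)
          (fun v hv => (hd v hv z).hasDerivWithinAt) (fun v hv => hb v hv z) h0 hu.1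
        rw [slope_def_module, norm_smul, norm_inv]
        rw [inv_mul_le_iff₀ (norm_pos_iff.2 (sub_ne_zero.2 hu.2)), mul_comm]
        exact h2
      have h3 := (norm_sub_le (slope (fun v => f v z) u₀ u) (f' u₀ z)).trans
        (add_le_add h1 (hb u₀ h0 z))
      rw [Real.norm_of_nonneg (sq_nonneg _)]
      exact pow_le_pow_left₀ (norm_nonneg _) (by linarith) 2
    · have h1 := (tendsto_iff_norm_sub_tendsto_zero.1
        (hasDerivAt_iff_tendsto_slope.1 (hd u₀ h0 z))).pow 2
      simpa using h1
  simp only [integral_zero] at hlim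
  have h5 := hlim.sqrt
  rw [Real.sqrt_zero] at h5
  refine h5.congr fun u => ?_
  rw [← hnorm, Real.sqrt_sq (norm_nonneg _)]

theorem lintegral_comp_affine {G : ℝ → ℝ≥0∞} (hG : Measurable G) {a : ℝ} (ha : a ≠ 0) (b : ℝ) :
    ∫⁻ x, G (a * x + b) = ENNReal.ofReal |a⁻¹| * ∫⁻ x, G x := by
  have hm : Measurable fun y : ℝ => G (y + b) := hG.comp (by fun_prop)
  have h1 := lintegral_map (μ := volume) hm (measurable_const_mul a)
  rw [Real.map_volume_mul_left ha, lintegral_smul_measure, lintegral_add_right_eq_self G b] at h1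
  exact h1.symm

/-- Change of variables along a triangular affine map of the plane. -/
theorem lintegral_comp_shear {G : ℝ × ℝ → ℝ≥0∞} (hG : Measurable G) {a a' : ℝ} (ha : a ≠ 0)
    (ha' : a' ≠ 0) {b : ℝ → ℝ} (hb : Measurable b) (b' : ℝ) :
    ∫⁻ z : ℝ × ℝ, G (a * z.1 + b z.2, a' * z.2 + b') =
      ENNReal.ofReal |a⁻¹| * (ENNReal.ofReal |a'⁻¹| * ∫⁻ z, G z) := by
  have hm : Measurable fun z : ℝ × ℝ => G (a * z.1 + b z.2, a' * z.2 + b') := by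
    refine hG.comp ?_
    fun_prop
  have hI : Measurable fun y : ℝ => ∫⁻ x, G (x, y) := hG.lintegral_prod_left'
  have hI' : Measurable fun y : ℝ => ∫⁻ x, G (x, a' * y + b') := hI.comp (by fun_prop)
  rw [Measure.volume_eq_prod, lintegral_prod_symm _ hm.aemeasurable,
    lintegral_prod_symm _ hG.aemeasurable, ← lintegral_comp_affine hI ha' b',
    ← lintegral_const_mul _ hI']
  refine lintegral_congr fun y => ?_
  exact lintegral_comp_affine (G := fun x => G (x, a' * y + b')) (hG.comp (by fun_prop)) ha (b y)

end LTwo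

/-! ### The Gaussian biphoton in decorrelated coordinates -/

/-- The centred Gaussian law of variance `1 / 4` on each axis: the law of the decorrelated
coordinates in the state of the biphoton. -/
noncomputable def quarterGaussian : Measure (ℝ × ℝ) :=
  (ProbabilityTheory.gaussianReal 0 (1 / 4)).prod (ProbabilityTheory.gaussianReal 0 (1 / 4))

instance : IsProbabilityMeasure quarterGaussian := by
  unfold quarterGaussian
  infer_instance

theorem gaussianReal_quarter : ProbabilityTheory.gaussianReal 0 (1 / 4) =
    (volume : Measure ℝ).withDensity fun x =>
      ENNReal.ofReal (√(2 / Real.pi) * Real.exp (-2 * x ^ 2)) := by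
  rw [ProbabilityTheory.gaussianReal_of_var_ne_zero 0 (by norm_num)]
  congr 1
  ext x
  rw [ProbabilityTheory.gaussianPDF, ProbabilityTheory.gaussianPDFReal]
  congr 2
  · rw [← Real.sqrt_inv]
    congr 1
    have := Real.pi_pos
    push_cast
    field_simp
    norm_num
  · congr 1
    push_cast
    ring

theorem quarterGaussian_eq : quarterGaussian =
    (volume : Measure (ℝ × ℝ)).withDensity fun w =>
      ENNReal.ofReal (2 / Real.pi * Real.exp (-2 * w.1 ^ 2 - 2 * w.2 ^ 2)) := by
  rw [quarterGaussian, gaussianReal_quarter, prod_withDensity (by fun_prop) (by fun_prop),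
    ← Measure.volume_eq_prod]
  congr 1
  ext w
  rw [← ENNReal.ofReal_mul (by positivity)]
  congr 1
  have h1 : √(2 / Real.pi) * √(2 / Real.pi) = 2 / Real.pi :=
    Real.mul_self_sqrt (by have := Real.pi_pos; positivity)
  calc _ = (√(2 / Real.pi) * √(2 / Real.pi)) *
        (Real.exp (-2 * w.1 ^ 2) * Real.exp (-2 * w.2 ^ 2)) := by ring
    _ = _ := by rw [h1, ← Real.exp_add]; ring_nf

namespace Biphoton

variable (B : Biphoton)

/-- `√(1 - κ²)`, where `κ` is the correlation of signal and idler. -/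
noncomputable def coκ : ℝ := √(1 - B.κ ^ 2)

theorem one_sub_κ_sq_pos : 0 < 1 - B.κ ^ 2 := by
  nlinarith [B.κ_nonneg, B.κ_lt_one]

theorem coκ_pos : 0 < B.coκ := Real.sqrt_pos.2 B.one_sub_κ_sq_pos

theorem coκ_sq : B.coκ ^ 2 = 1 - B.κ ^ 2 := Real.sq_sqrt B.one_sub_κ_sq_pos.le

/-- The decorrelated coordinates `(x - κ y, √(1 - κ²) y)`, where `x = σ (t - t̄)` and
`y = σ_i (t_i - t̄_i)`. -/
noncomputable def coord (θ : Fin 2 → ℝ) (z : ℝ × ℝ) : ℝ × ℝ :=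
  (B.σ * (z.1 - θ 0) - B.κ * B.σi * (z.2 - B.tI), B.coκ * B.σi * (z.2 - B.tI))

theorem continuous_coord (θ : Fin 2 → ℝ) : Continuous (B.coord θ) := by
  unfold coord
  fun_prop

theorem norm_sq_wave (θ : Fin 2 → ℝ) (z : ℝ × ℝ) :
    ‖B.wave θ z‖ ^ 2 = B.σ * (B.coκ * B.σi) *
      (2 / Real.pi * Real.exp (-2 * (B.coord θ z).1 ^ 2 - 2 * (B.coord θ z).2 ^ 2)) := by
  have hσ := B.σ_pos
  have hσi := B.σi_pos
  have hpi := Real.pi_pos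
  have hq : ((1 - B.κ ^ 2) ^ (1 / 4 : ℝ)) ^ 2 = B.coκ := by
    rw [coκ, Real.sqrt_eq_rpow, ← Real.rpow_natCast, ← Real.rpow_mul B.one_sub_κ_sq_pos.le]
    norm_num
  rw [B.norm_wave, mul_pow, sq_abs, mul_pow, hq, Real.sq_sqrt (by positivity), ← Real.exp_nat_mul]
  have he : ((2 : ℕ) : ℝ) * (-(z.1 - θ 0) ^ 2 * B.σ ^ 2 - (z.2 - B.tI) ^ 2 * B.σi ^ 2
        + 2 * B.κ * (z.1 - θ 0) * (z.2 - B.tI) * B.σ * B.σi) =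
      -2 * (B.coord θ z).1 ^ 2 - 2 * (B.coord θ z).2 ^ 2 := by
    simp only [coord, mul_pow, B.coκ_sq]
    push_cast
    ring
  rw [he]
  ring

/-- In the state of the biphoton the decorrelated coordinates are independent Gaussians. -/
theorem map_coord (θ : Fin 2 → ℝ) :
    Measure.map (B.coord θ) ((volume : Measure (ℝ × ℝ)).withDensity
      fun z => ENNReal.ofReal (‖B.wave θ z‖ ^ 2)) = quarterGaussian := by
  have hσ := B.σ_pos
  have hσi := B.σi_pos
  have hc := B.coκ_pos
  rw [quarterGaussian_eq]
  refine Measure.ext fun E hE => ?_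
  set ρ : ℝ × ℝ → ℝ≥0∞ := fun w =>
    ENNReal.ofReal (2 / Real.pi * Real.exp (-2 * w.1 ^ 2 - 2 * w.2 ^ 2)) with hρ
  have hρm : Measurable ρ := by
    rw [hρ]
    fun_prop
  have hcm := (B.continuous_coord θ).measurable
  rw [Measure.map_apply hcm hE, withDensity_apply _ (hcm hE), withDensity_apply _ hE,
    ← lintegral_indicator (hcm hE), ← lintegral_indicator hE]
  have h1 := lintegral_comp_shear (hρm.indicator hE) hσ.ne' (mul_pos hc hσi).ne'
    (b := fun t => -B.σ * θ 0 - B.κ * B.σi * (t - B.tI)) (by fun_prop) (-(B.coκ * B.σi * B.tI))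
  have h2 : ∀ z : ℝ × ℝ, (B.σ * z.1 + (-B.σ * θ 0 - B.κ * B.σi * (z.2 - B.tI)),
      B.coκ * B.σi * z.2 + -(B.coκ * B.σi * B.tI)) = B.coord θ z := fun z => by
    rw [coord]
    congr 1 <;> ring
  simp only [h2] at h1
  have h3 : ∀ z, (B.coord θ ⁻¹' E).indicator (fun z => ENNReal.ofReal (‖B.wave θ z‖ ^ 2)) z =
      ENNReal.ofReal (B.σ * (B.coκ * B.σi)) * E.indicator ρ (B.coord θ z) := by
    intro z
    by_cases hz : B.coord θ z ∈ E
    · rw [Set.indicator_of_mem hz, Set.indicator_of_mem (show z ∈ B.coord θ ⁻¹' E from hz), hρ,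
        ← ENNReal.ofReal_mul (by positivity), ← B.norm_sq_wave]
    · rw [Set.indicator_of_notMem hz,
        Set.indicator_of_notMem (show z ∉ B.coord θ ⁻¹' E from hz), mul_zero]
  simp only [h3]
  have h5 : Measurable fun z => E.indicator ρ (B.coord θ z) := (hρm.indicator hE).comp hcm
  rw [lintegral_const_mul _ h5, h1, ← mul_assoc, ← mul_assoc,
    ← ENNReal.ofReal_mul (by positivity), ← ENNReal.ofReal_mul (by positivity), abs_of_pos
    (by positivity), abs_of_pos (by positivity)]
  have h4 : B.σ * (B.coκ * B.σi) * B.σ⁻¹ * (B.coκ * B.σi)⁻¹ = 1 := by field_simp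
  rw [h4, ENNReal.ofReal_one, one_mul]

theorem measurable_norm_sq_wave (θ : Fin 2 → ℝ) :
    Measurable fun z => ENNReal.ofReal (‖B.wave θ z‖ ^ 2) :=
  ((B.continuous_wave θ).norm.pow 2).measurable.ennreal_ofReal

theorem integral_norm_sq_wave_mul (θ : Fin 2 → ℝ) {G : ℝ × ℝ → ℂ} (hG : Measurable G) :
    ∫ z, ((‖B.wave θ z‖ ^ 2 : ℝ) : ℂ) * G (B.coord θ z) = ∫ w, G w ∂quarterGaussian := by
  rw [← B.map_coord θ, integral_map (B.continuous_coord θ).aemeasurable hG.aestronglyMeasurable,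
    integral_withDensity_eq_integral_toReal_smul (B.measurable_norm_sq_wave θ)
      (ae_of_all _ fun _ => ENNReal.ofReal_lt_top)]
  refine integral_congr_ae (ae_of_all _ fun z => ?_)
  simp only
  rw [ENNReal.toReal_ofReal (by positivity), Complex.real_smul]

theorem memLp_mul_wave (θ : Fin 2 → ℝ) {G : ℝ × ℝ → ℂ} (hG : Measurable G)
    (h : MemLp G 2 quarterGaussian) :
    MemLp (fun z => G (B.coord θ z) * B.wave θ z) 2 volume := by
  have hcm := (B.continuous_coord θ).measurable
  have hm : Measurable fun z => G (B.coord θ z) * B.wave θ z :=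
    (hG.comp hcm).mul (B.continuous_wave θ).measurable
  rw [memLp_two_iff_integrable_sq_norm hm.aestronglyMeasurable]
  have h1 := (memLp_two_iff_integrable_sq_norm hG.aestronglyMeasurable).1 h
  rw [← B.map_coord θ, integrable_map_measure (hG.norm.pow_const 2).aestronglyMeasurable
    hcm.aemeasurable, integrable_withDensity_iff_integrable_smul' (B.measurable_norm_sq_wave θ)
      (ae_of_all _ fun _ => ENNReal.ofReal_lt_top)] at h1
  refine h1.congr (ae_of_all _ fun z => ?_)
  simp only [Function.comp_apply, smul_eq_mul]
  rw [ENNReal.toReal_ofReal (by positivity), norm_mul, mul_pow, mul_comm]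

/-- The state multiplied by a function of the decorrelated coordinates. -/
noncomputable def mulState (θ : Fin 2 → ℝ) (G : ℝ × ℝ → ℂ)
    (hG : Measurable G ∧ MemLp G 2 quarterGaussian) : BiphotonSpace :=
  (B.memLp_mul_wave θ hG.1 hG.2).toLp fun z => G (B.coord θ z) * B.wave θ z

theorem inner_mulState (θ : Fin 2 → ℝ) {F G : ℝ × ℝ → ℂ}
    (hF : Measurable F ∧ MemLp F 2 quarterGaussian)
    (hG : Measurable G ∧ MemLp G 2 quarterGaussian) :
    ⟪B.mulState θ F hF, B.mulState θ G hG⟫_ℂ =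
      ∫ w, G w * (starRingEnd ℂ) (F w) ∂quarterGaussian := by
  have hm : Measurable fun w => G w * (starRingEnd ℂ) (F w) :=
    hG.1.mul (RCLike.continuous_conj.measurable.comp hF.1)
  rw [mulState, mulState, inner_toLp, ← B.integral_norm_sq_wave_mul θ hm]
  refine integral_congr_ae (ae_of_all _ fun z => ?_)
  simp only [map_mul]
  rw [← Complex.normSq_eq_norm_sq, Complex.normSq_eq_conj_mul_self]
  ring

/-! ### The tangent frame of the biphoton -/

theorem memLp_one : Measurable (fun _ : ℝ × ℝ => (1 : ℂ)) ∧
    MemLp (fun _ : ℝ × ℝ => (1 : ℂ)) 2 quarterGaussian :=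
  ⟨measurable_const, memLp_const 1⟩

theorem memLp_fst : Measurable (fun w : ℝ × ℝ => ((2 * w.1 : ℝ) : ℂ)) ∧
    MemLp (fun w : ℝ × ℝ => ((2 * w.1 : ℝ) : ℂ)) 2 quarterGaussian :=
  ⟨by fun_prop, ((((ProbabilityTheory.memLp_id_gaussianReal 2).comp_fst _).const_mul 2).ofReal)⟩

theorem memLp_snd : Measurable (fun w : ℝ × ℝ => ((2 * w.2 : ℝ) : ℂ)) ∧
    MemLp (fun w : ℝ × ℝ => ((2 * w.2 : ℝ) : ℂ)) 2 quarterGaussian :=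
  ⟨by fun_prop, ((((ProbabilityTheory.memLp_id_gaussianReal 2).comp_snd _).const_mul 2).ofReal)⟩

/-- The state multiplied by the first decorrelated coordinate, normalised. -/
noncomputable def frame₀ (θ : Fin 2 → ℝ) : BiphotonSpace := B.mulState θ _ memLp_fst

/-- The state multiplied by the second decorrelated coordinate, normalised. -/
noncomputable def frame₁ (θ : Fin 2 → ℝ) : BiphotonSpace := B.mulState θ _ memLp_snd

theorem state_eq (θ : Fin 2 → ℝ) : B.state θ = B.mulState θ _ memLp_one := by
  unfold state mulState
  congr 1
  ext z
  rw [one_mul]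

theorem integral_quarterGaussian_mul (f g : ℝ → ℝ) :
    ∫ w, ((f w.1 * g w.2 : ℝ) : ℂ) ∂quarterGaussian =
      (((∫ x, f x ∂(ProbabilityTheory.gaussianReal 0 (1 / 4))) *
        ∫ y, g y ∂(ProbabilityTheory.gaussianReal 0 (1 / 4)) : ℝ) : ℂ) := by
  rw [integral_complex_ofReal, quarterGaussian, integral_prod_mul]

theorem integral_sq_gaussianReal_quarter :
    ∫ x, (2 * x) ^ 2 ∂(ProbabilityTheory.gaussianReal 0 (1 / 4)) = 1 := by
  have h := ProbabilityTheory.variance_id_gaussianReal (μ := 0) (v := 1 / 4)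
  rw [ProbabilityTheory.variance_of_integral_eq_zero aemeasurable_id
    (by simp [ProbabilityTheory.integral_id_gaussianReal])] at h
  simp only [id_eq] at h
  simp only [mul_pow]
  rw [integral_const_mul, h]
  norm_num

theorem integral_gaussianReal_quarter :
    ∫ x, 2 * x ∂(ProbabilityTheory.gaussianReal 0 (1 / 4)) = 0 := by
  rw [integral_const_mul, ProbabilityTheory.integral_id_gaussianReal, mul_zero]

theorem inner_state_self (θ : Fin 2 → ℝ) : ⟪B.state θ, B.state θ⟫_ℂ = 1 := by
  rw [state_eq, inner_mulState]
  · simp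

theorem norm_state (θ : Fin 2 → ℝ) : ‖B.state θ‖ = 1 := by
  have h := inner_self_eq_norm_sq (𝕜 := ℂ) (B.state θ)
  rw [B.inner_state_self, RCLike.one_re] at h
  exact (pow_eq_one_iff_of_nonneg (norm_nonneg _) two_ne_zero).1 h.symm

theorem inner_state_frame₀ (θ : Fin 2 → ℝ) : ⟪B.state θ, B.frame₀ θ⟫_ℂ = 0 := by
  rw [state_eq, frame₀, inner_mulState]
  · have h := integral_quarterGaussian_mul (fun x => 2 * x) (fun _ => 1)
    rw [integral_gaussianReal_quarter] at h
    simpa using h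

theorem inner_state_frame₁ (θ : Fin 2 → ℝ) : ⟪B.state θ, B.frame₁ θ⟫_ℂ = 0 := by
  rw [state_eq, frame₁, inner_mulState]
  · have h := integral_quarterGaussian_mul (fun _ => 1) (fun x => 2 * x)
    rw [integral_gaussianReal_quarter] at h
    simpa using h

theorem inner_frame₀_frame₁ (θ : Fin 2 → ℝ) : ⟪B.frame₀ θ, B.frame₁ θ⟫_ℂ = 0 := by
  rw [frame₀, frame₁, inner_mulState]
  · have h := integral_quarterGaussian_mul (fun x => 2 * x) (fun x => 2 * x)
    rw [integral_gaussianReal_quarter, mul_zero, Complex.ofReal_zero] at h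
    rw [← h]
    refine integral_congr_ae (ae_of_all _ fun w => ?_)
    simp only [Complex.conj_ofReal]
    push_cast
    ring

theorem inner_frame₀_self (θ : Fin 2 → ℝ) : ⟪B.frame₀ θ, B.frame₀ θ⟫_ℂ = 1 := by
  rw [frame₀, inner_mulState]
  · have h := integral_quarterGaussian_mul (fun x => (2 * x) ^ 2) (fun _ => 1)
    rw [integral_sq_gaussianReal_quarter] at h
    simp only [integral_const, probReal_univ, one_smul, mul_one,
      Complex.ofReal_one] at h
    rw [← h]
    refine integral_congr_ae (ae_of_all _ fun w => ?_)
    simp only [Complex.conj_ofReal]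
    push_cast
    ring

theorem inner_frame₁_self (θ : Fin 2 → ℝ) : ⟪B.frame₁ θ, B.frame₁ θ⟫_ℂ = 1 := by
  rw [frame₁, inner_mulState]
  · have h := integral_quarterGaussian_mul (fun _ => 1) (fun x => (2 * x) ^ 2)
    rw [integral_sq_gaussianReal_quarter] at h
    simp only [integral_const, probReal_univ, one_smul, mul_one, one_mul,
      Complex.ofReal_one] at h
    rw [← h]
    refine integral_congr_ae (ae_of_all _ fun w => ?_)
    simp only [Complex.conj_ofReal]
    push_cast
    ring

/-- The square-integrable function that dominates the derivative in the central time. -/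
theorem memLp_exp_sq : MemLp (fun w : ℝ × ℝ => Real.exp (3 / 4 * w.1 ^ 2)) 2 quarterGaussian := by
  have h : MemLp (fun x : ℝ => Real.exp (3 / 4 * x ^ 2)) 2
      (ProbabilityTheory.gaussianReal 0 (1 / 4)) := by
    rw [memLp_two_iff_integrable_sq (by fun_prop), gaussianReal_quarter,
      integrable_withDensity_iff_integrable_smul' (by fun_prop)
        (ae_of_all _ fun _ => ENNReal.ofReal_lt_top)]
    refine ((integrable_exp_neg_mul_sq (b := 1 / 2) (by norm_num)).const_mul
      (√(2 / Real.pi))).congr (ae_of_all _ fun x => ?_)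
    simp only [smul_eq_mul]
    rw [ENNReal.toReal_ofReal (by positivity), mul_assoc, ← Real.exp_nat_mul, ← Real.exp_add]
    congr 2
    push_cast
    ring
  exact h.comp_fst _

end Biphoton

namespace Biphoton

variable (B : Biphoton)

theorem norm_wave_eq_coord (θ : Fin 2 → ℝ) (z : ℝ × ℝ) :
    ‖B.wave θ z‖ = |√(2 * B.σ * B.σi / Real.pi) * (1 - B.κ ^ 2) ^ (1 / 4 : ℝ)| *
      Real.exp (-(B.coord θ z).1 ^ 2 - (B.coord θ z).2 ^ 2) := by
  rw [B.norm_wave]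
  congr 2
  simp only [coord, mul_pow, B.coκ_sq]
  ring

theorem one_add_abs_le_exp (x : ℝ) : 1 + |x| ≤ 2 * Real.exp (x ^ 2 / 4) := by
  have h1 := Real.add_one_le_exp (x ^ 2 / 4)
  nlinarith [sq_nonneg (|x| - 1), sq_abs x]

/-- A square-integrable bound for the derivative in the central time, uniform for bounded shifts
`h`: a bounded shift costs at most half of the Gaussian decay. -/
theorem norm_deriv_wave_le (ω σ x h : ℝ) (hσ : 0 < σ) (hh : |h| ≤ 1) :
    (|ω| + 2 * σ * |x - σ * h|) * Real.exp (x ^ 2 - (x - σ * h) ^ 2) ≤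
      2 * (|ω| + 2 * σ ^ 2 + 2 * σ) * Real.exp (σ ^ 2) * Real.exp (3 / 4 * x ^ 2) := by
  have h1 : |x - σ * h| ≤ |x| + σ := by
    refine (abs_sub _ _).trans ?_
    rw [abs_mul, abs_of_pos hσ]
    nlinarith
  have h2 : |ω| + 2 * σ * |x - σ * h| ≤ (|ω| + 2 * σ ^ 2 + 2 * σ) * (1 + |x|) := by
    have := mul_le_mul_of_nonneg_left h1 (by positivity : 0 ≤ 2 * σ)
    nlinarith [abs_nonneg x, abs_nonneg ω, mul_nonneg (abs_nonneg ω) (abs_nonneg x),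
      mul_nonneg (sq_nonneg σ) (abs_nonneg x)]
  have h3 : x ^ 2 - (x - σ * h) ^ 2 ≤ σ ^ 2 + x ^ 2 / 2 := by
    have h4 : h ^ 2 ≤ 1 := (sq_le_one_iff_abs_le_one h).2 hh
    nlinarith [sq_nonneg (x - 2 * (σ * h)), mul_le_mul_of_nonneg_left h4 (sq_nonneg σ)]
  calc _ ≤ ((|ω| + 2 * σ ^ 2 + 2 * σ) * (2 * Real.exp (x ^ 2 / 4))) *
        Real.exp (σ ^ 2 + x ^ 2 / 2) := by
        refine mul_le_mul (h2.trans ?_) (Real.exp_le_exp.2 h3) (Real.exp_nonneg _) (by positivity)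
        exact mul_le_mul_of_nonneg_left (one_add_abs_le_exp x) (by positivity)
    _ = _ := by
        have h5 : Real.exp (3 / 4 * x ^ 2) = Real.exp (x ^ 2 / 4) * Real.exp (x ^ 2 / 2) := by
          rw [← Real.exp_add]
          ring_nf
        rw [h5, Real.exp_add]
        ring

theorem hasDerivAt_wave_time (θ : Fin 2 → ℝ) (u : ℝ) (z : ℝ × ℝ) :
    HasDerivAt (fun v => B.wave (Function.update θ 0 v) z)
      ((Complex.I * (θ 1 : ℂ) + (2 * B.σ * (B.coord (Function.update θ 0 u) z).1 : ℝ)) *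
        B.wave (Function.update θ 0 u) z) u := by
  have h1 : HasDerivAt (fun v : ℝ => z.1 - v) (-1) u := by
    simpa using (hasDerivAt_id u).const_sub z.1
  have h2 : HasDerivAt (fun v : ℝ => -(z.1 - v) ^ 2 * B.σ ^ 2 - (z.2 - B.tI) ^ 2 * B.σi ^ 2
        + 2 * B.κ * (z.1 - v) * (z.2 - B.tI) * B.σ * B.σi)
      (2 * B.σ * (B.σ * (z.1 - u) - B.κ * B.σi * (z.2 - B.tI))) u := by
    have h := ((((h1.pow 2).neg.mul_const (B.σ ^ 2)).sub_const ((z.2 - B.tI) ^ 2 * B.σi ^ 2)).add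
      ((((h1.const_mul (2 * B.κ)).mul_const (z.2 - B.tI)).mul_const B.σ).mul_const B.σi))
    refine h.congr_deriv ?_
    simp
    ring
  have h3 := (((h1.ofReal_comp.const_mul (-Complex.I * (θ 1 : ℂ))).sub_const
    (Complex.I * (B.ωI : ℂ) * ((z.2 - B.tI : ℝ) : ℂ))).add h2.ofReal_comp).cexp.const_mul
      (((√(2 * B.σ * B.σi / Real.pi) * (1 - B.κ ^ 2) ^ (1 / 4 : ℝ) : ℝ) : ℂ))
  have hw : ∀ v, B.wave (Function.update θ 0 v) z =
      ((√(2 * B.σ * B.σi / Real.pi) * (1 - B.κ ^ 2) ^ (1 / 4 : ℝ) : ℝ) : ℂ) *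
      Complex.exp (-Complex.I * (θ 1 : ℂ) * ((z.1 - v : ℝ) : ℂ)
        - Complex.I * (B.ωI : ℂ) * ((z.2 - B.tI : ℝ) : ℂ)
        + ((-(z.1 - v) ^ 2 * B.σ ^ 2 - (z.2 - B.tI) ^ 2 * B.σi ^ 2
          + 2 * B.κ * (z.1 - v) * (z.2 - B.tI) * B.σ * B.σi : ℝ) : ℂ)) := fun v => by
    simp [wave]
  simp only [hw]
  refine h3.congr_deriv ?_
  simp only [coord, Function.update_self, Pi.add_apply]
  push_cast
  ring

theorem hasDerivAt_wave_freq (θ : Fin 2 → ℝ) (u : ℝ) (z : ℝ × ℝ) :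
    HasDerivAt (fun v => B.wave (Function.update θ 1 v) z)
      (-Complex.I * ((z.1 - θ 0 : ℝ) : ℂ) * B.wave (Function.update θ 1 u) z) u := by
  have h1 : HasDerivAt (fun v : ℝ => (v : ℂ)) 1 u := by
    simpa using (hasDerivAt_id u).ofReal_comp
  have h3 := (((((h1.const_mul (-Complex.I)).mul_const ((z.1 - θ 0 : ℝ) : ℂ))).sub_const
    (Complex.I * (B.ωI : ℂ) * ((z.2 - B.tI : ℝ) : ℂ))).add_const
      ((-(z.1 - θ 0) ^ 2 * B.σ ^ 2 - (z.2 - B.tI) ^ 2 * B.σi ^ 2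
          + 2 * B.κ * (z.1 - θ 0) * (z.2 - B.tI) * B.σ * B.σi : ℝ) : ℂ)).cexp.const_mul
      (((√(2 * B.σ * B.σi / Real.pi) * (1 - B.κ ^ 2) ^ (1 / 4 : ℝ) : ℝ) : ℂ))
  have hw : ∀ v, B.wave (Function.update θ 1 v) z =
      ((√(2 * B.σ * B.σi / Real.pi) * (1 - B.κ ^ 2) ^ (1 / 4 : ℝ) : ℝ) : ℂ) *
      Complex.exp (-Complex.I * (v : ℂ) * ((z.1 - θ 0 : ℝ) : ℂ)
        - Complex.I * (B.ωI : ℂ) * ((z.2 - B.tI : ℝ) : ℂ)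
        + ((-(z.1 - θ 0) ^ 2 * B.σ ^ 2 - (z.2 - B.tI) ^ 2 * B.σi ^ 2
          + 2 * B.κ * (z.1 - θ 0) * (z.2 - B.tI) * B.σ * B.σi : ℝ) : ℂ)) := fun v => by
    simp [wave]
  simp only [hw]
  refine h3.congr_deriv ?_
  push_cast
  ring

/-- A wave function that is the product of `B.wave θ` and an affine function of the decorrelated
coordinates represents a linear combination of the state and the tangent frame. -/
theorem toLp_eq_combination (θ : Fin 2 → ℝ) {f : ℝ × ℝ → ℂ} (hf : MemLp f 2 volume) (a b c : ℂ)
    (h : ∀ z, f z = (a + b * ((2 * (B.coord θ z).1 : ℝ) : ℂ) +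
      c * ((2 * (B.coord θ z).2 : ℝ) : ℂ)) * B.wave θ z) :
    hf.toLp f = a • B.state θ + b • B.frame₀ θ + c • B.frame₁ θ := by
  have h1 : a • B.state θ + b • B.frame₀ θ + c • B.frame₁ θ =
      ((((B.memLp_wave θ).const_smul a).add
        ((B.memLp_mul_wave θ memLp_fst.1 memLp_fst.2).const_smul b)).add
        ((B.memLp_mul_wave θ memLp_snd.1 memLp_snd.2).const_smul c)).toLp _ := rfl
  rw [h1]
  refine MemLp.toLp_congr _ _ (ae_of_all _ fun z => ?_)
  simp only [h, Pi.add_apply, Pi.smul_apply, smul_eq_mul]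
  ring

theorem memLp_combination (θ : Fin 2 → ℝ) {f : ℝ × ℝ → ℂ} (a b c : ℂ)
    (h : ∀ z, f z = (a + b * ((2 * (B.coord θ z).1 : ℝ) : ℂ) +
      c * ((2 * (B.coord θ z).2 : ℝ) : ℂ)) * B.wave θ z) : MemLp f 2 volume := by
  refine MemLp.ae_eq (ae_of_all _ fun z => ?_)
    ((((B.memLp_wave θ).const_smul a).add
        ((B.memLp_mul_wave θ memLp_fst.1 memLp_fst.2).const_smul b)).add
        ((B.memLp_mul_wave θ memLp_snd.1 memLp_snd.2).const_smul c))
  simp only [h, Pi.add_apply, Pi.smul_apply, smul_eq_mul]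
  ring

theorem hasDerivAt_state_time (θ : Fin 2 → ℝ) :
    HasDerivAt (fun u => B.state (Function.update θ 0 u))
      ((Complex.I * (θ 1 : ℂ)) • B.state θ + (B.σ : ℂ) • B.frame₀ θ) (θ 0) := by
  set f' : ℝ → ℝ × ℝ → ℂ := fun u z =>
    (Complex.I * (θ 1 : ℂ) + (2 * B.σ * (B.coord (Function.update θ 0 u) z).1 : ℝ)) *
        B.wave (Function.update θ 0 u) z with hf'
  have hcomb : ∀ z, f' (θ 0) z = (Complex.I * (θ 1 : ℂ) +
      (B.σ : ℂ) * ((2 * (B.coord θ z).1 : ℝ) : ℂ) +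
        0 * ((2 * (B.coord θ z).2 : ℝ) : ℂ)) * B.wave θ z := by
    intro z
    simp only [hf', Function.update_eq_self]
    push_cast
    ring
  have hm := B.memLp_combination θ _ _ _ hcomb
  have hg : MemLp (fun z => 2 * (|θ 1| + 2 * B.σ ^ 2 + 2 * B.σ) * Real.exp (B.σ ^ 2) *
      ‖((Real.exp (3 / 4 * (B.coord θ z).1 ^ 2) : ℝ) : ℂ) * B.wave θ z‖) 2 volume :=
    (B.memLp_mul_wave θ (G := fun w => ((Real.exp (3 / 4 * w.1 ^ 2) : ℝ) : ℂ)) (by fun_prop)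
      memLp_exp_sq.ofReal).norm.const_mul _
  have h := hasDerivAt_toLp (f := fun u => B.wave (Function.update θ 0 u)) (f' := f') (u₀ := θ 0)
    (fun u => B.memLp_wave _) (fun u _ z => B.hasDerivAt_wave_time θ u z) (fun u hu z => ?_) hg hm
  · rw [B.toLp_eq_combination θ hm _ _ _ hcomb, zero_smul, add_zero] at h
    exact h
  · have hu' : |u - θ 0| ≤ 1 := by
      rw [Metric.mem_ball, Real.dist_eq] at hu
      exact hu.le
    have hx : (B.coord (Function.update θ 0 u) z).1 = (B.coord θ z).1 - B.σ * (u - θ 0) := by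
      simp only [coord, Function.update_self]
      ring
    have hy : (B.coord (Function.update θ 0 u) z).2 = (B.coord θ z).2 := rfl
    have hw : ‖B.wave (Function.update θ 0 u) z‖ = ‖B.wave θ z‖ *
        Real.exp ((B.coord θ z).1 ^ 2 - ((B.coord θ z).1 - B.σ * (u - θ 0)) ^ 2) := by
      rw [B.norm_wave_eq_coord, B.norm_wave_eq_coord, hx, hy, mul_assoc |_|, ← Real.exp_add]
      congr 2
      ring
    have hn : ‖Complex.I * (θ 1 : ℂ) + (2 * B.σ * (B.coord (Function.update θ 0 u) z).1 : ℝ)‖ ≤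
        |θ 1| + 2 * B.σ * |(B.coord θ z).1 - B.σ * (u - θ 0)| := by
      refine (norm_add_le _ _).trans_eq ?_
      rw [hx, norm_mul, Complex.norm_I, one_mul, Complex.norm_real, Complex.norm_real,
        Real.norm_eq_abs, Real.norm_eq_abs, abs_mul (2 * B.σ),
        abs_of_pos (by have := B.σ_pos; positivity : 0 < 2 * B.σ)]
    rw [hf', norm_mul, norm_mul, hw, Complex.norm_real, Real.norm_of_nonneg (Real.exp_nonneg _)]
    have h1 := norm_deriv_wave_le (θ 1) B.σ (B.coord θ z).1 (u - θ 0) B.σ_pos hu'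
    calc _ ≤ (|θ 1| + 2 * B.σ * |(B.coord θ z).1 - B.σ * (u - θ 0)|) * (‖B.wave θ z‖ *
          Real.exp ((B.coord θ z).1 ^ 2 - ((B.coord θ z).1 - B.σ * (u - θ 0)) ^ 2)) :=
          mul_le_mul_of_nonneg_right hn (by positivity)
      _ = ((|θ 1| + 2 * B.σ * |(B.coord θ z).1 - B.σ * (u - θ 0)|) *
          Real.exp ((B.coord θ z).1 ^ 2 - ((B.coord θ z).1 - B.σ * (u - θ 0)) ^ 2)) *
            ‖B.wave θ z‖ := by ring
      _ ≤ _ := mul_le_mul_of_nonneg_right h1 (norm_nonneg _)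
      _ = _ := by ring

theorem hasDerivAt_state_freq (θ : Fin 2 → ℝ) :
    HasDerivAt (fun u => B.state (Function.update θ 1 u))
      ((-(Complex.I / (2 * B.σ * B.coκ))) •
        ((B.coκ : ℂ) • B.frame₀ θ + (B.κ : ℂ) • B.frame₁ θ)) (θ 1) := by
  set f' : ℝ → ℝ × ℝ → ℂ := fun u z =>
    -Complex.I * ((z.1 - θ 0 : ℝ) : ℂ) * B.wave (Function.update θ 1 u) z with hf'
  have hc := B.coκ_pos
  have hσ := B.σ_pos
  have hcomb : ∀ z, f' (θ 1) z = (0 + -(Complex.I / (2 * B.σ * B.coκ)) * B.coκ *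
      ((2 * (B.coord θ z).1 : ℝ) : ℂ) + -(Complex.I / (2 * B.σ * B.coκ)) * B.κ *
      ((2 * (B.coord θ z).2 : ℝ) : ℂ)) * B.wave θ z := by
    intro z
    simp only [hf', Function.update_eq_self, coord]
    have h1 : (B.σ : ℂ) ≠ 0 := by exact_mod_cast hσ.ne'
    have h2 : (B.coκ : ℂ) ≠ 0 := by exact_mod_cast hc.ne'
    push_cast
    field_simp
    ring
  have hm := B.memLp_combination θ _ _ _ hcomb
  have hnorm : ∀ u z, ‖B.wave (Function.update θ 1 u) z‖ = ‖B.wave θ z‖ := fun u z => by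
    rw [B.norm_wave_eq_coord, B.norm_wave_eq_coord]
    simp [coord]
  have h := hasDerivAt_toLp (f := fun u => B.wave (Function.update θ 1 u)) (f' := f') (u₀ := θ 1)
    (fun u => B.memLp_wave _) (fun u _ z => B.hasDerivAt_wave_freq θ u z)
    (g := fun z => ‖f' (θ 1) z‖) (fun u hu z => ?_) hm.norm hm
  · rw [B.toLp_eq_combination θ hm _ _ _ hcomb, zero_smul, zero_add, mul_smul, mul_smul,
      ← smul_add] at h
    exact h
  · simp only [hf', norm_mul, hnorm]
    exact le_rfl

end Biphoton

/-! ### The quantum Fisher information of a family of pure states -/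

section Qfim

variable {H : Type*} [NormedAddCommGroup H] [InnerProductSpace ℂ H] [CompleteSpace H]
  {ι : Type*} [DecidableEq ι]

theorem isBoundedBilinearMap_rankOne :
    IsBoundedBilinearMap ℝ fun p : H × H => InnerProductSpace.rankOne ℂ p.1 p.2 where
  add_left := fun x y z => by simp
  smul_left := fun c x y => by
    rw [← Complex.coe_smul, map_smul, smul_apply, Complex.coe_smul]
  add_right := fun x y z => by simp
  smul_right := fun c x y => by
    rw [← Complex.coe_smul, map_smulₛₗ, Complex.conj_ofReal, Complex.coe_smul]
  bound := ⟨1, one_pos, fun x y => by simp⟩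

theorem hasDerivAt_bilinear_diag {V W : Type*} [NormedAddCommGroup V] [NormedSpace ℝ V]
    [NormedAddCommGroup W] [NormedSpace ℝ W] {b : V × V → W} (hb : IsBoundedBilinearMap ℝ b)
    {Ψ : ℝ → V} {d : V} {u : ℝ} (hd : HasDerivAt Ψ d u) :
    HasDerivAt (fun v => b (Ψ v, Ψ v)) (b (Ψ u, d) + b (d, Ψ u)) u := by
  have h := (hb.hasFDerivAt (Ψ u, Ψ u)).comp_hasDerivAt u (hd.prodMk hd)
  simpa [Function.comp_def] using h

theorem hasDerivAt_pureState {Ψ : ℝ → H} {d : H} {u : ℝ} (hd : HasDerivAt Ψ d u) :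
    HasDerivAt (fun v => pureState (Ψ v))
      (InnerProductSpace.rankOne ℂ (Ψ u) d + InnerProductSpace.rankOne ℂ d (Ψ u)) u :=
  hasDerivAt_bilinear_diag isBoundedBilinearMap_rankOne hd

/-- The action of a symmetric logarithmic derivative on the unit vector `ψ`: twice the component of
the derivative `d` orthogonal to `ψ`. As `⟨ψ, d⟩` is imaginary, subtracting `⟨ψ, d⟩ ψ` amounts to
adding `⟨d, ψ⟩ ψ`. -/
noncomputable def sldVector (ψ d : H) : H := (2 : ℂ) • (d + ⟪d, ψ⟫_ℂ • ψ)

theorem IsSLD.apply_state {Ψ : (ι → ℝ) → H} {θ : ι → ℝ} {j : ι} {L : H →L[ℂ] H} {d : H}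
    (hL : IsSLD Ψ θ j L) (hΨ : ‖Ψ θ‖ = 1)
    (hd : HasDerivAt (fun u => Ψ (Function.update θ j u)) d (θ j))
    (hre : ⟪Ψ θ, d⟫_ℂ + ⟪d, Ψ θ⟫_ℂ = 0) : L (Ψ θ) = sldVector (Ψ θ) d := by
  have h1 := hL.2.unique (hasDerivAt_pureState hd)
  rw [Function.update_eq_self] at h1
  have hn : ⟪Ψ θ, Ψ θ⟫_ℂ = 1 := by
    rw [inner_self_eq_norm_sq_to_K, hΨ]
    simp
  have h2 := congrArg (fun A : H →L[ℂ] H => A (Ψ θ)) h1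
  simp only [pureState, smul_apply, add_apply, ContinuousLinearMap.mul_def,
    ContinuousLinearMap.comp_apply,
    InnerProductSpace.rankOne_apply, hn, one_smul] at h2
  have h3 := congrArg (fun x => ⟪Ψ θ, x⟫_ℂ) h2
  simp only [inner_smul_right, inner_add_right, hn] at h3
  have h4 : ⟪Ψ θ, L (Ψ θ)⟫_ℂ = 0 := by linear_combination h3 + hre
  rw [h4, zero_smul, zero_add] at h2
  rw [sldVector, add_comm d, ← h2, smul_smul]
  norm_num

theorem isSLD_rankOne {Ψ : (ι → ℝ) → H} {θ : ι → ℝ} {j : ι} {d : H} (hΨ : ‖Ψ θ‖ = 1)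
    (hd : HasDerivAt (fun u => Ψ (Function.update θ j u)) d (θ j))
    (hre : ⟪Ψ θ, d⟫_ℂ + ⟪d, Ψ θ⟫_ℂ = 0) :
    IsSLD Ψ θ j ((2 : ℂ) • (InnerProductSpace.rankOne ℂ (Ψ θ) d +
      InnerProductSpace.rankOne ℂ d (Ψ θ))) := by
  have hn : ⟪Ψ θ, Ψ θ⟫_ℂ = 1 := by
    rw [inner_self_eq_norm_sq_to_K, hΨ]
    simp
  refine ⟨?_, ?_⟩
  · rw [ContinuousLinearMap.isSelfAdjoint_iff_isSymmetric]
    intro x y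
    simp only [ContinuousLinearMap.coe_coe, smul_apply, add_apply,
      InnerProductSpace.rankOne_apply, inner_smul_left, inner_smul_right, inner_add_left,
      inner_add_right, inner_conj_symm, map_ofNat]
    ring
  · have h := hasDerivAt_pureState hd
    rw [Function.update_eq_self] at h
    refine h.congr_deriv ?_
    ext x
    simp only [pureState, smul_apply, add_apply, ContinuousLinearMap.mul_def,
    ContinuousLinearMap.comp_apply,
      InnerProductSpace.rankOne_apply, hn, one_smul, map_smul, map_add, smul_add, smul_smul]
    have h5 : ⟪d, Ψ θ⟫_ℂ = -⟪Ψ θ, d⟫_ℂ := by linear_combination hre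
    simp only [h5]
    module

/-- All symmetric logarithmic derivatives agree on the state, so the quantum Fisher information
matrix is unique, and given by the Gram matrix of the vectors `L_j Ψ`. -/
theorem isQFIM_iff {Ψ : (ι → ℝ) → H} {θ : ι → ℝ} {d : ι → H} (hΨ : ‖Ψ θ‖ = 1)
    (hd : ∀ j, HasDerivAt (fun u => Ψ (Function.update θ j u)) (d j) (θ j))
    (hre : ∀ j, ⟪Ψ θ, d j⟫_ℂ + ⟪d j, Ψ θ⟫_ℂ = 0) (F : Matrix ι ι ℝ) :
    IsQFIM Ψ θ F ↔
      ∀ j k, F j k = (⟪sldVector (Ψ θ) (d j), sldVector (Ψ θ) (d k)⟫_ℂ).re := by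
  have key : ∀ L : ι → (H →L[ℂ] H), (∀ j, IsSLD Ψ θ j (L j)) → ∀ j k,
      (1 / 2 : ℂ) * ⟪Ψ θ, (L j * L k + L k * L j) (Ψ θ)⟫_ℂ =
        (((⟪sldVector (Ψ θ) (d j), sldVector (Ψ θ) (d k)⟫_ℂ).re : ℝ) : ℂ) := by
    intro L hL j k
    have h1 : ∀ j, ∀ x y, ⟪x, L j y⟫_ℂ = ⟪L j x, y⟫_ℂ := fun j x y =>
      ((ContinuousLinearMap.isSelfAdjoint_iff_isSymmetric.1 (hL j).1) x y).symm
    rw [add_apply, ContinuousLinearMap.mul_def, ContinuousLinearMap.comp_apply,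
      ContinuousLinearMap.mul_def, ContinuousLinearMap.comp_apply,
      inner_add_right, h1 j, h1 k (Ψ θ), (hL j).apply_state hΨ (hd j) (hre j),
      (hL k).apply_state hΨ (hd k) (hre k),
      ← inner_conj_symm (sldVector (Ψ θ) (d k)), Complex.add_conj]
    push_cast
    ring
  constructor
  · rintro ⟨L, hL, hF⟩ j k
    exact_mod_cast (hF j k).trans (key L hL j k)
  · intro hF
    have hL := fun j => isSLD_rankOne hΨ (hd j) (hre j)
    exact ⟨_, hL, fun j k => by rw [key _ hL, hF]⟩

end Qfim

/-! ### Information bounds for the biphoton -/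

namespace Biphoton

variable (B : Biphoton)

/-- The derivatives of the state in the central time and in the central frequency. -/
noncomputable def tangent (θ : Fin 2 → ℝ) : Fin 2 → BiphotonSpace :=
  ![(Complex.I * (θ 1 : ℂ)) • B.state θ + (B.σ : ℂ) • B.frame₀ θ,
    (-(Complex.I / (2 * B.σ * B.coκ))) • ((B.coκ : ℂ) • B.frame₀ θ + (B.κ : ℂ) • B.frame₁ θ)]

theorem hasDerivAt_state (θ : Fin 2 → ℝ) (j : Fin 2) :
    HasDerivAt (fun u => B.state (Function.update θ j u)) (B.tangent θ j) (θ j) := by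
  fin_cases j
  · exact B.hasDerivAt_state_time θ
  · exact B.hasDerivAt_state_freq θ

theorem inner_frame₀_state (θ : Fin 2 → ℝ) : ⟪B.frame₀ θ, B.state θ⟫_ℂ = 0 := by
  rw [← inner_conj_symm, B.inner_state_frame₀, map_zero]

theorem inner_frame₁_state (θ : Fin 2 → ℝ) : ⟪B.frame₁ θ, B.state θ⟫_ℂ = 0 := by
  rw [← inner_conj_symm, B.inner_state_frame₁, map_zero]

theorem inner_frame₁_frame₀ (θ : Fin 2 → ℝ) : ⟪B.frame₁ θ, B.frame₀ θ⟫_ℂ = 0 := by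
  rw [← inner_conj_symm, B.inner_frame₀_frame₁, map_zero]

theorem sldVector_time (θ : Fin 2 → ℝ) :
    sldVector (B.state θ) (B.tangent θ 0) = (2 * B.σ : ℂ) • B.frame₀ θ := by
  simp only [sldVector, tangent, Matrix.cons_val_zero, inner_add_left, inner_smul_left,
    B.inner_state_self, B.inner_frame₀_state, map_mul, Complex.conj_I, Complex.conj_ofReal]
  module

theorem sldVector_freq (θ : Fin 2 → ℝ) :
    sldVector (B.state θ) (B.tangent θ 1) = (-(Complex.I / (B.σ * B.coκ))) •
      ((B.coκ : ℂ) • B.frame₀ θ + (B.κ : ℂ) • B.frame₁ θ) := by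
  have h1 : (B.σ : ℂ) ≠ 0 := by exact_mod_cast B.σ_pos.ne'
  have h2 : (B.coκ : ℂ) ≠ 0 := by exact_mod_cast B.coκ_pos.ne'
  simp only [sldVector, tangent, Matrix.cons_val_one, Matrix.cons_val_zero, inner_add_left,
    inner_smul_left, B.inner_frame₀_state, B.inner_frame₁_state, mul_zero, add_zero, zero_smul,
    smul_smul (2 : ℂ)]
  congr 1
  field_simp

theorem isQFIM_iff (θ : Fin 2 → ℝ) (F : Matrix (Fin 2) (Fin 2) ℝ) :
    IsQFIM B.state θ F ↔ F = !![4 * B.σ ^ 2, 0; 0, 1 / (B.σ ^ 2 * (1 - B.κ ^ 2))] := by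
  have hσ := B.σ_pos.ne'
  have hc := B.coκ_pos.ne'
  have hre : ∀ j, ⟪B.state θ, B.tangent θ j⟫_ℂ + ⟪B.tangent θ j, B.state θ⟫_ℂ = 0 := by
    intro j
    fin_cases j
    · simp only [Fin.zero_eta, tangent, Matrix.cons_val_zero, inner_add_left, inner_add_right,
        inner_smul_left, inner_smul_right, B.inner_state_self, B.inner_frame₀_state,
        B.inner_state_frame₀, map_mul, Complex.conj_I, Complex.conj_ofReal]
      ring
    · simp only [Fin.mk_one, tangent, Matrix.cons_val_one, Matrix.cons_val_zero, inner_add_left,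
        inner_add_right, inner_smul_left, inner_smul_right, B.inner_frame₁_state,
        B.inner_frame₀_state, B.inner_state_frame₀, B.inner_state_frame₁]
      ring
  have h00 : (⟪sldVector (B.state θ) (B.tangent θ 0), sldVector (B.state θ) (B.tangent θ 0)⟫_ℂ).re
      = 4 * B.σ ^ 2 := by
    rw [sldVector_time, inner_smul_left, inner_smul_right, B.inner_frame₀_self]
    have : (starRingEnd ℂ) (2 * (B.σ : ℂ)) * (2 * (B.σ : ℂ) * 1) = ((4 * B.σ ^ 2 : ℝ) : ℂ) := by
      simp only [map_mul, map_ofNat, Complex.conj_ofReal]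
      push_cast
      ring
    rw [this, Complex.ofReal_re]
  have h01 : (⟪sldVector (B.state θ) (B.tangent θ 0), sldVector (B.state θ) (B.tangent θ 1)⟫_ℂ).re
      = 0 := by
    rw [sldVector_time, sldVector_freq, inner_smul_left, inner_smul_right, inner_add_right,
      inner_smul_right, inner_smul_right, B.inner_frame₀_self, B.inner_frame₀_frame₁]
    have : (starRingEnd ℂ) (2 * (B.σ : ℂ)) * (-(Complex.I / (B.σ * B.coκ)) *
        (B.coκ * 1 + B.κ * 0)) = ((-2 * B.σ / (B.σ * B.coκ) * B.coκ : ℝ) : ℂ) * Complex.I := by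
      simp only [map_mul, map_ofNat, Complex.conj_ofReal]
      push_cast
      ring
    rw [this, Complex.re_ofReal_mul, Complex.I_re, mul_zero]
  have h10 : (⟪sldVector (B.state θ) (B.tangent θ 1), sldVector (B.state θ) (B.tangent θ 0)⟫_ℂ).re
      = 0 := by
    rw [← inner_conj_symm, Complex.conj_re, h01]
  have h11 : (⟪sldVector (B.state θ) (B.tangent θ 1), sldVector (B.state θ) (B.tangent θ 1)⟫_ℂ).re
      = 1 / (B.σ ^ 2 * (1 - B.κ ^ 2)) := by
    rw [sldVector_freq, inner_smul_left, inner_smul_right, inner_add_right, inner_add_left,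
      inner_add_left]
    simp only [inner_smul_left, inner_smul_right, B.inner_frame₀_self, B.inner_frame₁_self,
      B.inner_frame₀_frame₁, B.inner_frame₁_frame₀, Complex.conj_ofReal, ← B.coκ_sq]
    have h2 : (B.coκ : ℂ) ^ 2 + (B.κ : ℂ) ^ 2 = 1 := by
      have := B.coκ_sq
      exact_mod_cast (by linarith : B.coκ ^ 2 + B.κ ^ 2 = 1)
    have : (starRingEnd ℂ) (-(Complex.I / (B.σ * B.coκ))) * (-(Complex.I / (B.σ * B.coκ)) *
        (B.coκ * (B.coκ * 1) + B.coκ * (B.κ * 0) + (B.κ * (B.coκ * 0) + B.κ * (B.κ * 1)))) =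
        ((1 / (B.σ ^ 2 * B.coκ ^ 2) : ℝ) : ℂ) := by
      simp only [map_neg, map_div₀, map_mul, Complex.conj_I, Complex.conj_ofReal]
      push_cast
      linear_combination (-(Complex.I ^ 2) / (B.σ ^ 2 * B.coκ ^ 2 : ℂ)) * h2 -
        (1 / (B.σ ^ 2 * B.coκ ^ 2 : ℂ)) * Complex.I_sq
    rw [this, Complex.ofReal_re]
  rw [QuantumRadar.isQFIM_iff (B.norm_state θ) (B.hasDerivAt_state θ) hre]
  constructor
  · intro h
    ext j k
    fin_cases j <;> fin_cases k
    · exact (h 0 0).trans h00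
    · exact (h 0 1).trans h01
    · exact (h 1 0).trans h10
    · exact (h 1 1).trans h11
  · rintro rfl j k
    fin_cases j <;> fin_cases k
    · exact h00.symm
    · exact h01.symm
    · exact h10.symm
    · exact h11.symm

variable {X : Type*} [MeasurableSpace X]

/-- The trade-off between the two scores, in units of the quantum Fisher information: the vectors
`v₀ ± i v₁`, where `v₀ = e₀` and `v₁ = -i (√(1 - κ²) e₀ + κ e₁)`, have the norms
`√(2 ± 2 √(1 - κ²))`, whose product is `2 κ`. -/
theorem info_le (M : POVM X BiphotonSpace) (θ : Fin 2 → ℝ) {s₀ s₁ : X → ℝ}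
    (h₀ : IsScore (B.model M) θ 0 s₀) (h₁ : IsScore (B.model M) θ 1 s₁) :
    (∫ x, s₀ x ^ 2 ∂(B.model M θ)) / (4 * B.σ ^ 2) +
      (∫ x, s₁ x ^ 2 ∂(B.model M θ)) * (B.σ ^ 2 * (1 - B.κ ^ 2)) ≤ 1 + B.κ := by
  have hσ := B.σ_pos
  have hc := B.coκ_pos
  have hσ' : (B.σ : ℂ) ≠ 0 := by exact_mod_cast hσ.ne'
  have hc' : (B.coκ : ℂ) ≠ 0 := by exact_mod_cast hc.ne'
  obtain ⟨h₀m, h₀E⟩ := (M.isScore_iff (B.hasDerivAt_state θ 0)).1 h₀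
  obtain ⟨h₁m, h₁E⟩ := (M.isScore_iff (B.hasDerivAt_state θ 1)).1 h₁
  set w := (B.coκ : ℂ) • B.frame₀ θ + (B.κ : ℂ) • B.frame₁ θ with hw
  have e₀ : ∀ E, MeasurableSet E → ∫ x in E, (2 * B.σ)⁻¹ * s₀ x ∂(M.prob (B.state θ)) =
      (⟪M.effect E (B.state θ), B.frame₀ θ⟫_ℂ).re := by
    intro E hE
    have him : (⟪M.effect E (B.state θ), B.state θ⟫_ℂ).im = 0 := by
      refine Complex.conj_eq_iff_im.1 ?_
      rw [inner_conj_symm, M.inner_effect hE]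
    rw [integral_const_mul, h₀E E hE]
    simp only [tangent, Matrix.cons_val_zero, inner_add_right, inner_smul_right, Complex.add_re,
      Complex.re_ofReal_mul, mul_assoc Complex.I, Complex.I_mul_re, Complex.im_ofReal_mul, him]
    field_simp
    ring
  have e₁ : ∀ E, MeasurableSet E → ∫ x in E, (B.σ * B.coκ) * s₁ x ∂(M.prob (B.state θ)) =
      (⟪M.effect E (B.state θ), (-Complex.I) • w⟫_ℂ).re := by
    intro E hE
    rw [integral_const_mul, h₁E E hE, ← mul_assoc, ← Complex.re_ofReal_mul, inner_smul_right]
    simp only [tangent, Matrix.cons_val_one, Matrix.cons_val_zero, inner_smul_right]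
    congr 1
    rw [← hw]
    push_cast
    field_simp
  have h := M.integral_sq_add_integral_sq_le (h₀m.const_mul _) (h₁m.const_mul _) e₀ e₁
  have hI : Complex.I • (-Complex.I) • w = w := by
    rw [smul_smul]
    simp
  have hnorm : ∀ a b : ℝ, ‖(a : ℂ) • B.frame₀ θ + (b : ℂ) • B.frame₁ θ‖ = √(a ^ 2 + b ^ 2) := by
    intro a b
    rw [← Real.sqrt_sq (norm_nonneg _), ← inner_self_eq_norm_sq (𝕜 := ℂ)]
    congr 1
    have h2 : ⟪(a : ℂ) • B.frame₀ θ + (b : ℂ) • B.frame₁ θ,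
        (a : ℂ) • B.frame₀ θ + (b : ℂ) • B.frame₁ θ⟫_ℂ = ((a ^ 2 + b ^ 2 : ℝ) : ℂ) := by
      simp only [inner_add_left, inner_add_right, inner_smul_left, inner_smul_right,
        B.inner_frame₀_self, B.inner_frame₁_self, B.inner_frame₀_frame₁, B.inner_frame₁_frame₀,
        Complex.conj_ofReal]
      push_cast
      ring
    rw [h2]
    exact Complex.ofReal_re _
  have hp : B.frame₀ θ + w = ((1 + B.coκ : ℝ) : ℂ) • B.frame₀ θ + (B.κ : ℂ) • B.frame₁ θ := by
    rw [hw]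
    push_cast
    module
  have hm : B.frame₀ θ - w =
      ((1 - B.coκ : ℝ) : ℂ) • B.frame₀ θ + ((-B.κ : ℝ) : ℂ) • B.frame₁ θ := by
    rw [hw]
    push_cast
    module
  rw [hI, hp, hm, hnorm, hnorm] at h
  have hcκ := B.coκ_sq
  have hc1 : B.coκ ≤ 1 := by nlinarith [sq_nonneg B.κ]
  have hA : (1 + B.coκ) ^ 2 + B.κ ^ 2 = 2 + 2 * B.coκ := by linarith
  have hB : (1 - B.coκ) ^ 2 + (-B.κ) ^ 2 = 2 - 2 * B.coκ := by linarith
  have hprod : √(2 + 2 * B.coκ) * √(2 - 2 * B.coκ) = 2 * B.κ := by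
    rw [← Real.sqrt_mul (by positivity), ← Real.sqrt_sq (by positivity [B.κ_nonneg] : 0 ≤ 2 * B.κ)]
    congr 1
    linear_combination (-4) * hcκ
  rw [hA, hB, div_pow, add_sq, Real.sq_sqrt (by linarith), Real.sq_sqrt (by linarith),
    mul_assoc 2, hprod] at h
  simp only [mul_pow] at h
  rw [integral_const_mul, integral_const_mul, hcκ] at h
  have e : ((2 * B.σ)⁻¹) ^ 2 = (4 * B.σ ^ 2)⁻¹ := by
    rw [inv_pow]
    ring
  rw [inv_pow, mul_pow] at h
  have e2 : ∀ a b : ℝ, a / (4 * B.σ ^ 2) + b * (B.σ ^ 2 * (1 - B.κ ^ 2)) =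
      (2 ^ 2 * B.σ ^ 2)⁻¹ * a + B.σ ^ 2 * (1 - B.κ ^ 2) * b := fun a b => by
    rw [div_eq_inv_mul]
    ring
  refine (e2 _ _).trans_le (h.trans_eq ?_)
  ring

end Biphoton

namespace Biphoton

variable (B : Biphoton) {X : Type*} [MeasurableSpace X]

theorem trace_inv_mul (FC : Matrix (Fin 2) (Fin 2) ℝ) :
    ((!![4 * B.σ ^ 2, 0; 0, 1 / (B.σ ^ 2 * (1 - B.κ ^ 2))] : Matrix (Fin 2) (Fin 2) ℝ)⁻¹ *
      FC).trace = FC 0 0 / (4 * B.σ ^ 2) + FC 1 1 * (B.σ ^ 2 * (1 - B.κ ^ 2)) := by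
  have hσ := B.σ_pos
  have hκ := B.one_sub_κ_sq_pos
  have h : (!![4 * B.σ ^ 2, 0; 0, 1 / (B.σ ^ 2 * (1 - B.κ ^ 2))] : Matrix (Fin 2) (Fin 2) ℝ)⁻¹ =
      !![1 / (4 * B.σ ^ 2), 0; 0, B.σ ^ 2 * (1 - B.κ ^ 2)] := by
    refine Matrix.inv_eq_right_inv ?_
    rw [Matrix.mul_fin_two, Matrix.one_fin_two]
    congr 2 <;> simp <;> field_simp
  rw [h, Matrix.trace_fin_two, Matrix.mul_apply, Matrix.mul_apply]
  simp
  ring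

theorem exists_score_of_isCFIM {M : POVM X BiphotonSpace} {θ : Fin 2 → ℝ}
    {FQ FC : Matrix (Fin 2) (Fin 2) ℝ} (hQ : IsQFIM B.state θ FQ) (hC : IsCFIM (B.model M) θ FC) :
    ∃ s₀ s₁ : X → ℝ, IsScore (B.model M) θ 0 s₀ ∧ IsScore (B.model M) θ 1 s₁ ∧
      (FQ⁻¹ * FC).trace = (∫ x, s₀ x ^ 2 ∂(B.model M θ)) / (4 * B.σ ^ 2) +
        (∫ x, s₁ x ^ 2 ∂(B.model M θ)) * (B.σ ^ 2 * (1 - B.κ ^ 2)) := by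
  obtain ⟨s, hs, hF⟩ := hC
  refine ⟨s 0, s 1, hs 0, hs 1, ?_⟩
  rw [(B.isQFIM_iff θ FQ).1 hQ, B.trace_inv_mul, hF, hF]
  simp only [sq]

theorem trace_le (M : POVM X BiphotonSpace) (θ : Fin 2 → ℝ) {FQ FC : Matrix (Fin 2) (Fin 2) ℝ}
    (hQ : IsQFIM B.state θ FQ) (hC : IsCFIM (B.model M) θ FC) :
    (FQ⁻¹ * FC).trace ≤ 1 + B.κ := by
  obtain ⟨s₀, s₁, h₀, h₁, h⟩ := B.exists_score_of_isCFIM hQ hC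
  rw [h]
  exact B.info_le M θ h₀ h₁

/-- The two Cramér–Rao inequalities combined: `1 ≤ 4 V₀ V₁ a b / (1 - κ²)`, where `V` are the
variances and `a`, `b` the normalised informations, whose sum the trade-off bounds. -/
theorem one_sub_sq_le_of_isLocallyUnbiased {M : POVM X BiphotonSpace} {θ : Fin 2 → ℝ}
    {est : Fin 2 → X → ℝ} (hest : IsLocallyUnbiased (B.model M) θ est) {s₀ s₁ : X → ℝ}
    (h₀ : IsScore (B.model M) θ 0 s₀) (h₁ : IsScore (B.model M) θ 1 s₁) :
    1 - B.κ ^ 2 ≤ (stdDev (B.model M θ) (est 0) * stdDev (B.model M θ) (est 1)) ^ 2 *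
      ((∫ x, s₀ x ^ 2 ∂(B.model M θ)) / (4 * B.σ ^ 2) +
        (∫ x, s₁ x ^ 2 ∂(B.model M θ)) * (B.σ ^ 2 * (1 - B.κ ^ 2))) ^ 2 := by
  have hσ := B.σ_pos
  have hκ := B.one_sub_κ_sq_pos
  have c₀ := hest.one_le_variance_mul B.norm_state (B.hasDerivAt_state θ 0) h₀
  have c₁ := hest.one_le_variance_mul B.norm_state (B.hasDerivAt_state θ 1) h₁
  rw [mul_pow, stdDev, stdDev, Real.sq_sqrt (ProbabilityTheory.variance_nonneg _ _),
    Real.sq_sqrt (ProbabilityTheory.variance_nonneg _ _)]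
  have v₀ := ProbabilityTheory.variance_nonneg (est 0) (B.model M θ)
  have v₁ := ProbabilityTheory.variance_nonneg (est 1) (B.model M θ)
  change 1 ≤ ProbabilityTheory.variance (est 0) (B.model M θ) * ∫ x, s₀ x ^ 2 ∂(B.model M θ) at c₀
  change 1 ≤ ProbabilityTheory.variance (est 1) (B.model M θ) * ∫ x, s₁ x ^ 2 ∂(B.model M θ) at c₁
  set V₀ := ProbabilityTheory.variance (est 0) (B.model M θ)
  set V₁ := ProbabilityTheory.variance (est 1) (B.model M θ)
  set I₀ := ∫ x, s₀ x ^ 2 ∂(B.model M θ)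
  set I₁ := ∫ x, s₁ x ^ 2 ∂(B.model M θ)
  set K := 1 - B.κ ^ 2
  have h1 : 1 ≤ (V₀ * I₀) * (V₁ * I₁) := by nlinarith
  have h2 : 4 * (I₀ / (4 * B.σ ^ 2) * (I₁ * (B.σ ^ 2 * K))) ≤
      (I₀ / (4 * B.σ ^ 2) + I₁ * (B.σ ^ 2 * K)) ^ 2 := by
    nlinarith [sq_nonneg (I₀ / (4 * B.σ ^ 2) - I₁ * (B.σ ^ 2 * K))]
  have h3 : 4 * (I₀ / (4 * B.σ ^ 2) * (I₁ * (B.σ ^ 2 * K))) = I₀ * I₁ * K := by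
    field_simp
  calc K ≤ ((V₀ * I₀) * (V₁ * I₁)) * K := le_mul_of_one_le_left hκ.le h1
    _ = V₀ * V₁ * (I₀ * I₁ * K) := by ring
    _ ≤ _ := by
      rw [← h3]
      exact mul_le_mul_of_nonneg_left h2 (mul_nonneg v₀ v₁)

theorem refinedBound_nonneg (κ : ℝ) : 0 ≤ refinedBound κ := Real.sqrt_nonneg _

theorem refinedBound_sq : refinedBound B.κ ^ 2 = (1 - B.κ) / (1 + B.κ) := by
  have h1 := B.κ_nonneg
  have h2 := B.κ_lt_one
  exact Real.sq_sqrt (div_nonneg (by linarith) (by linarith))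

theorem one_sub_sq_eq : 1 - B.κ ^ 2 = refinedBound B.κ ^ 2 * (1 + B.κ) ^ 2 := by
  have h1 := B.κ_nonneg
  rw [B.refinedBound_sq]
  field_simp
  ring

theorem refinedBound_le_stdDev_mul (M : POVM X BiphotonSpace) (θ : Fin 2 → ℝ)
    {est : Fin 2 → X → ℝ} (hest : IsLocallyUnbiased (B.model M) θ est) :
    refinedBound B.κ ≤ stdDev (B.model M θ) (est 0) * stdDev (B.model M θ) (est 1) := by
  obtain ⟨s₀, h₀⟩ := M.exists_isScore (B.hasDerivAt_state θ 0)
  obtain ⟨s₁, h₁⟩ := M.exists_isScore (B.hasDerivAt_state θ 1)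
  have hκ := B.κ_nonneg
  have h := B.one_sub_sq_le_of_isLocallyUnbiased hest h₀ h₁
  have hle := B.info_le M θ h₀ h₁
  set S := stdDev (B.model M θ) (est 0) * stdDev (B.model M θ) (est 1) with hS
  have hS0 : 0 ≤ S := mul_nonneg (Real.sqrt_nonneg _) (Real.sqrt_nonneg _)
  have hI0 : 0 ≤ (∫ x, s₀ x ^ 2 ∂(B.model M θ)) / (4 * B.σ ^ 2) +
      (∫ x, s₁ x ^ 2 ∂(B.model M θ)) * (B.σ ^ 2 * (1 - B.κ ^ 2)) :=
    add_nonneg (div_nonneg (integral_nonneg fun x => sq_nonneg _) (by positivity))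
      (mul_nonneg (integral_nonneg fun x => sq_nonneg _)
        (mul_nonneg (sq_nonneg _) B.one_sub_κ_sq_pos.le))
  have h2 := h.trans (mul_le_mul_of_nonneg_left (pow_le_pow_left₀ hI0 hle 2) (sq_nonneg S))
  rw [B.one_sub_sq_eq] at h2
  exact (pow_le_pow_iff_left₀ (refinedBound_nonneg _) hS0 two_ne_zero).1
    (le_of_mul_le_mul_right h2 (by positivity))

/-- A measurement that admits a locally unbiased estimator attaining the uncertainty relation also
attains the trade-off: by the Cramér–Rao inequality its informations cannot be smaller. -/
theorem trace_eq_of_stdDev_mul_eq {M : POVM X BiphotonSpace} {θ : Fin 2 → ℝ}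
    {est : Fin 2 → X → ℝ} (hest : IsLocallyUnbiased (B.model M) θ est)
    (heq : stdDev (B.model M θ) (est 0) * stdDev (B.model M θ) (est 1) = refinedBound B.κ)
    {FQ FC : Matrix (Fin 2) (Fin 2) ℝ} (hQ : IsQFIM B.state θ FQ)
    (hC : IsCFIM (B.model M) θ FC) : (FQ⁻¹ * FC).trace = 1 + B.κ := by
  refine le_antisymm (B.trace_le M θ hQ hC) ?_
  obtain ⟨s₀, s₁, h₀, h₁, htr⟩ := B.exists_score_of_isCFIM hQ hC
  have hκ := B.κ_nonneg
  have hκ1 := B.κ_lt_one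
  have h := B.one_sub_sq_le_of_isLocallyUnbiased hest h₀ h₁
  rw [heq] at h
  rw [htr]
  have hI0 : 0 ≤ (∫ x, s₀ x ^ 2 ∂(B.model M θ)) / (4 * B.σ ^ 2) +
      (∫ x, s₁ x ^ 2 ∂(B.model M θ)) * (B.σ ^ 2 * (1 - B.κ ^ 2)) :=
    add_nonneg (div_nonneg (integral_nonneg fun x => sq_nonneg _) (by positivity))
      (mul_nonneg (integral_nonneg fun x => sq_nonneg _)
        (mul_nonneg (sq_nonneg _) B.one_sub_κ_sq_pos.le))
  set T := (∫ x, s₀ x ^ 2 ∂(B.model M θ)) / (4 * B.σ ^ 2) +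
      (∫ x, s₁ x ^ 2 ∂(B.model M θ)) * (B.σ ^ 2 * (1 - B.κ ^ 2))
  have hb : 0 < refinedBound B.κ ^ 2 := by
    rw [B.refinedBound_sq]
    exact div_pos (by linarith) (by linarith)
  rw [B.one_sub_sq_eq] at h
  exact (pow_le_pow_iff_left₀ (by linarith) hI0 two_ne_zero).1 (le_of_mul_le_mul_left h hb)

end Biphoton

theorem refinedBound_zero : refinedBound 0 = 1 := by
  simp [refinedBound]

theorem tendsto_refinedBound : Tendsto refinedBound (𝓝[<] 1) (𝓝 0) := by
  have h : ContinuousAt refinedBound 1 := by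
    unfold refinedBound
    refine Real.continuous_sqrt.continuousAt.comp (f := fun κ : ℝ => (1 - κ) / (1 + κ)) ?_
    exact (by fun_prop : ContinuousAt (fun κ : ℝ => 1 - κ) 1).div (by fun_prop) (by norm_num)
  have h1 := h.tendsto
  have h2 : refinedBound 1 = 0 := by simp [refinedBound]
  rw [h2] at h1
  exact h1.mono_left nhdsWithin_le_nhds

/-! ### Projective measurements with finitely many outcomes -/

section FiniteMeasurement

variable {H : Type*} [NormedAddCommGroup H] [InnerProductSpace ℂ H] [CompleteSpace H] {n : ℕ}

theorem isStarProjection_sum {P : Fin n → H →L[ℂ] H} (hP : OrthogonalIdempotents P)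
    (hsa : ∀ k, IsSelfAdjoint (P k)) (S : Finset (Fin n)) : IsStarProjection (∑ k ∈ S, P k) :=
  ⟨hP.isIdempotentElem_sum, isSelfAdjoint_sum _ fun k _ => hsa k⟩

open Classical in
/-- The measurement given by a resolution of the identity into mutually orthogonal projections. -/
noncomputable def POVM.ofProjections (P : Fin n → H →L[ℂ] H) (hP : CompleteOrthogonalIdempotents P)
    (hsa : ∀ k, IsSelfAdjoint (P k)) : POVM (Fin n) H where
  effect E := ∑ k with k ∈ E, P k
  isPositive E _ :=
    .of_isStarProjection (isStarProjection_sum hP.toOrthogonalIdempotents hsa _)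
  univ := by simp [hP.complete]
  hasSum E _ hd φ := by
    simp only [Finset.sum_filter, sum_apply, inner_sum]
    refine hasSum_sum fun k _ => ?_
    by_cases hk : k ∈ ⋃ m, E m
    · obtain ⟨m, hm⟩ := Set.mem_iUnion.1 hk
      rw [if_pos hk]
      have h := hasSum_single (f := fun m => ⟪φ, (if k ∈ E m then P k else 0) φ⟫_ℂ) m
        fun m' hm' => by
          rw [if_neg fun h => (Set.disjoint_left.1 (hd hm') h) hm]
          simp
      simpa [hm] using h
    · have h : ∀ m, k ∉ E m := fun m hm => hk (Set.mem_iUnion.2 ⟨m, hm⟩)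
      simp [h]

theorem POVM.isProjective_ofProjections {P : Fin n → H →L[ℂ] H}
    (hP : CompleteOrthogonalIdempotents P) (hsa : ∀ k, IsSelfAdjoint (P k)) :
    (POVM.ofProjections P hP hsa).IsProjective := fun _ _ => hP.isIdempotentElem_sum

theorem POVM.ofProjections_singleton {P : Fin n → H →L[ℂ] H}
    (hP : CompleteOrthogonalIdempotents P) (hsa : ∀ k, IsSelfAdjoint (P k)) (k : Fin n) :
    (POVM.ofProjections P hP hsa).effect {k} = P k := by
  simp [POVM.ofProjections, Finset.sum_filter]

/-- The projections onto the members of an orthonormal family, preceded by the projection onto the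
orthogonal complement of their span. -/
noncomputable def basisProjection (m : Fin n → H) (k : Fin (n + 1)) : H →L[ℂ] H :=
  (finSuccEquiv n k).elim (1 - ∑ l, InnerProductSpace.rankOne ℂ (m l) (m l))
    fun l => InnerProductSpace.rankOne ℂ (m l) (m l)

theorem completeOrthogonalIdempotents_basisProjection {H : Type*} [NormedAddCommGroup H]
    [InnerProductSpace ℂ H] {m : Fin n → H} (hm : Orthonormal ℂ m) :
    CompleteOrthogonalIdempotents (basisProjection m) := by
  have h : OrthogonalIdempotents fun l => InnerProductSpace.rankOne ℂ (m l) (m l) :=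
    ⟨fun l => InnerProductSpace.isIdempotentElem_rankOne_self (hm.1 l), fun k l hkl => by
      dsimp only
      rw [ContinuousLinearMap.mul_def, InnerProductSpace.rankOne_comp_rankOne, hm.2 hkl,
        zero_smul]⟩
  exact (CompleteOrthogonalIdempotents.equiv (finSuccEquiv n)).2
    (CompleteOrthogonalIdempotents.option h)

theorem isSelfAdjoint_basisProjection {m : Fin n → H} (hm : Orthonormal ℂ m) (k : Fin (n + 1)) :
    IsSelfAdjoint (basisProjection m k) := by
  have h : ∀ l, IsSelfAdjoint (InnerProductSpace.rankOne ℂ (m l) (m l)) := fun l =>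
    (InnerProductSpace.isStarProjection_rankOne_self (hm.1 l)).isSelfAdjoint
  refine Fin.cases ?_ (fun l => ?_) k
  · rw [basisProjection, finSuccEquiv_zero]
    exact (IsSelfAdjoint.one _).sub (isSelfAdjoint_sum _ fun l _ => h l)
  · rw [basisProjection, finSuccEquiv_succ]
    exact h l

end FiniteMeasurement

namespace Biphoton

variable (B : Biphoton)

/-! ### An optimal finite measurement of the biphoton -/

/-- `√((1 + κ) / 2)`, the cosine of the angle by which the tangent frame is rotated into the optimal
frame. -/
noncomputable def cosAngle : ℝ := √((1 + B.κ) / 2)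

/-- `√((1 - κ) / 2)`, the sine of that angle. -/
noncomputable def sinAngle : ℝ := √((1 - B.κ) / 2)

theorem cosAngle_pos : 0 < B.cosAngle := Real.sqrt_pos.2 (by linarith [B.κ_nonneg])

theorem cosAngle_sq : B.cosAngle ^ 2 = (1 + B.κ) / 2 :=
  Real.sq_sqrt (by linarith [B.κ_nonneg])

theorem sinAngle_sq : B.sinAngle ^ 2 = (1 - B.κ) / 2 :=
  Real.sq_sqrt (by linarith [B.κ_lt_one])

theorem coκ_eq : B.coκ = 2 * B.cosAngle * B.sinAngle := by
  have h1 : 0 ≤ B.sinAngle := Real.sqrt_nonneg _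
  have h2 := B.cosAngle_pos
  refine (pow_left_inj₀ B.coκ_pos.le (by positivity) two_ne_zero).1 ?_
  rw [mul_pow, mul_pow, B.cosAngle_sq, B.sinAngle_sq, B.coκ_sq]
  ring

theorem coκ_mul_sinAngle_add : B.coκ * B.sinAngle + B.κ * B.cosAngle = B.cosAngle := by
  rw [B.coκ_eq]
  linear_combination (2 * B.cosAngle) * B.sinAngle_sq

theorem coκ_mul_cosAngle_sub : B.coκ * B.cosAngle - B.κ * B.sinAngle = B.sinAngle := by
  rw [B.coκ_eq]
  linear_combination (2 * B.sinAngle) * B.cosAngle_sq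

/-- The state and two unit vectors in the span of the tangent frame. The derivative in the central
time has a real component along the first of them and an imaginary one along the second; for the
derivative in the central frequency it is the other way round. In a basis with real components with
respect to this frame, where only the real parts matter, each vector thus responds to one
parameter. -/
noncomputable def optimalFrame (θ : Fin 2 → ℝ) : Fin 3 → BiphotonSpace :=
  ![B.state θ, (B.cosAngle : ℂ) • B.frame₀ θ - (B.sinAngle : ℂ) • B.frame₁ θ,
    (Complex.I * B.sinAngle) • B.frame₀ θ + (Complex.I * B.cosAngle) • B.frame₁ θ]

theorem orthonormal_optimalFrame (θ : Fin 2 → ℝ) : Orthonormal ℂ (B.optimalFrame θ) := by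
  have h : (B.cosAngle : ℂ) ^ 2 + (B.sinAngle : ℂ) ^ 2 = 1 := by
    norm_cast
    rw [B.cosAngle_sq, B.sinAngle_sq]
    ring
  have hI := Complex.I_sq
  rw [orthonormal_iff_ite]
  intro j k
  fin_cases j <;> fin_cases k <;>
  simp only [optimalFrame, Fin.zero_eta, Fin.mk_one, Fin.reduceFinMk, Matrix.cons_val,
      Matrix.cons_val_zero, Matrix.cons_val_one, inner_add_left, inner_add_right, inner_sub_left,
      inner_sub_right, inner_smul_left, inner_smul_right, map_mul, Complex.conj_I,
      Complex.conj_ofReal, B.inner_state_self, B.inner_state_frame₀, B.inner_state_frame₁,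
      B.inner_frame₀_state, B.inner_frame₁_state, B.inner_frame₀_self, B.inner_frame₁_self,
      B.inner_frame₀_frame₁, B.inner_frame₁_frame₀, Fin.isValue, reduceIte, Fin.reduceEq] <;>
  first
  | ring1
  | linear_combination h
  | linear_combination h - (B.cosAngle ^ 2 + B.sinAngle ^ 2 : ℂ) * hI

/-- A real orthogonal matrix whose first column has no zero. -/
noncomputable def mixing : Matrix (Fin 3) (Fin 3) ℝ :=
  !![1 / 3, 2 / 3, 2 / 3; 2 / 3, 1 / 3, -2 / 3; 2 / 3, -2 / 3, 1 / 3]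

/-- The measured basis: the optimal frame, rotated so that every outcome has a positive
probability. -/
noncomputable def optimalBasis (θ : Fin 2 → ℝ) (k : Fin 3) : BiphotonSpace :=
  ∑ j, (mixing k j : ℂ) • B.optimalFrame θ j

theorem orthonormal_optimalBasis (θ : Fin 2 → ℝ) : Orthonormal ℂ (B.optimalBasis θ) := by
  rw [orthonormal_iff_ite]
  intro k l
  rw [optimalBasis, optimalBasis, (B.orthonormal_optimalFrame θ).inner_sum]
  simp only [Complex.conj_ofReal, Fin.sum_univ_three]
  fin_cases k <;> fin_cases l <;> simp [mixing] <;> norm_num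

/-- The projective measurement in the measured basis; the first of the four outcomes stands for the
orthogonal complement, and has probability `0` in the given state. -/
noncomputable def optimalMeasurement (θ : Fin 2 → ℝ) : POVM (Fin 4) BiphotonSpace :=
  .ofProjections (basisProjection (B.optimalBasis θ))
    (completeOrthogonalIdempotents_basisProjection (B.orthonormal_optimalBasis θ))
    (isSelfAdjoint_basisProjection (B.orthonormal_optimalBasis θ))

theorem inner_optimalBasis (θ : Fin 2 → ℝ) (k : Fin 3) (φ : BiphotonSpace) :
    ⟪B.optimalBasis θ k, φ⟫_ℂ = ∑ j, (mixing k j : ℂ) * ⟪B.optimalFrame θ j, φ⟫_ℂ := by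
  rw [optimalBasis, sum_inner]
  simp only [inner_smul_left, Complex.conj_ofReal]

theorem inner_optimalBasis_state (θ : Fin 2 → ℝ) (k : Fin 3) :
    ⟪B.optimalBasis θ k, B.state θ⟫_ℂ = mixing k 0 := by
  rw [inner_optimalBasis]
  have h := orthonormal_iff_ite.1 (B.orthonormal_optimalFrame θ)
  have h0 : B.state θ = B.optimalFrame θ 0 := rfl
  simp [h0, h]

theorem effect_succ_state (θ : Fin 2 → ℝ) (k : Fin 3) :
    (B.optimalMeasurement θ).effect {k.succ} (B.state θ) =
      (mixing k 0 : ℂ) • B.optimalBasis θ k := by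
  rw [optimalMeasurement, POVM.ofProjections_singleton, basisProjection, finSuccEquiv_succ,
    Option.elim_some, InnerProductSpace.rankOne_apply, B.inner_optimalBasis_state]

theorem effect_zero_state (θ : Fin 2 → ℝ) :
    (B.optimalMeasurement θ).effect {0} (B.state θ) = 0 := by
  rw [optimalMeasurement, POVM.ofProjections_singleton, basisProjection, finSuccEquiv_zero,
    Option.elim_none]
  have h1 : ∀ l, InnerProductSpace.rankOne ℂ (B.optimalBasis θ l) (B.optimalBasis θ l)
      (B.state θ) = (mixing l 0 : ℂ) • B.optimalBasis θ l := fun l => by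
    rw [InnerProductSpace.rankOne_apply, B.inner_optimalBasis_state]
  have h0 : B.state θ = B.optimalFrame θ 0 := rfl
  rw [sub_apply, sum_apply, Finset.sum_congr rfl fun l _ => h1 l,
    show (1 : BiphotonSpace →L[ℂ] BiphotonSpace) (B.state θ) = B.state θ from rfl, h0]
  simp only [optimalBasis, Fin.sum_univ_three, mixing, Matrix.of_apply, Matrix.cons_val,
    Matrix.cons_val_zero, Matrix.cons_val_one, Fin.isValue]
  push_cast
  module

theorem prob_succ (θ : Fin 2 → ℝ) (k : Fin 3) :
    ((B.optimalMeasurement θ).prob (B.state θ)).real {k.succ} = mixing k 0 ^ 2 := by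
  rw [POVM.prob_real _ _ (measurableSet_singleton _), ← POVM.inner_effect _
    (measurableSet_singleton _), effect_succ_state, inner_smul_left, inner_optimalBasis_state,
    Complex.conj_ofReal, ← Complex.ofReal_mul, Complex.ofReal_re, sq]

theorem prob_zero (θ : Fin 2 → ℝ) :
    ((B.optimalMeasurement θ).prob (B.state θ)).real {0} = 0 := by
  rw [POVM.prob_real _ _ (measurableSet_singleton _), ← POVM.inner_effect _
    (measurableSet_singleton _), effect_zero_state, inner_zero_left, Complex.zero_re]

theorem inner_optimalFrame_tangent_zero (θ : Fin 2 → ℝ) (j : Fin 3) :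
    ⟪B.optimalFrame θ j, B.tangent θ 0⟫_ℂ =
      ![Complex.I * θ 1, B.σ * B.cosAngle, -Complex.I * B.σ * B.sinAngle] j := by
  fin_cases j <;>
  simp only [optimalFrame, tangent, Fin.zero_eta, Fin.mk_one, Fin.reduceFinMk, Matrix.cons_val,
      Matrix.cons_val_zero, Matrix.cons_val_one, inner_add_left, inner_add_right, inner_sub_left,
      inner_smul_left, inner_smul_right, map_mul, Complex.conj_I,
      Complex.conj_ofReal, B.inner_state_self, B.inner_state_frame₀, B.inner_frame₀_state,
      B.inner_frame₁_state, B.inner_frame₀_self, B.inner_frame₁_frame₀] <;>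
  ring

theorem inner_optimalFrame_tangent_one (θ : Fin 2 → ℝ) (j : Fin 3) :
    ⟪B.optimalFrame θ j, B.tangent θ 1⟫_ℂ = ![0,
      -Complex.I * B.sinAngle / (2 * B.σ * B.coκ), -B.cosAngle / (2 * B.σ * B.coκ)] j := by
  have h1 : (B.coκ : ℂ) * B.sinAngle + B.κ * B.cosAngle = B.cosAngle := by
    exact_mod_cast B.coκ_mul_sinAngle_add
  have h2 : (B.coκ : ℂ) * B.cosAngle - B.κ * B.sinAngle = B.sinAngle := by
    exact_mod_cast B.coκ_mul_cosAngle_sub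
  fin_cases j <;>
  simp only [optimalFrame, tangent, Fin.zero_eta, Fin.mk_one, Fin.reduceFinMk, Matrix.cons_val,
      Matrix.cons_val_zero, Matrix.cons_val_one, inner_add_left, inner_add_right, inner_sub_left,
      inner_smul_left, inner_smul_right, map_mul, Complex.conj_I,
      Complex.conj_ofReal, B.inner_state_frame₀, B.inner_state_frame₁, B.inner_frame₀_self,
      B.inner_frame₁_self, B.inner_frame₀_frame₁, B.inner_frame₁_frame₀]
  · ring
  · linear_combination (-Complex.I / (2 * B.σ * B.coκ)) * h2
  · linear_combination (Complex.I ^ 2 / (2 * B.σ * B.coκ)) * h1 +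
      (B.cosAngle / (2 * B.σ * B.coκ)) * Complex.I_sq

/-- The derivatives of the outcome probabilities. -/
noncomputable def optimalSlope (j : Fin 2) (k : Fin 3) : ℝ :=
  ![2 * B.σ * B.cosAngle * (mixing k 0 * mixing k 1),
    -(B.cosAngle / (B.σ * B.coκ)) * (mixing k 0 * mixing k 2)] j

theorem hasDerivAt_prob_succ (θ : Fin 2 → ℝ) (j : Fin 2) (k : Fin 3) :
    HasDerivAt (fun u => ((B.optimalMeasurement θ).prob
      (B.state (Function.update θ j u))).real {k.succ}) (B.optimalSlope j k) (θ j) := by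
  have h := (B.optimalMeasurement θ).hasDerivAt_prob_real (B.hasDerivAt_state θ j)
    (measurableSet_singleton k.succ)
  rw [effect_succ_state, inner_smul_left, Complex.conj_ofReal, inner_optimalBasis] at h
  convert h using 1
  fin_cases j
  · simp only [Fin.zero_eta, inner_optimalFrame_tangent_zero, Fin.sum_univ_three]
    simp [optimalSlope]
    ring
  · simp only [Fin.mk_one, inner_optimalFrame_tangent_one, Fin.sum_univ_three]
    have : (-(B.cosAngle : ℂ) / (2 * B.σ * B.coκ)) =
      ((-B.cosAngle / (2 * B.σ * B.coκ) : ℝ) : ℂ) := by push_cast; ring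
    have h3 : (-Complex.I * B.sinAngle / (2 * B.σ * B.coκ)) =
      ((-B.sinAngle / (2 * B.σ * B.coκ) : ℝ) : ℂ) * Complex.I := by push_cast; ring
    simp only [Matrix.cons_val, Matrix.cons_val_zero, Matrix.cons_val_one, this, h3, ← mul_assoc,
      ← Complex.ofReal_mul, mul_zero, zero_add, mul_add]
    simp only [Complex.add_re, Complex.ofReal_re, Complex.re_ofReal_mul, Complex.I_re, optimalSlope,
      Matrix.cons_val_zero, Matrix.cons_val_one]
    ring

theorem hasDerivAt_prob_zero (θ : Fin 2 → ℝ) (j : Fin 2) :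
    HasDerivAt (fun u => ((B.optimalMeasurement θ).prob
      (B.state (Function.update θ j u))).real {0}) 0 (θ j) := by
  have h := (B.optimalMeasurement θ).hasDerivAt_prob_real (B.hasDerivAt_state θ j)
    (measurableSet_singleton 0)
  rwa [effect_zero_state, inner_zero_left, Complex.zero_re, mul_zero] at h

/-- The locally optimal estimator: the deviation from `θ` is proportional to the score. -/
noncomputable def optimalEstimator (θ : Fin 2 → ℝ) (j : Fin 2) : Fin 4 → ℝ :=
  Fin.cons (θ j) fun k => θ j + ![1 / (2 * B.σ * B.cosAngle) * (mixing k 1 / mixing k 0),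
    -(B.σ * B.coκ / B.cosAngle) * (mixing k 2 / mixing k 0)] j

theorem optimalEstimator_succ (θ : Fin 2 → ℝ) (j : Fin 2) (k : Fin 3) :
    B.optimalEstimator θ j k.succ =
      θ j + ![1 / (2 * B.σ * B.cosAngle) * (mixing k 1 / mixing k 0),
        -(B.σ * B.coκ / B.cosAngle) * (mixing k 2 / mixing k 0)] j := rfl

instance {X : Type*} [MeasurableSpace X] (M : POVM X BiphotonSpace) (θ : Fin 2 → ℝ) :
    IsFiniteMeasure (B.model M θ) := M.isFiniteMeasure_prob _

theorem isLocallyUnbiased_optimalEstimator (θ : Fin 2 → ℝ) :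
    IsLocallyUnbiased (B.model (B.optimalMeasurement θ)) θ (B.optimalEstimator θ) where
  measurable _ := measurable_of_finite _
  secondMoment := by
    refine ⟨∑ j, ∑ k, B.optimalEstimator θ j k ^ 2, Eventually.of_forall fun η j =>
      ⟨?_, ?_⟩⟩
    · have hb : ∀ x, ‖B.optimalEstimator θ j x‖ ≤ ∑ x, ‖B.optimalEstimator θ j x‖ := fun x =>
        Finset.single_le_sum (f := fun x => ‖B.optimalEstimator θ j x‖)
          (fun _ _ => norm_nonneg _) (Finset.mem_univ x)
      exact MemLp.of_bound (measurable_of_finite _).aestronglyMeasurable _ (ae_of_all _ hb)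
    · have h1 : ∀ x, B.optimalEstimator θ j x ^ 2 ≤
          ∑ j, ∑ k, B.optimalEstimator θ j k ^ 2 := fun x =>
        (Finset.single_le_sum (f := fun x => B.optimalEstimator θ j x ^ 2)
          (fun _ _ => sq_nonneg _) (Finset.mem_univ x)).trans
          (Finset.single_le_sum (f := fun j => ∑ k, B.optimalEstimator θ j k ^ 2)
            (fun _ _ => Finset.sum_nonneg fun _ _ => sq_nonneg _) (Finset.mem_univ j))
      refine (integral_mono .of_finite (integrable_const _) h1).trans_eq ?_
      rw [integral_const, model, POVM.prob_real_univ, B.norm_state, one_pow, one_smul]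
  mean j := by
    rw [model, integral_fintype .of_finite, Fin.sum_univ_succ, Fin.sum_univ_three]
    simp only [prob_succ, prob_zero, optimalEstimator_succ]
    fin_cases j <;> simp [mixing] <;> ring
  hasDerivAt_mean j k := by
    have h : ∀ η, ∫ x, B.optimalEstimator θ j x ∂(B.model (B.optimalMeasurement θ) η) =
      ((B.optimalMeasurement θ).prob (B.state η)).real {0} * B.optimalEstimator θ j 0 +
        ∑ l : Fin 3, ((B.optimalMeasurement θ).prob (B.state η)).real {l.succ} *
          B.optimalEstimator θ j l.succ := fun η => by
        rw [model, integral_fintype .of_finite, Fin.sum_univ_succ]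
        simp only [smul_eq_mul]
    simp only [h]
    have h1 := ((B.hasDerivAt_prob_zero θ k).mul_const (B.optimalEstimator θ j 0)).add
      (HasDerivAt.fun_sum (u := Finset.univ) fun (l : Fin 3) _ =>
        (B.hasDerivAt_prob_succ θ k l).mul_const (B.optimalEstimator θ j l.succ))
    refine h1.congr_deriv ?_
    have hσ := B.σ_pos.ne'
    have hc := B.coκ_pos.ne'
    have hp := B.cosAngle_pos.ne'
    rw [Fin.sum_univ_three]
    simp only [optimalEstimator_succ]
    clear h h1
    fin_cases j <;> fin_cases k <;> simp [optimalSlope, mixing] <;> field_simp <;> ring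

theorem stdDev_optimalEstimator (θ : Fin 2 → ℝ) :
    stdDev (B.model (B.optimalMeasurement θ) θ) (B.optimalEstimator θ 0) *
      stdDev (B.model (B.optimalMeasurement θ) θ) (B.optimalEstimator θ 1) =
        refinedBound B.κ := by
  have hlu := B.isLocallyUnbiased_optimalEstimator θ
  rw [stdDev, stdDev, variance_eq_of_isLocallyUnbiased hlu, variance_eq_of_isLocallyUnbiased hlu,
    ← Real.sqrt_mul (integral_nonneg fun _ => sq_nonneg _), refinedBound]
  congr 1
  have hκ := B.κ_nonneg
  have hσ := B.σ_pos.ne'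
  have hp := B.cosAngle_pos.ne'
  rw [model, integral_fintype .of_finite, integral_fintype .of_finite,
    Fin.sum_univ_succ, Fin.sum_univ_three, Fin.sum_univ_succ, Fin.sum_univ_three]
  simp only [prob_succ, prob_zero, optimalEstimator_succ]
  have h4 : B.cosAngle ^ 4 = ((1 + B.κ) / 2) ^ 2 := by rw [← B.cosAngle_sq]; ring
  simp [mixing]
  field_simp
  rw [h4, B.coκ_sq]
  ring

end Biphoton

/-! ### The Fourier transform on `L¹ ∩ L²` -/

section FourierTransform

open scoped FourierTransform SchwartzMap ContDiff

/-- On `L¹ ∩ L²` the Fourier transform of `L²` is given by the Fourier integral: both have the same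
pairings with test functions. -/
theorem fourier_toLp_ae_eq {f : ℝ → ℂ} (h1 : Integrable f) (h2 : MemLp f 2) :
    (𝓕 (h2.toLp f) : Lp ℂ 2 (volume : Measure ℝ)) =ᵐ[volume] 𝓕 f := by
  have hcont : Continuous (𝓕 f) :=
    VectorFourier.fourierIntegral_continuous Real.continuous_fourierChar
      (by exact continuous_inner) h1
  refine ae_eq_of_integral_contDiff_smul_eq ((Lp.memLp _).locallyIntegrable one_le_two)
    hcont.locallyIntegrable fun g hg hgc => ?_
  have hg₁ : HasCompactSupport (Complex.ofRealCLM ∘ g) := hgc.comp_left rfl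
  have hg₂ : ContDiff ℝ ∞ (Complex.ofRealCLM ∘ g) := by fun_prop
  set G : 𝓢(ℝ, ℂ) := hg₁.toSchwartzMap hg₂ with hG
  have hGx : ∀ x, G x = (g x : ℂ) := fun x => rfl
  have e1 : ∫ x, g x • (𝓕 (h2.toLp f) : Lp ℂ 2 (volume : Measure ℝ)) x =
      Lp.toTemperedDistribution (𝓕 (h2.toLp f)) G := by
    rw [Lp.toTemperedDistribution_apply]
    simp only [hGx, Complex.coe_smul]
  have e2 : ∫ x, (𝓕 G) x • h2.toLp f x = ∫ x, (𝓕 G) x • f x := by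
    refine integral_congr_ae ?_
    filter_upwards [h2.coeFn_toLp] with x hx
    rw [hx]
  have e3 := VectorFourier.integral_fourierIntegral_smul_eq_flip (μ := volume) (ν := volume)
    (L := innerₗ ℝ) (f := G) (g := f) Real.continuous_fourierChar (by exact continuous_inner)
    G.integrable h1
  rw [e1, ← Lp.fourier_toTemperedDistribution_eq, TemperedDistribution.fourier_apply,
    Lp.toTemperedDistribution_apply, e2, SchwartzMap.fourier_coe]
  refine e3.trans (integral_congr_ae (ae_of_all _ fun x => ?_))
  simp only [flip_innerₗ, hGx, Complex.coe_smul]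
  rfl

theorem lintegral_enorm_fourier_sq {f : ℝ → ℂ} (h1 : Integrable f) (h2 : MemLp f 2) :
    ∫⁻ w, ‖𝓕 f w‖ₑ ^ 2 = ∫⁻ y, ‖f y‖ₑ ^ 2 := by
  have h := Lp.norm_fourier_eq (h2.toLp f)
  have key : ∀ g : ℝ → ℂ, ∫⁻ y, ‖g y‖ₑ ^ 2 = eLpNorm g 2 volume ^ 2 := fun g => by
    rw [eLpNorm_eq_lintegral_rpow_enorm_toReal two_ne_zero ENNReal.ofNat_ne_top,
      ← ENNReal.rpow_natCast, ← ENNReal.rpow_mul]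
    simp
  rw [key, key, ← eLpNorm_congr_ae (fourier_toLp_ae_eq h1 h2), ← Lp.enorm_def,
    ← eLpNorm_congr_ae h2.coeFn_toLp, ← Lp.enorm_def, enorm_eq_iff_norm_eq.2 h]

/-- The inverse Fourier transform in the angular frequency `ν`, not normalised. -/
noncomputable def angularTransform (f : ℝ → ℂ) (ν : ℝ) : ℂ :=
  ∫ y : ℝ, Complex.exp (Complex.I * (ν : ℂ) * (y : ℂ)) * f y

theorem angularTransform_eq_fourier (f : ℝ → ℂ) (ν : ℝ) :
    angularTransform f ν = 𝓕 f (-(2 * Real.pi)⁻¹ * ν + 0) := by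
  rw [Real.fourier_real_eq_integral_exp_smul, angularTransform]
  refine integral_congr_ae (ae_of_all _ fun y => ?_)
  simp only [smul_eq_mul]
  congr 2
  have := Real.pi_pos.ne'
  have h2 : -2 * Real.pi * y * (-(2 * Real.pi)⁻¹ * ν + 0) = ν * y := by field_simp; ring
  rw [h2]
  push_cast
  ring

theorem continuous_angularTransform {f : ℝ → ℂ} (h1 : Integrable f) :
    Continuous (angularTransform f) := by
  have hcont : Continuous (𝓕 f) :=
    VectorFourier.fourierIntegral_continuous Real.continuous_fourierChar
      (by exact continuous_inner) h1
  rw [funext (angularTransform_eq_fourier f)]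
  fun_prop

/-- Plancherel's theorem on `L¹ ∩ L²`, in the angular frequency. -/
theorem lintegral_enorm_angularTransform_sq {f : ℝ → ℂ} (h1 : Integrable f) (h2 : MemLp f 2) :
    ∫⁻ ν, ‖angularTransform f ν‖ₑ ^ 2 = ENNReal.ofReal (2 * Real.pi) * ∫⁻ y, ‖f y‖ₑ ^ 2 := by
  have hpi := Real.pi_pos
  have hcont : Continuous (𝓕 f) :=
    VectorFourier.fourierIntegral_continuous Real.continuous_fourierChar
      (by exact continuous_inner) h1
  simp only [angularTransform_eq_fourier]
  rw [lintegral_comp_affine (G := fun w => ‖𝓕 f w‖ₑ ^ 2) (by fun_prop)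
    (by simp [hpi.ne']) 0, lintegral_enorm_fourier_sq h1 h2]
  congr 2
  rw [inv_neg, inv_inv, abs_neg, abs_of_pos (by positivity)]

end FourierTransform

/-! ### Measurements given by a wave function of the outcome -/

section OfIsometry

variable {X : Type*} [MeasurableSpace X] {H : Type*} [NormedAddCommGroup H]
  [InnerProductSpace ℂ H] [CompleteSpace H] {μ : Measure X}

/-- The wave function of the outcome, restricted to the event `E`. -/
noncomputable def restrictedWave (U : H →ₗᵢ[ℂ] Lp ℂ 2 μ) (E : Set X) :
    H →L[ℂ] Lp ℂ 2 (μ.restrict E) :=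
  LpToLpRestrictCLM X ℂ ℂ μ 2 E ∘L U.toContinuousLinearMap

theorem integrable_norm_sq (f : Lp ℂ 2 μ) : Integrable (fun x => ‖f x‖ ^ 2) μ :=
  (memLp_two_iff_integrable_sq_norm (Lp.memLp f).1).1 (Lp.memLp f)

theorem norm_sq_eq_integral (f : Lp ℂ 2 μ) : ‖f‖ ^ 2 = ∫ x, ‖f x‖ ^ 2 ∂μ := by
  rw [← norm_toLp_sq (Lp.memLp f), Lp.toLp_coeFn]

theorem norm_restrictedWave_sq {H : Type*} [NormedAddCommGroup H] [InnerProductSpace ℂ H]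
    (U : H →ₗᵢ[ℂ] Lp ℂ 2 μ) (E : Set X) (φ : H) :
    ‖restrictedWave U E φ‖ ^ 2 = ∫ x in E, ‖U φ x‖ ^ 2 ∂μ := by
  rw [norm_sq_eq_integral]
  refine integral_congr_ae ?_
  filter_upwards [LpToLpRestrictCLM_coeFn ℂ E (U φ)] with x hx
  rw [← hx]
  rfl

theorem inner_adjoint_restrictedWave (U : H →ₗᵢ[ℂ] Lp ℂ 2 μ) (E : Set X) (φ : H) :
    ⟪φ, ((restrictedWave U E).adjoint ∘L restrictedWave U E) φ⟫_ℂ =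
      ((∫ x in E, ‖U φ x‖ ^ 2 ∂μ : ℝ) : ℂ) := by
  rw [ContinuousLinearMap.comp_apply, ContinuousLinearMap.adjoint_inner_right,
    inner_self_eq_norm_sq_to_K, ← norm_restrictedWave_sq]
  push_cast
  rfl

theorem ext_of_inner_eq {H : Type*} [NormedAddCommGroup H] [InnerProductSpace ℂ H]
    {S T : H →L[ℂ] H} (h : ∀ φ, ⟪φ, S φ⟫_ℂ = ⟪φ, T φ⟫_ℂ) : S = T := by
  refine ContinuousLinearMap.coe_injective ((ext_inner_map _ _).1 fun φ => ?_)
  rw [← inner_conj_symm, ← inner_conj_symm (T.toLinearMap φ)]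
  exact congrArg _ (h φ)

/-- The measurement in which the outcome of the state `φ` has the wave function `U φ`: the pull-back
along `U` of the spectral measure of multiplication by the outcome. -/
noncomputable def POVM.ofIsometry (U : H →ₗᵢ[ℂ] Lp ℂ 2 μ) : POVM X H where
  effect E := (restrictedWave U E).adjoint ∘L restrictedWave U E
  isPositive E _ := ContinuousLinearMap.isPositive_adjoint_comp_self _
  univ := by
    refine ext_of_inner_eq fun φ => ?_
    rw [inner_adjoint_restrictedWave, Measure.restrict_univ, ← norm_sq_eq_integral, U.norm_map]
    change _ = ⟪φ, φ⟫_ℂ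
    rw [inner_self_eq_norm_sq_to_K]
    push_cast
    rfl
  hasSum E hE hd φ := by
    simp only [inner_adjoint_restrictedWave]
    exact Complex.hasSum_ofReal.2
      (hasSum_integral_iUnion hE hd (integrable_norm_sq (U φ)).integrableOn)

theorem POVM.prob_ofIsometry (U : H →ₗᵢ[ℂ] Lp ℂ 2 μ) (φ : H) :
    (POVM.ofIsometry U).prob φ = μ.withDensity fun x => ENNReal.ofReal (‖U φ x‖ ^ 2) := by
  refine Measure.ext fun E hE => ?_
  rw [POVM.prob_apply _ _ hE, withDensity_apply _ hE, ← ofReal_integral_eq_lintegral_ofReal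
    (integrable_norm_sq (U φ)).integrableOn (ae_of_all _ fun _ => sq_nonneg _)]
  congr 1
  change (⟪φ, ((restrictedWave U E).adjoint ∘L restrictedWave U E) φ⟫_ℂ).re = _
  rw [inner_adjoint_restrictedWave, Complex.ofReal_re]

theorem POVM.inner_effect_self_eq (M : POVM X H) (φ : H) {E : Set X} (hE : MeasurableSet E) :
    ⟪φ, M.effect E φ⟫_ℂ = (((M.prob φ).real E : ℝ) : ℂ) := by
  rw [M.prob_real φ hE]
  refine (Complex.conj_eq_iff_re.1 ?_).symm
  rw [inner_conj_symm, M.inner_effect hE]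

/-- A measurement is determined by the outcome laws of a dense set of states. -/
theorem POVM.effect_eq_of_dense {M M' : POVM X H} {s : Set H} (hs : Dense s)
    (h : ∀ φ ∈ s, M.prob φ = M'.prob φ) {E : Set X} (hE : MeasurableSet E) :
    M.effect E = M'.effect E := by
  refine ext_of_inner_eq fun φ => ?_
  refine congrFun (Continuous.ext_on hs (f := fun φ => ⟪φ, M.effect E φ⟫_ℂ)
    (g := fun φ => ⟪φ, M'.effect E φ⟫_ℂ) (by fun_prop) (by fun_prop) fun φ hφ => ?_) φ
  simp only
  rw [M.inner_effect_self_eq φ hE, M'.inner_effect_self_eq φ hE, h φ hφ]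

end OfIsometry

/-! ### The joint wave function of time difference and frequency sum -/

section TimeFrequency

variable {r : ℝ}

/-- The point with signal time `y` on the line of time difference `x`. -/
noncomputable def linePoint (r x y : ℝ) : ℝ × ℝ := (y, (y - x) / r)

theorem lintegral_linePoint (hr : 0 < r) {G : ℝ × ℝ → ℝ≥0∞} (hG : Measurable G) :
    ∫⁻ x, ∫⁻ y, G (linePoint r x y) = ENNReal.ofReal r * ∫⁻ z, G z := by
  have h1 := lintegral_comp_shear (hG.comp measurable_swap) (a := -r⁻¹) (a' := 1)
    (b := fun y => r⁻¹ * y) (by simp [hr.ne']) one_ne_zero (by fun_prop) 0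
  have h2 : ∀ z : ℝ × ℝ, (G ∘ Prod.swap) (-r⁻¹ * z.1 + r⁻¹ * z.2, 1 * z.2 + 0) =
      G (linePoint r z.1 z.2) := fun z => by
    simp only [Function.comp_apply, Prod.swap_prod_mk, linePoint]
    congr 2 <;> ring
  have hm : Measurable fun z : ℝ × ℝ => G (linePoint r z.1 z.2) := by
    unfold linePoint
    fun_prop
  simp only [h2] at h1
  rw [inv_neg, inv_inv, abs_neg, abs_of_pos hr, inv_one, abs_one, ENNReal.ofReal_one, one_mul,
    Measure.volume_eq_prod, lintegral_prod _ hm.aemeasurable] at h1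
  rw [h1]
  congr 1
  rw [← Measure.volume_eq_prod]
  exact (Measure.measurePreserving_swap (μ := (volume : Measure ℝ))
    (ν := (volume : Measure ℝ))).lintegral_comp hG

theorem ae_ae_linePoint (hr : 0 < r) {p : ℝ × ℝ → Prop} (hp : ∀ᵐ z, p z) :
    ∀ᵐ x, ∀ᵐ y, p (linePoint r x y) := by
  obtain ⟨N, hpN, hN, hN0⟩ := exists_measurable_superset_of_null (ae_iff.1 hp)
  have h := lintegral_linePoint hr (measurable_one.indicator hN : Measurable (N.indicator 1))
  rw [lintegral_indicator_one hN, hN0, mul_zero] at h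
  have hm : Measurable fun z : ℝ × ℝ => N.indicator (1 : ℝ × ℝ → ℝ≥0∞) (linePoint r z.1 z.2) := by
    refine (measurable_one.indicator hN).comp ?_
    unfold linePoint
    fun_prop
  rw [lintegral_eq_zero_iff hm.lintegral_prod_right'] at h
  filter_upwards [h] with x hx
  have hmx : Measurable fun y => N.indicator (1 : ℝ × ℝ → ℝ≥0∞) (linePoint r x y) :=
    hm.comp measurable_prodMk_left
  rw [Pi.zero_apply, lintegral_eq_zero_iff hmx] at hx
  filter_upwards [hx] with y hy
  by_contra hc
  have : N.indicator (1 : ℝ × ℝ → ℝ≥0∞) (linePoint r x y) = 1 := Set.indicator_of_mem (hpN hc) _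
  simp [this] at hy

variable {φ ψ : ℝ × ℝ → ℂ}

theorem stronglyMeasurable_line (hφ : StronglyMeasurable φ) (x : ℝ) :
    StronglyMeasurable fun y => φ (linePoint r x y) :=
  hφ.comp_measurable (by unfold linePoint; fun_prop)

theorem ae_integrable_line (hr : 0 < r) (hφ : StronglyMeasurable φ) (h1 : Integrable φ) :
    ∀ᵐ x, Integrable fun y => φ (linePoint r x y) := by
  have hm : Measurable fun z : ℝ × ℝ => ‖φ (linePoint r z.1 z.2)‖ₑ :=
    hφ.measurable.enorm.comp (by unfold linePoint; fun_prop)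
  have h := lintegral_linePoint hr hφ.measurable.enorm
  have hfin : ∫⁻ x, ∫⁻ y, ‖φ (linePoint r x y)‖ₑ ≠ ∞ := by
    rw [h]
    exact ENNReal.mul_ne_top ENNReal.ofReal_ne_top h1.2.ne
  filter_upwards [ae_lt_top hm.lintegral_prod_right' hfin] with x hx
  exact ⟨(stronglyMeasurable_line hφ x).aestronglyMeasurable, hx⟩

theorem ae_memLp_line (hr : 0 < r) (hφ : StronglyMeasurable φ) (h2 : MemLp φ 2) :
    ∀ᵐ x, MemLp (fun y => φ (linePoint r x y)) 2 := by
  have h3 := (memLp_two_iff_integrable_sq_norm h2.1).1 h2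
  have hs : StronglyMeasurable fun z => ‖φ z‖ ^ 2 := hφ.norm.pow 2
  have hm : Measurable fun z : ℝ × ℝ => ‖‖φ (linePoint r z.1 z.2)‖ ^ 2‖ₑ :=
    hs.measurable.enorm.comp (by unfold linePoint; fun_prop)
  have h := lintegral_linePoint hr hs.measurable.enorm
  have hfin : ∫⁻ x, ∫⁻ y, ‖‖φ (linePoint r x y)‖ ^ 2‖ₑ ≠ ∞ := by
    rw [h]
    exact ENNReal.mul_ne_top ENNReal.ofReal_ne_top h3.2.ne
  filter_upwards [ae_lt_top hm.lintegral_prod_right' hfin] with x hx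
  have hx1 := stronglyMeasurable_line (r := r) hφ x
  rw [memLp_two_iff_integrable_sq_norm hx1.aestronglyMeasurable]
  exact ⟨(hx1.norm.pow 2).aestronglyMeasurable, hx⟩

/-- The amplitude `⟨x, ν | φ⟩` of the time difference `x` and the frequency sum `ν`. -/
noncomputable def amplitude (r : ℝ) (φ : ℝ × ℝ → ℂ) (z : ℝ × ℝ) : ℂ :=
  ((√(2 * Real.pi * r))⁻¹ : ℝ) * angularTransform (fun y => φ (linePoint r z.1 y)) z.2

theorem norm_amplitude_sq (hr : 0 < r) (φ : ℝ × ℝ → ℂ) (z : ℝ × ℝ) :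
    ‖amplitude r φ z‖ ^ 2 = (2 * Real.pi * r)⁻¹ *
      ‖angularTransform (fun y => φ (linePoint r z.1 y)) z.2‖ ^ 2 := by
  have := Real.pi_pos
  rw [amplitude, norm_mul, Complex.norm_real, mul_pow, Real.norm_eq_abs, sq_abs, inv_pow,
    Real.sq_sqrt (by positivity)]

theorem stronglyMeasurable_amplitude (hφ : StronglyMeasurable φ) :
    StronglyMeasurable (amplitude r φ) := by
  refine StronglyMeasurable.const_mul (StronglyMeasurable.integral_prod_right'
    (f := fun p : (ℝ × ℝ) × ℝ => Complex.exp (Complex.I * (p.1.2 : ℂ) * (p.2 : ℂ)) *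
      φ (linePoint r p.1.1 p.2)) ?_) _
  exact (by fun_prop : Continuous fun p : (ℝ × ℝ) × ℝ =>
    Complex.exp (Complex.I * (p.1.2 : ℂ) * (p.2 : ℂ))).stronglyMeasurable.mul
      (hφ.comp_measurable (by unfold linePoint; fun_prop))

/-- The amplitude preserves the norm, by Plancherel's theorem on each line of constant time
difference. -/
theorem lintegral_enorm_amplitude_sq (hr : 0 < r) (hφ : StronglyMeasurable φ) (h1 : Integrable φ)
    (h2 : MemLp φ 2) : ∫⁻ z, ‖amplitude r φ z‖ₑ ^ 2 = ∫⁻ z, ‖φ z‖ₑ ^ 2 := by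
  have hpi := Real.pi_pos
  have hm : Measurable fun z => ‖amplitude r φ z‖ₑ ^ 2 :=
    (stronglyMeasurable_amplitude hφ).measurable.enorm.pow_const 2
  have hc : ‖(((√(2 * Real.pi * r))⁻¹ : ℝ) : ℂ)‖ₑ ^ 2 = ENNReal.ofReal (2 * Real.pi * r)⁻¹ := by
    rw [← ofReal_norm, ← ENNReal.ofReal_pow (norm_nonneg _), Complex.norm_real,
      Real.norm_eq_abs, sq_abs, inv_pow, Real.sq_sqrt (by positivity)]
  rw [Measure.volume_eq_prod, lintegral_prod _ hm.aemeasurable, ← Measure.volume_eq_prod]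
  have h3 : ∀ᵐ x : ℝ, ∫⁻ ν, ‖amplitude r φ (x, ν)‖ₑ ^ 2 =
      ENNReal.ofReal r⁻¹ * ∫⁻ y, ‖φ (linePoint r x y)‖ₑ ^ 2 := by
    filter_upwards [ae_integrable_line hr hφ h1, ae_memLp_line hr hφ h2] with x hx1 hx2
    simp only [amplitude, enorm_mul, mul_pow, hc]
    rw [lintegral_const_mul _ ((continuous_angularTransform hx1).measurable.enorm.pow_const 2),
      lintegral_enorm_angularTransform_sq hx1 hx2, ← mul_assoc,
      ← ENNReal.ofReal_mul (by positivity)]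
    congr 2
    field_simp
  have hm2 : Measurable fun z => ‖φ z‖ₑ ^ 2 := hφ.measurable.enorm.pow_const 2
  have hm3 : Measurable fun z : ℝ × ℝ => ‖φ (linePoint r z.1 z.2)‖ₑ ^ 2 :=
    hm2.comp (by unfold linePoint; fun_prop)
  rw [lintegral_congr_ae h3, lintegral_const_mul _ hm3.lintegral_prod_right',
    lintegral_linePoint hr hm2, ← mul_assoc, ← ENNReal.ofReal_mul (by positivity),
    inv_mul_cancel₀ hr.ne', ENNReal.ofReal_one, one_mul]

theorem memLp_amplitude (hr : 0 < r) (hφ : StronglyMeasurable φ) (h1 : Integrable φ)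
    (h2 : MemLp φ 2) : MemLp (amplitude r φ) 2 := by
  rw [memLp_two_iff_integrable_sq_norm (stronglyMeasurable_amplitude hφ).aestronglyMeasurable]
  refine ⟨((stronglyMeasurable_amplitude hφ).norm.pow 2).aestronglyMeasurable, ?_⟩
  have h3 := (memLp_two_iff_integrable_sq_norm h2.1).1 h2
  have h4 := h3.2
  simp only [HasFiniteIntegral, enorm_pow, enorm_norm] at h4 ⊢
  rwa [lintegral_enorm_amplitude_sq hr hφ h1 h2]

theorem amplitude_ae_congr (hr : 0 < r) (h : φ =ᵐ[volume] ψ) :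
    ∀ᵐ x, ∀ ν, amplitude r φ (x, ν) = amplitude r ψ (x, ν) := by
  filter_upwards [ae_ae_linePoint hr h] with x hx ν
  simp only [amplitude, angularTransform]
  congr 1
  refine integral_congr_ae ?_
  filter_upwards [hx] with y hy
  rw [hy]

theorem ae_prod_of_ae_forall {p : ℝ × ℝ → Prop} (h : ∀ᵐ x, ∀ ν, p (x, ν)) : ∀ᵐ z, p z := by
  filter_upwards [Measure.quasiMeasurePreserving_fst (μ := (volume : Measure ℝ))
    (ν := (volume : Measure ℝ)) |>.ae h] with z hz
  exact hz z.2

theorem integrable_angular {f : ℝ → ℂ} (hf : Integrable f) (ν : ℝ) :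
    Integrable fun y : ℝ => Complex.exp (Complex.I * (ν : ℂ) * (y : ℂ)) * f y := by
  refine (hf.norm.mono' ((by fun_prop : Continuous fun y : ℝ =>
    Complex.exp (Complex.I * (ν : ℂ) * (y : ℂ))).aestronglyMeasurable.mul hf.1)
    (ae_of_all _ fun y => ?_))
  rw [norm_mul, show Complex.I * (ν : ℂ) * (y : ℂ) = ((ν * y : ℝ) : ℂ) * Complex.I by
    push_cast; ring, Complex.norm_exp_ofReal_mul_I, one_mul]

theorem amplitude_add (hr : 0 < r) (hφ : StronglyMeasurable φ) (hφ1 : Integrable φ)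
    (hψ : StronglyMeasurable ψ) (hψ1 : Integrable ψ) :
    ∀ᵐ x, ∀ ν, amplitude r (φ + ψ) (x, ν) = amplitude r φ (x, ν) + amplitude r ψ (x, ν) := by
  filter_upwards [ae_integrable_line hr hφ hφ1, ae_integrable_line hr hψ hψ1] with x hx1 hx2 ν
  simp only [amplitude, angularTransform, Pi.add_apply, mul_add]
  rw [← mul_add]
  congr 1
  exact integral_add (integrable_angular hx1 ν) (integrable_angular hx2 ν)

theorem amplitude_smul (c : ℂ) (z : ℝ × ℝ) : amplitude r (c • φ) z = c * amplitude r φ z := by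
  have h : ∀ f : ℝ → ℂ, angularTransform (fun y => c * f y) z.2 = c * angularTransform f z.2 := by
    intro f
    rw [angularTransform, angularTransform, ← integral_const_mul]
    refine integral_congr_ae (ae_of_all _ fun y => ?_)
    ring
  simp only [amplitude, Pi.smul_apply, smul_eq_mul, h]
  ring

/-- The states whose wave function is integrable. -/
def integrableStates : Submodule ℂ BiphotonSpace where
  carrier := {φ | Integrable (φ : ℝ × ℝ → ℂ) volume}
  zero_mem' := (integrable_zero _ _ _).congr (Lp.coeFn_zero _ _ _).symm
  add_mem' hφ hψ := (Integrable.add hφ hψ).congr (Lp.coeFn_add _ _).symm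
  smul_mem' c φ hφ := (Integrable.smul c hφ).congr (Lp.coeFn_smul c φ).symm

theorem dense_integrableStates : Dense (integrableStates : Set BiphotonSpace) := by
  refine Dense.mono ?_ (SchwartzMap.denseRange_toLpCLM (E := ℝ × ℝ) (F := ℂ) (p := 2)
    (μ := volume) ENNReal.ofNat_ne_top)
  rintro _ ⟨f, rfl⟩
  exact f.integrable.congr (f.coeFn_toLp 2 volume).symm

theorem memLp_amplitude_coe (hr : 0 < r) (φ : integrableStates) :
    MemLp (amplitude r (φ : BiphotonSpace)) 2 :=
  memLp_amplitude hr (Lp.stronglyMeasurable _) φ.2 (Lp.memLp _)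

/-- The amplitude as a linear map on integrable states. -/
noncomputable def amplitudeMap (hr : 0 < r) : integrableStates →ₗ[ℂ] BiphotonSpace where
  toFun φ := (memLp_amplitude_coe hr φ).toLp _
  map_add' φ ψ := by
    rw [← MemLp.toLp_add]
    refine MemLp.toLp_congr _ _ ?_
    have h1 := amplitude_ae_congr hr (Lp.coeFn_add (φ : BiphotonSpace) (ψ : BiphotonSpace))
    have h2 := amplitude_add hr (Lp.stronglyMeasurable (φ : BiphotonSpace))
      φ.2 (Lp.stronglyMeasurable (ψ : BiphotonSpace)) ψ.2
    refine ae_prod_of_ae_forall ?_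
    filter_upwards [h1, h2] with x hx1 hx2 ν
    exact (hx1 ν).trans (hx2 ν)
  map_smul' c φ := by
    rw [RingHom.id_apply, ← MemLp.toLp_const_smul]
    refine MemLp.toLp_congr _ _ ?_
    refine ae_prod_of_ae_forall ?_
    filter_upwards [amplitude_ae_congr hr (Lp.coeFn_smul c (φ : BiphotonSpace))] with x hx ν
    exact (hx ν).trans (amplitude_smul c (x, ν))

theorem norm_amplitudeMap (hr : 0 < r) (φ : integrableStates) :
    ‖amplitudeMap hr φ‖ = ‖(φ : BiphotonSpace)‖ := by
  have h := lintegral_enorm_amplitude_sq hr (Lp.stronglyMeasurable (φ : BiphotonSpace)) φ.2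
    (Lp.memLp _)
  refine (pow_left_inj₀ (norm_nonneg _) (norm_nonneg _) two_ne_zero).1 ?_
  have key : ∀ {f : ℝ × ℝ → ℂ}, StronglyMeasurable f →
      ∫ z, ‖f z‖ ^ 2 = (∫⁻ z, ‖f z‖ₑ ^ 2).toReal := fun {f} hf => by
    rw [integral_eq_lintegral_of_nonneg_ae (ae_of_all _ fun _ => sq_nonneg _)
      (hf.norm.pow 2).aestronglyMeasurable]
    simp only [← ofReal_norm, ENNReal.ofReal_pow (norm_nonneg _)]
  rw [norm_sq_eq_integral (φ : BiphotonSpace)]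
  change ‖(memLp_amplitude_coe hr φ).toLp _‖ ^ 2 = _
  rw [norm_toLp_sq, key (stronglyMeasurable_amplitude (Lp.stronglyMeasurable _)), h,
    key (Lp.stronglyMeasurable _)]

/-- The amplitude extended to all states. -/
noncomputable def amplitudeIsometry (hr : 0 < r) : BiphotonSpace →ₗᵢ[ℂ] BiphotonSpace where
  toLinearMap := ((amplitudeMap hr).extendOfNorm integrableStates.subtype).toLinearMap
  norm_map' := by
    have hd : DenseRange integrableStates.subtype := by
      simpa [DenseRange] using dense_integrableStates
    refine fun φ => hd.induction_on φ (isClosed_eq (by fun_prop) (by fun_prop)) fun φ => ?_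
    rw [ContinuousLinearMap.coe_coe, LinearMap.extendOfNorm_eq hd
      ⟨1, fun φ => by rw [one_mul]; exact (norm_amplitudeMap hr φ).le⟩, norm_amplitudeMap]
    rfl

theorem amplitudeIsometry_apply (hr : 0 < r) {φ : BiphotonSpace} (hφ : φ ∈ integrableStates) :
    amplitudeIsometry hr φ = (memLp_amplitude_coe hr ⟨φ, hφ⟩).toLp _ :=
  LinearMap.extendOfNorm_eq (f := amplitudeMap hr) (e := integrableStates.subtype)
    (by simpa [DenseRange] using dense_integrableStates)
    ⟨1, fun φ => by rw [one_mul]; exact (norm_amplitudeMap hr φ).le⟩ ⟨φ, hφ⟩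

/-- The joint measurement of time difference and frequency sum. -/
noncomputable def timeFrequencyMeasurement (hr : 0 < r) : POVM (ℝ × ℝ) BiphotonSpace :=
  .ofIsometry (amplitudeIsometry hr)

theorem isTimeFrequencyMeasurement (hr : 0 < r) :
    IsTimeFrequencyMeasurement r (timeFrequencyMeasurement hr) := by
  intro φ hφ
  rw [timeFrequencyMeasurement, POVM.prob_ofIsometry, amplitudeIsometry_apply hr hφ]
  refine withDensity_congr_ae ?_
  filter_upwards [(memLp_amplitude_coe hr ⟨φ, hφ⟩).coeFn_toLp] with z hz
  rw [hz, norm_amplitude_sq hr]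
  rfl

theorem IsTimeFrequencyMeasurement.effect_eq {M M' : POVM (ℝ × ℝ) BiphotonSpace}
    (h : IsTimeFrequencyMeasurement r M) (h' : IsTimeFrequencyMeasurement r M') {E : Set (ℝ × ℝ)}
    (hE : MeasurableSet E) : M.effect E = M'.effect E :=
  POVM.effect_eq_of_dense dense_integrableStates (fun φ hφ => (h φ hφ).trans (h' φ hφ).symm) hE

end TimeFrequency

/-! ### The biphoton under the joint measurement -/

open scoped NNReal

theorem memLp_add_const_gaussianReal (m a : ℝ) (v : ℝ≥0) :
    MemLp (fun x => x + a) 2 (ProbabilityTheory.gaussianReal m v) :=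
  (ProbabilityTheory.memLp_id_gaussianReal 2).add (memLp_const a)

theorem integral_add_const_gaussianReal (m a : ℝ) (v : ℝ≥0) :
    ∫ x, (x + a) ∂(ProbabilityTheory.gaussianReal m v) = m + a := by
  have h : Integrable (fun x : ℝ => x) (ProbabilityTheory.gaussianReal m v) :=
    (ProbabilityTheory.memLp_id_gaussianReal 1).integrable le_rfl
  rw [integral_add h (integrable_const a), ProbabilityTheory.integral_id_gaussianReal]
  simp

theorem integral_add_const_sq_gaussianReal (m a : ℝ) (v : ℝ≥0) :
    ∫ x, (x + a) ^ 2 ∂(ProbabilityTheory.gaussianReal m v) = v + (m + a) ^ 2 := by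
  have h := ProbabilityTheory.variance_eq_sub (memLp_add_const_gaussianReal m a v)
  rw [ProbabilityTheory.variance_add_const (by fun_prop), integral_add_const_gaussianReal] at h
  have h2 := ProbabilityTheory.variance_fun_id_gaussianReal (μ := m) (v := v)
  rw [h2] at h
  have h3 : ∫ x, (x + a) ^ 2 ∂(ProbabilityTheory.gaussianReal m v) =
      ∫ x, ((fun x => x + a) ^ 2) x ∂(ProbabilityTheory.gaussianReal m v) := rfl
  rw [h3]
  linarith

namespace Biphoton

variable (B : Biphoton)

/-- The ratio of the bandwidths. -/
noncomputable def ratio : ℝ := B.σi / B.σ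

theorem ratio_pos : 0 < B.ratio := div_pos B.σi_pos B.σ_pos

theorem one_sub_κ_pos : 0 < 1 - B.κ := sub_pos.2 B.κ_lt_one

theorem one_add_κ_pos : 0 < 1 + B.κ := by linarith [B.κ_nonneg]

/-- The wave function on a line of constant time difference, times the plane wave of frequency sum
`ν`, is a Gaussian in the signal time `s`, counted from the central time. -/
theorem exp_mul_wave_linePoint (θ : Fin 2 → ℝ) (x ν s : ℝ) :
    Complex.exp (Complex.I * ν * ((s + θ 0 : ℝ) : ℂ)) *
      B.wave θ (linePoint B.ratio x (s + θ 0)) =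
    ((√(2 * B.σ * B.σi / Real.pi) * (1 - B.κ ^ 2) ^ (1 / 4 : ℝ) : ℝ) : ℂ) *
      Complex.exp (((-(2 * (1 - B.κ) * B.σ ^ 2) : ℝ) : ℂ) * s ^ 2 +
        (((2 * (1 - B.κ) * B.σ ^ 2 * (x - θ 0 + B.ratio * B.tI) : ℝ) : ℂ) +
          ((ν - θ 1 - B.ωI / B.ratio : ℝ) : ℂ) * Complex.I) * s +
        (((-(B.σ ^ 2 * (x - θ 0 + B.ratio * B.tI) ^ 2) : ℝ) : ℂ) +
          ((ν * θ 0 + B.ωI / B.ratio * (x - θ 0 + B.ratio * B.tI) : ℝ) : ℂ) * Complex.I)) := by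
  have hr := B.ratio_pos.ne'
  have hσi : B.σi = B.ratio * B.σ := by rw [ratio, div_mul_cancel₀ _ B.σ_pos.ne']
  rw [wave, mul_left_comm, ← Complex.exp_add]
  congr 2
  simp only [linePoint]
  have hr' : (B.ratio : ℂ) ≠ 0 := by exact_mod_cast hr
  have e1 : (s + θ 0 - x) / B.ratio - B.tI = (s - (x - θ 0 + B.ratio * B.tI)) / B.ratio := by
    field_simp
    ring
  have e2 : -(s + θ 0 - θ 0) ^ 2 * B.σ ^ 2 - ((s + θ 0 - x) / B.ratio - B.tI) ^ 2 * B.σi ^ 2 +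
      2 * B.κ * (s + θ 0 - θ 0) * ((s + θ 0 - x) / B.ratio - B.tI) * B.σ * B.σi =
      -(2 * (1 - B.κ) * B.σ ^ 2) * s ^ 2 +
        2 * (1 - B.κ) * B.σ ^ 2 * (x - θ 0 + B.ratio * B.tI) * s -
          B.σ ^ 2 * (x - θ 0 + B.ratio * B.tI) ^ 2 := by
    rw [e1, hσi]
    field_simp
    ring
  rw [e2, e1]
  push_cast
  field_simp
  ring

theorem norm_sq_angularTransform_wave (θ : Fin 2 → ℝ) (x ν : ℝ) :
    ‖angularTransform (fun y => B.wave θ (linePoint B.ratio x y)) ν‖ ^ 2 =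
      2 * B.σ * B.σi / Real.pi * B.coκ * (Real.pi / (2 * (1 - B.κ) * B.σ ^ 2)) *
        Real.exp (-((1 + B.κ) * B.σ ^ 2 * (x - θ 0 + B.ratio * B.tI) ^ 2) -
          (ν - θ 1 - B.ωI / B.ratio) ^ 2 / (4 * (1 - B.κ) * B.σ ^ 2)) := by
  have hκ := B.one_sub_κ_pos
  have hσ := B.σ_pos
  have hσi := B.σi_pos
  have hpi := Real.pi_pos
  have hb : 0 < 2 * (1 - B.κ) * B.σ ^ 2 := by positivity
  have hq : ((1 - B.κ ^ 2) ^ (1 / 4 : ℝ)) ^ 2 = B.coκ := by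
    rw [coκ, Real.sqrt_eq_rpow, ← Real.rpow_natCast, ← Real.rpow_mul B.one_sub_κ_sq_pos.le]
    norm_num
  rw [angularTransform, ← integral_add_right_eq_self _ (θ 0)]
  simp only [B.exp_mul_wave_linePoint]
  rw [integral_const_mul, integral_cexp_quadratic (by rw [Complex.ofReal_re]; linarith)]
  set b := 2 * (1 - B.κ) * B.σ ^ 2 with hbdef
  set d := x - θ 0 + B.ratio * B.tI
  set μ := ν - θ 1 - B.ωI / B.ratio
  have h1 : (Real.pi : ℂ) / -((-b : ℝ) : ℂ) = ((Real.pi / b : ℝ) : ℂ) := by push_cast; ring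
  have h2 : ‖((Real.pi / b : ℝ) : ℂ) ^ (1 / 2 : ℂ)‖ ^ 2 = Real.pi / b := by
    rw [Complex.norm_cpow_eq_rpow_re_of_pos (by positivity), ← Real.rpow_natCast,
      ← Real.rpow_mul (by positivity)]
    norm_num
  rw [h1, norm_mul, norm_mul, mul_pow, mul_pow, h2, Complex.norm_exp, ← Real.exp_nat_mul,
    Complex.norm_real, Real.norm_eq_abs, sq_abs, mul_pow, hq, Real.sq_sqrt (by positivity),
    mul_assoc (_ * B.coκ)]
  congr 3
  have h3 : ∀ e : ℝ, (((-(B.σ ^ 2 * d ^ 2) : ℝ) : ℂ) + (e : ℂ) * Complex.I) -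
      (((b * d : ℝ) : ℂ) + (μ : ℂ) * Complex.I) ^ 2 / (4 * ((-b : ℝ) : ℂ)) =
      ((-(B.σ ^ 2 * d ^ 2) + (b ^ 2 * d ^ 2 - μ ^ 2) / (4 * b) : ℝ) : ℂ) +
        ((e + d * μ / 2 : ℝ) : ℂ) * Complex.I := fun e => by
    have hb' : (b : ℂ) ≠ 0 := by exact_mod_cast hb.ne'
    push_cast
    field_simp
    linear_combination (2 * μ ^ 2 : ℂ) * Complex.I_sq
  rw [h3, Complex.add_re, Complex.ofReal_re, Complex.re_ofReal_mul, Complex.I_re, hbdef]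
  field_simp
  push_cast
  ring

/-- The variances of time difference and frequency sum. -/
noncomputable def lineVariance (j : Fin 2) : ℝ≥0 :=
  ![Real.toNNReal (2 * (1 + B.κ) * B.σ ^ 2)⁻¹, Real.toNNReal (2 * (1 - B.κ) * B.σ ^ 2)] j

theorem coe_lineVariance_zero : (B.lineVariance 0 : ℝ) = (2 * (1 + B.κ) * B.σ ^ 2)⁻¹ := by
  have h1 := B.one_add_κ_pos
  exact Real.coe_toNNReal _ (by positivity)

theorem coe_lineVariance_one : (B.lineVariance 1 : ℝ) = 2 * (1 - B.κ) * B.σ ^ 2 := by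
  have h1 := B.one_sub_κ_pos
  exact Real.coe_toNNReal _ (by positivity)

/-- The law of time difference and frequency sum: independent Gaussians. -/
noncomputable def lineLaw (θ : Fin 2 → ℝ) : Measure (ℝ × ℝ) :=
  (ProbabilityTheory.gaussianReal (θ 0 - B.ratio * B.tI) (B.lineVariance 0)).prod
    (ProbabilityTheory.gaussianReal (θ 1 + B.ωI / B.ratio) (B.lineVariance 1))

theorem lineLaw_eq (θ : Fin 2 → ℝ) : B.lineLaw θ =
    (volume : Measure (ℝ × ℝ)).withDensity fun z => ENNReal.ofReal ((2 * Real.pi * B.ratio)⁻¹ *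
      ‖angularTransform (fun y => B.wave θ (linePoint B.ratio z.1 y)) z.2‖ ^ 2) := by
  have hκ := B.one_sub_κ_pos
  have hκ' := B.one_add_κ_pos
  have hσ := B.σ_pos
  have hσi := B.σi_pos
  have hpi := Real.pi_pos
  have hv0 : B.lineVariance 0 ≠ 0 := by
    rw [← NNReal.coe_ne_zero, coe_lineVariance_zero]
    positivity
  have hv1 : B.lineVariance 1 ≠ 0 := by
    rw [← NNReal.coe_ne_zero, coe_lineVariance_one]
    positivity
  rw [lineLaw, ProbabilityTheory.gaussianReal_of_var_ne_zero _ hv0,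
    ProbabilityTheory.gaussianReal_of_var_ne_zero _ hv1,
    prod_withDensity (by fun_prop) (by fun_prop), ← Measure.volume_eq_prod]
  congr 1
  ext z
  rw [ProbabilityTheory.gaussianPDF, ProbabilityTheory.gaussianPDF,
    ← ENNReal.ofReal_mul (ProbabilityTheory.gaussianPDFReal_nonneg _ _ _)]
  congr 1
  rw [ProbabilityTheory.gaussianPDFReal, ProbabilityTheory.gaussianPDFReal,
    B.norm_sq_angularTransform_wave, coe_lineVariance_zero, coe_lineVariance_one]
  have h1 : (√(2 * Real.pi * (2 * (1 + B.κ) * B.σ ^ 2)⁻¹))⁻¹ *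
      (√(2 * Real.pi * (2 * (1 - B.κ) * B.σ ^ 2)))⁻¹ = B.coκ / (2 * Real.pi * (1 - B.κ)) := by
    rw [← mul_inv, ← Real.sqrt_mul (by positivity)]
    have h2 : 2 * Real.pi * (2 * (1 + B.κ) * B.σ ^ 2)⁻¹ *
        (2 * Real.pi * (2 * (1 - B.κ) * B.σ ^ 2)) =
          (2 * Real.pi * (1 - B.κ) / B.coκ) ^ 2 := by
      rw [div_pow, B.coκ_sq, show 1 - B.κ ^ 2 = (1 - B.κ) * (1 + B.κ) by ring]
      field_simp
    have hc := B.coκ_pos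
    rw [h2, Real.sqrt_sq (by positivity), inv_div]
  have h3 : (2 * Real.pi * B.ratio)⁻¹ * (2 * B.σ * B.σi / Real.pi * B.coκ *
      (Real.pi / (2 * (1 - B.κ) * B.σ ^ 2))) = B.coκ / (2 * Real.pi * (1 - B.κ)) := by
    rw [ratio]
    field_simp
  rw [mul_mul_mul_comm, h1, ← Real.exp_add, ← h3, mul_assoc]
  congr 3
  field_simp
  ring

theorem integrable_wave (θ : Fin 2 → ℝ) : Integrable (B.wave θ) := by
  have hκ := B.one_sub_κ_pos
  set N := |√(2 * B.σ * B.σi / Real.pi) * (1 - B.κ ^ 2) ^ (1 / 4 : ℝ)| with hN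
  have h1 : Integrable (fun t : ℝ => Real.exp (-((1 - B.κ) * B.σ ^ 2) * (t - θ 0) ^ 2)) :=
    (integrable_exp_neg_mul_sq (by have := B.σ_pos; positivity)).comp_sub_right (θ 0)
  have h2 : Integrable (fun t : ℝ => Real.exp (-((1 - B.κ) * B.σi ^ 2) * (t - B.tI) ^ 2)) :=
    (integrable_exp_neg_mul_sq (by have := B.σi_pos; positivity)).comp_sub_right B.tI
  refine ((h1.mul_prod h2).const_mul N).mono' (B.continuous_wave θ).aestronglyMeasurable
    (ae_of_all _ fun z => ?_)
  rw [B.norm_wave, ← Real.exp_add]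
  refine mul_le_mul_of_nonneg_left (Real.exp_le_exp.2 ?_) (by positivity)
  nlinarith [mul_nonneg B.κ_nonneg
    (sq_nonneg ((z.1 - θ 0) * B.σ - (z.2 - B.tI) * B.σi))]

theorem prob_state_eq_lineLaw {M : POVM (ℝ × ℝ) BiphotonSpace}
    (hM : IsTimeFrequencyMeasurement B.ratio M) (θ : Fin 2 → ℝ) :
    M.prob (B.state θ) = B.lineLaw θ := by
  have hs : (B.state θ : ℝ × ℝ → ℂ) =ᵐ[volume] B.wave θ := (B.memLp_wave θ).coeFn_toLp
  rw [hM _ ((B.integrable_wave θ).congr hs.symm), lineLaw_eq]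
  refine withDensity_congr_ae (ae_prod_of_ae_forall ?_)
  filter_upwards [amplitude_ae_congr B.ratio_pos hs] with x hx ν
  have h := congrArg (fun w => ENNReal.ofReal (‖w‖ ^ 2)) (hx ν)
  simp only [norm_amplitude_sq B.ratio_pos] at h
  exact h

/-- The outcome, corrected for the known central time and frequency of the idler. -/
noncomputable def lineEstimator (j : Fin 2) (z : ℝ × ℝ) : ℝ :=
  ![z.1 + B.ratio * B.tI, z.2 + -(B.ωI / B.ratio)] j

theorem memLp_lineEstimator (θ : Fin 2 → ℝ) (j : Fin 2) :
    MemLp (B.lineEstimator j) 2 (B.lineLaw θ) := by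
  fin_cases j
  · exact (memLp_add_const_gaussianReal _ _ _).comp_fst _
  · exact (memLp_add_const_gaussianReal _ _ _).comp_snd _

theorem integral_lineEstimator (θ : Fin 2 → ℝ) (j : Fin 2) :
    ∫ z, B.lineEstimator j z ∂(B.lineLaw θ) = θ j := by
  fin_cases j
  · refine (integral_fun_fst fun x => x + B.ratio * B.tI).trans ?_
    rw [integral_add_const_gaussianReal, probReal_univ, one_smul, sub_add_cancel]
    rfl
  · refine (integral_fun_snd fun x => x + -(B.ωI / B.ratio)).trans ?_
    rw [integral_add_const_gaussianReal, probReal_univ, one_smul, add_neg_cancel_right]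
    rfl

theorem integral_lineEstimator_sq (θ : Fin 2 → ℝ) (j : Fin 2) :
    ∫ z, B.lineEstimator j z ^ 2 ∂(B.lineLaw θ) = B.lineVariance j + θ j ^ 2 := by
  fin_cases j
  · refine (integral_fun_fst fun x => (x + B.ratio * B.tI) ^ 2).trans ?_
    rw [integral_add_const_sq_gaussianReal, probReal_univ, one_smul, sub_add_cancel]
    rfl
  · refine (integral_fun_snd fun x => (x + -(B.ωI / B.ratio)) ^ 2).trans ?_
    rw [integral_add_const_sq_gaussianReal, probReal_univ, one_smul, add_neg_cancel_right]
    rfl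

variable {M : POVM (ℝ × ℝ) BiphotonSpace}

theorem isLocallyUnbiased_lineEstimator (hM : IsTimeFrequencyMeasurement B.ratio M)
    (θ : Fin 2 → ℝ) : IsLocallyUnbiased (B.model M) θ B.lineEstimator := by
  have hlaw : B.model M = B.lineLaw := funext (B.prob_state_eq_lineLaw hM)
  rw [hlaw]
  refine ⟨fun j => ?_, ?_, fun j => B.integral_lineEstimator θ j, fun j k => ?_⟩
  · fin_cases j
    · exact measurable_fst.add_const _
    · exact measurable_snd.add_const _
  · refine ⟨∑ j, (B.lineVariance j + (θ j ^ 2 + 1)), ?_⟩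
    have h : ∀ᶠ η : Fin 2 → ℝ in 𝓝 θ, ∀ j, η j ^ 2 < θ j ^ 2 + 1 :=
      eventually_all.2 fun j => (by fun_prop : Continuous fun η : Fin 2 → ℝ => η j ^ 2).tendsto θ
        |>.eventually_lt_const (lt_add_one _)
    filter_upwards [h] with η hη j
    refine ⟨B.memLp_lineEstimator η j, ?_⟩
    rw [B.integral_lineEstimator_sq]
    refine (by linarith [hη j] : _ ≤ (B.lineVariance j : ℝ) + (θ j ^ 2 + 1)).trans ?_
    exact Finset.single_le_sum (f := fun j => (B.lineVariance j : ℝ) + (θ j ^ 2 + 1))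
      (fun _ _ => by positivity) (Finset.mem_univ j)
  · simp only [B.integral_lineEstimator]
    by_cases hjk : j = k
    · subst hjk
      simpa using hasDerivAt_id' (θ j)
    · simpa [hjk] using hasDerivAt_const (θ k) (θ j)

theorem stdDev_lineEstimator (hM : IsTimeFrequencyMeasurement B.ratio M) (θ : Fin 2 → ℝ) :
    stdDev (B.model M θ) (B.lineEstimator 0) * stdDev (B.model M θ) (B.lineEstimator 1) =
      refinedBound B.κ := by
  have hlaw : B.model M θ = B.lineLaw θ := B.prob_state_eq_lineLaw hM θ
  have hvar : ∀ j, ProbabilityTheory.variance (B.lineEstimator j) (B.lineLaw θ) =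
      B.lineVariance j := fun j => by
    have : IsProbabilityMeasure (B.lineLaw θ) := by
      unfold lineLaw
      infer_instance
    rw [ProbabilityTheory.variance_eq_sub (B.memLp_lineEstimator θ j), B.integral_lineEstimator]
    refine (congrArg (· - θ j ^ 2) (B.integral_lineEstimator_sq θ j)).trans ?_
    ring
  have hκ := B.one_sub_κ_pos
  have hκ' := B.one_add_κ_pos
  have hσ := B.σ_pos
  rw [hlaw, stdDev, stdDev, hvar, hvar, ← Real.sqrt_mul NNReal.zero_le_coe, refinedBound,
    coe_lineVariance_zero, coe_lineVariance_one]
  congr 1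
  field_simp

end Biphoton

end QuantumRadar

theorem mainTheorem3 (B : QuantumRadar.Biphoton) :
    -- the quantum Fisher information matrix
    (∀ (θ : Fin 2 → ℝ) (FQ : Matrix (Fin 2) (Fin 2) ℝ),
      QuantumRadar.IsQFIM B.state θ FQ ↔
        FQ = !![4 * B.σ ^ 2, 0; 0, 1 / (B.σ ^ 2 * (1 - B.κ ^ 2))]) ∧
    -- the trade-off and the uncertainty relation, for every measurement
    (∀ (X : Type*) [MeasurableSpace X] (M : QuantumRadar.POVM X QuantumRadar.BiphotonSpace)
      (θ : Fin 2 → ℝ),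
      (∃! FC : Matrix (Fin 2) (Fin 2) ℝ, QuantumRadar.IsCFIM (B.model M) θ FC) ∧
      (∀ FQ FC : Matrix (Fin 2) (Fin 2) ℝ, QuantumRadar.IsQFIM B.state θ FQ →
        QuantumRadar.IsCFIM (B.model M) θ FC → (FQ⁻¹ * FC).trace ≤ 1 + B.κ) ∧
      (∀ est : Fin 2 → X → ℝ, QuantumRadar.IsLocallyUnbiased (B.model M) θ est →
        QuantumRadar.refinedBound B.κ ≤
          QuantumRadar.stdDev (B.model M θ) (est 0) * QuantumRadar.stdDev (B.model M θ) (est 1))) ∧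
    -- attainability by projective measurements with finitely many outcomes
    (∀ θ : Fin 2 → ℝ, ∃ (n : ℕ) (M : QuantumRadar.POVM (Fin n) QuantumRadar.BiphotonSpace),
      M.IsProjective ∧
      (∀ FQ FC : Matrix (Fin 2) (Fin 2) ℝ, QuantumRadar.IsQFIM B.state θ FQ →
        QuantumRadar.IsCFIM (B.model M) θ FC → (FQ⁻¹ * FC).trace = 1 + B.κ) ∧
      ∃ est : Fin 2 → Fin n → ℝ, QuantumRadar.IsLocallyUnbiased (B.model M) θ est ∧
        QuantumRadar.stdDev (B.model M θ) (est 0) * QuantumRadar.stdDev (B.model M θ) (est 1) =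
          QuantumRadar.refinedBound B.κ) ∧
    -- saturation, at all parameter values at once, by the continuous-spectrum measurement
    (∃ M : QuantumRadar.POVM (ℝ × ℝ) QuantumRadar.BiphotonSpace,
      QuantumRadar.IsTimeFrequencyMeasurement (B.σi / B.σ) M ∧
      (∀ M' : QuantumRadar.POVM (ℝ × ℝ) QuantumRadar.BiphotonSpace,
        QuantumRadar.IsTimeFrequencyMeasurement (B.σi / B.σ) M' →
          ∀ E, MeasurableSet E → M'.effect E = M.effect E) ∧
      (∀ (θ : Fin 2 → ℝ) (FQ FC : Matrix (Fin 2) (Fin 2) ℝ), QuantumRadar.IsQFIM B.state θ FQ →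
        QuantumRadar.IsCFIM (B.model M) θ FC → (FQ⁻¹ * FC).trace = 1 + B.κ) ∧
      ∃ est : Fin 2 → ℝ × ℝ → ℝ, ∀ θ : Fin 2 → ℝ,
        QuantumRadar.IsLocallyUnbiased (B.model M) θ est ∧
        QuantumRadar.stdDev (B.model M θ) (est 0) * QuantumRadar.stdDev (B.model M θ) (est 1) =
          QuantumRadar.refinedBound B.κ) ∧
    -- interpolation between the Arthurs–Kelly bound and perfect entanglement
    QuantumRadar.refinedBound 0 = 1 ∧
    Tendsto QuantumRadar.refinedBound (𝓝[<] 1) (𝓝 0) := by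
  have hproj := fun θ => QuantumRadar.POVM.isProjective_ofProjections
    (QuantumRadar.completeOrthogonalIdempotents_basisProjection (B.orthonormal_optimalBasis θ))
    (QuantumRadar.isSelfAdjoint_basisProjection (B.orthonormal_optimalBasis θ))
  have hM : QuantumRadar.IsTimeFrequencyMeasurement (B.σi / B.σ)
      (QuantumRadar.timeFrequencyMeasurement B.ratio_pos) :=
    QuantumRadar.isTimeFrequencyMeasurement B.ratio_pos
  refine ⟨B.isQFIM_iff, fun X _ M θ => ⟨M.existsUnique_isCFIM (B.hasDerivAt_state θ),
    fun FQ FC hQ hC => B.trace_le M θ hQ hC, fun est hest => B.refinedBound_le_stdDev_mul M θ hest⟩,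
    fun θ => ⟨4, B.optimalMeasurement θ, hproj θ, fun FQ FC hQ hC => ?_, B.optimalEstimator θ,
      B.isLocallyUnbiased_optimalEstimator θ, B.stdDev_optimalEstimator θ⟩,
    ⟨_, hM, fun M' hM' E hE => hM'.effect_eq hM hE, fun θ FQ FC hQ hC => ?_, B.lineEstimator,
      fun θ => ⟨B.isLocallyUnbiased_lineEstimator hM θ, B.stdDev_lineEstimator hM θ⟩⟩,
    QuantumRadar.refinedBound_zero, QuantumRadar.tendsto_refinedBound⟩
  · exact B.trace_eq_of_stdDev_mul_eq (B.isLocallyUnbiased_optimalEstimator θ)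
      (B.stdDev_optimalEstimator θ) hQ hC
  · exact B.trace_eq_of_stdDev_mul_eq (B.isLocallyUnbiased_lineEstimator hM θ)
      (B.stdDev_lineEstimator hM θ) hQ hC
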